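/- **Setting.** Let $M$ be a compact connected oriented 3-manifold whose boundary is a non-empty union of tori, and let $\mathcal T$ be an oriented ideal triangulation of its interior with $N\ge 2$ tetrahedra (orientation-reversing face pairings are used; two faces of one tetrahedron may be glued to each other). Let $Q$ be the set of normal quadrilateral types (three in each tetrahedron, with the cyclic order $\square\to\square'\to\square''$ given by the orientation), and let $G(E,\square)$ be the number of tetrahedral edges in the edge class $E$ that face $\square$. For an oriented peripheral curve $\gamma$ in normal position (without backtracking) let $G(\gamma,\square)$ be the signed number of times $\gamma$ passes around a corner lying on a tetrahedral edge that faces $\square$, the sign being positive if the corner is passed anticlockwise. Put $$\mathcal{SA}=\Bigl\{\omega:Q\to S^1 : \omega(\square)\omega(\square')\omega(\square'')=-1\ \text{for all }\square,\ \ \prod_\square\omega(\square)^{G(E,\square)}=1\ \text{for all edges }E\Bigr\},$$ and let $\mathcal{SA}_0\subset\mathcal{SA}$ be the subset on which $\prod_\square\omega(\square)^{G(\gamma,\square)}=1$ for all peripheral curves $\gamma$. For a closed curve $\theta$ in $M$ in normal position without backtracking and $\alpha\in\mathbb F_2^Q$, let $\mathrm{par}_\theta(\alpha)$ be the sum of $\alpha(\square)$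 over all passages of $\theta$ through a tetrahedron, where $\square$ is the quad facing the edge common to the face of entry and the face of exit. Let $\mathcal A$ be the set of $\alpha\in\mathbb F_2^Q$ with $\alpha(\square)+\alpha(\square')+\alpha(\square'')=1$ for all $\square$ and $\mathrm{par}_\theta(\alpha)=0$ for all $\theta$. Represent $(M,\partial M)$ by the cell complex $\mathcal T_{00}$ whose 3-cells are the doubly truncated tetrahedra (vertices and edges cut off) and the solid cylinders around the edges; its 2-cells are the large hexagons in the faces of $\mathcal T$, the rectangles along the edges of the tetrahedra, the boundary hexagons and the edge discs, the last two types lying in $\partial M$. For $\alpha\in\mathcal A$ let $\mathrm{rect}(\alpha)$ be the relative 2-cocycle that takes the value $\alpha(\square)$ on each rectangle parallel to $\square$ and vanishes on all other 2-cells. An *algebraic solution* is a function $z:Q\to\mathbb C\setminus\{0,1\}$ with $z(\square')=1/(1-z(\square))$ and $\prod_\square z(\square)^{G(E,\square)}=1$ for all edges $E$. By developing ideal hyperbolic tetrahedra of shapes $z$ it determines a representation $\rho_z:\pi_1(M)\to PSL(2,\mathbb C)$, up to conjugation. A representation is *boundary-parabolic* if it sends the fundamental group of each boundary torus into a conjugate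 of $\{w\mapsto w+b\}$, and an $SL(2,\mathbb C)$-representation is *boundary-unipotent* if it sends each of these groups into a conjugate of the group of upper triangular matrices with diagonal entries $1$. For $\rho:\pi_1(M)\to PSL(2,\mathbb C)$ let $\mathrm{Obs}(\rho)\in H^2(M;\mathbb F_2)$ be the obstruction to lifting $\rho$ to $SL(2,\mathbb C)$: take any labelling of the oriented 1-cells by elements of $SL(2,\mathbb C)$ that projects to a $PSL(2,\mathbb C)$-cocycle for $\rho$; its products around the 2-cells are $\pm1$ and form a cocycle representing $\mathrm{Obs}(\rho)$. If $\rho$ is boundary-parabolic, let $\mathrm{Obs}_0(\rho)\in H^2(M,\partial M;\mathbb F_2)$ be the obstruction to lifting it to a boundary-unipotent $SL(2,\mathbb C)$-representation, defined in the same way by labellings that restrict to an $SL(2,\mathbb C)$-cocycle with unipotent monodromy on every boundary component. A *strong flattening* of $z$ is a pair $W:Q\to\mathbb C$, $f:Q\to\mathbb Z$ with $\exp(W+i\pi f)=z$, $W(\square)+W(\square')+W(\square'')=0$ for all $\square$, $\sum_\square G(E,\square)W(\square)=0$ for all $E$, $\sum_\square G(\gamma,\square)W(\square)=0$ for all peripheral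 curves $\gamma$, and $\mathrm{par}_\theta(f\bmod 2)=0$ for all $\theta$. Without the condition on peripheral curves it is called an *edge flattening*. **Theorem.** There are maps $\Phi:\mathcal{SA}\to H^2(M;\mathbb F_2)$ and $\Phi_0:\mathcal{SA}_0\to H^2(M,\partial M;\mathbb F_2)$ with the following properties. 1. $\Phi$ and $\Phi_0$ are continuous for the discrete topology on the targets (locally constant), hence constant on connected components. 2. The induced map $\pi_0(\mathcal{SA}_0)\to H^2(M,\partial M;\mathbb F_2)$ is a bijection; the induced map $\pi_0(\mathcal{SA})\to H^2(M;\mathbb F_2)$ is an injection with image $\ker\bigl(\iota^*:H^2(M;\mathbb F_2)\to H^2(\partial M;\mathbb F_2)\bigr)$. 3. For every $\alpha\in\mathcal A$, $(-1)^\alpha\in\mathcal{SA}_0$, $\Phi((-1)^\alpha)=[\mathrm{rect}(\alpha)]$ and $\Phi_0((-1)^\alpha)=[\mathrm{rect}(\alpha)]$. 4. Let $z$ be an algebraic solution, $\rho=\rho_z$ and $\omega=z/|z|$. Then $\omega\in\mathcal{SA}$ and $\Phi(\omega)=\mathrm{Obs}(\rho)$. Edge flattenings $(W,f)$ of $z$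 exist, and for each of them $\delta=f\bmod 2$ lies in $\mathcal A$, $(-1)^\delta$ lies in the connected component of $\omega$ in $\mathcal{SA}$, and $\mathrm{Obs}(\rho)=[\mathrm{rect}(\delta)]$. 5. If $z$ also satisfies the completeness equations $\prod_\square z(\square)^{G(\gamma,\square)}=1$ for all peripheral curves $\gamma$, then $\rho$ is boundary-parabolic. If $\rho$ is boundary-parabolic, then $\omega\in\mathcal{SA}_0$ and $\Phi_0(\omega)=\mathrm{Obs}_0(\rho)$; strong flattenings $(W,f)$ of $z$ exist, and for each of them, with $\delta=f\bmod2$, $(-1)^\delta$ lies in the connected component of $\omega$ in $\mathcal{SA}_0$ and $\mathrm{Obs}_0(\rho)=[\mathrm{rect}(\delta)]$. -/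

import Mathlib

open scoped MatrixGroups

/-! ### Oriented triangulations -/

/-- `N` oriented tetrahedra, each with vertices `0, 1, 2, 3` and oriented by that order, with an
orientation-reversing pairing of their faces.  The face `f` of a tetrahedron is the one opposite to
the vertex `f`.  The face `f` of `t` is glued to the face `gluing t f f` of `adj t f`; the
permutation `gluing t f` sends each of the three vertices of the face to the vertex with which it is
identified.  With the above orientations the identification of the two faces reverses the
orientation exactly if this permutation is odd.  No face is left unglued or glued to itself. -/
structure FacePairing (N : ℕ) where
  adj : Fin N → Fin 4 → Fin N
  gluing : Fin N → Fin 4 → Equiv.Perm (Fin 4)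
  adj_adj : ∀ t f, adj (adj t f) (gluing t f f) = t
  gluing_gluing : ∀ t f, gluing (adj t f) (gluing t f f) = (gluing t f)⁻¹
  odd : ∀ t f, Equiv.Perm.sign (gluing t f) = -1
  distinct : ∀ t f, (adj t f, gluing t f f) ≠ (t, f)

/-- The three kinds of edges of a doubly truncated tetrahedron, and the passage from one side of a
face of the triangulation to the other side. -/
inductive Move
  | long
  | medium
  | short
  | glue
  deriving DecidableEq

/-- The normal quadrilateral type `k` of a tetrahedron separates the edge `{0, k+1}` from the
opposite edge.  It is faced by these two edges.  `quadType a b` is the type faced by the edge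
`{a, b}`, which is also the type faced by the edge common to the faces `a` and `b`.
The cyclic order `□ → □' → □''` is `k → k + 1`; it runs anticlockwise around every ideal vertex, as
seen from that vertex. (The value at `a = b` is never used.) -/
def quadType (a b : Fin 4) : Fin 3 :=
  ![![0, 0, 1, 2], ![0, 0, 2, 1], ![1, 2, 0, 0], ![2, 1, 0, 0]] a b

theorem quadType_comm (a b : Fin 4) : quadType a b = quadType b a := by
  revert a b; decide

theorem quadType_compl (p : Equiv.Perm (Fin 4)) :
    quadType (p 2) (p 3) = quadType (p 0) (p 1) := by
  revert p; decide

namespace FacePairing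

variable {N : ℕ} (T : FacePairing N)

/-- A flag of a tetrahedron: a vertex, an edge and a face, each contained in the next.
The pair `(t, p)` stands for the vertex `p 0`, the edge `{p 0, p 1}` and the face
`{p 0, p 1, p 2}` of `t`, i.e. the face opposite to the vertex `p 3`.
The flags of `t` are the vertices of the doubly truncated tetrahedron `t`. -/
abbrev Flag (_ : FacePairing N) : Type := Fin N × Equiv.Perm (Fin 4)

/-- `long` changes the vertex of a flag, `medium` the edge, `short` the face, leaving the rest of
the flag as it is; `glue` passes to the same flag in the tetrahedron on the other side of the
face. -/
def move : Move → T.Flag → T.Flag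
  | .long, y => (y.1, y.2 * Equiv.swap 0 1)
  | .medium, y => (y.1, y.2 * Equiv.swap 1 2)
  | .short, y => (y.1, y.2 * Equiv.swap 2 3)
  | .glue, y => (T.adj y.1 (y.2 3), T.gluing y.1 (y.2 3) * y.2)

theorem move_involutive (c : Move) : Function.Involutive (T.move c) := by
  rintro ⟨t, p⟩
  cases c
  · simp [move, mul_assoc]
  · simp [move, mul_assoc]
  · simp [move, mul_assoc]
  · simp [move, T.adj_adj, T.gluing_gluing]

/-! ### The cell complex of doubly truncated tetrahedra -/

/-- Flags up to the moves in `S`. -/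
def Cell (S : Finset Move) : Type :=
  Quot fun y y' : T.Flag => ∃ c ∈ S, y' = T.move c y

variable {T} in
/-- The cell that contains a flag. -/
def cell (S : Finset Move) (y : T.Flag) : T.Cell S := Quot.mk _ y

variable {T} in
def Cell.proj {S S' : Finset Move} (h : S ⊆ S') (Y : T.Cell S) : T.Cell S' :=
  Quot.map id (fun _ _ ⟨c, hc, e⟩ => ⟨c, h hc, e⟩) Y

instance (S : Finset Move) : Finite (T.Cell S) :=
  inferInstanceAs (Finite (Quot _))

noncomputable instance (S : Finset Move) : Fintype (T.Cell S) := Fintype.ofFinite _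

/- The cells of the complex `T₀₀`, which decomposes the compact manifold `M` into the doubly
truncated tetrahedra and the solid cylinders around the edges of the triangulation.  A cell is given
by the set of flags that lie on it (for a cell in a face of the triangulation: on both sides). -/

/-- 0-cells -/
abbrev Vertices := T.Cell {.glue}
/-- 1-cells parallel to the edges of the triangulation -/
abbrev LongEdges := T.Cell {.long, .glue}
/-- 1-cells on the boundary, in the faces of the triangulation -/
abbrev MediumEdges := T.Cell {.medium, .glue}
/-- 1-cells on the boundary, encircling the ends of the edges of the triangulation -/
abbrev ShortEdges := T.Cell {.short}
/-- 2-cells in the faces of the triangulation -/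
abbrev LargeHexagons := T.Cell {.long, .medium, .glue}
/-- 2-cells along the edges of the tetrahedra; also, the edges of the unglued tetrahedra -/
abbrev Rectangles := T.Cell {.long, .short}
/-- 2-cells on the boundary, one at each vertex of each tetrahedron -/
abbrev BoundaryHexagons := T.Cell {.medium, .short}
/-- 2-cells on the boundary, capping off the cylinders around the edges of the triangulation -/
abbrev EdgeDiscs := T.Cell {.short, .glue}
/-- 3-cells: the doubly truncated tetrahedra -/
abbrev Tetrahedra := T.Cell {.long, .medium, .short}
/-- The edges of the triangulation; also, the 3-cells that are cylinders around them -/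
abbrev Edges := T.Cell {.long, .short, .glue}
/-- The ideal vertices of the triangulation; also, the components of the boundary of `M` -/
abbrev Ends := T.Cell {.medium, .short, .glue}

/-- The Euler characteristic of a boundary component of `M`. -/
noncomputable def eulerChar (V : T.Ends) : ℤ :=
  (Nat.card {Y : T.Vertices // Y.proj (by decide) = V} : ℤ)
    - Nat.card {Y : T.MediumEdges // Y.proj (by decide) = V}
    - Nat.card {Y : T.ShortEdges // Y.proj (by decide) = V}
    + Nat.card {Y : T.BoundaryHexagons // Y.proj (by decide) = V}
    + Nat.card {Y : T.EdgeDiscs // Y.proj (by decide) = V}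

/-- `T` is an ideal triangulation, with at least two tetrahedra, of the interior `M` of a compact
connected oriented 3-manifold whose boundary consists of tori: the boundary components are closed
connected oriented surfaces, so they are tori exactly if their Euler characteristic is zero. -/
structure IsIdealTriangulation : Prop where
  two_le : 2 ≤ N
  connected : ∀ s t : Fin N, Relation.ReflTransGen (fun a b => ∃ f, T.adj a f = b) s t
  torus : ∀ V : T.Ends, T.eulerChar V = 0

/-! ### Cellular cohomology with coefficients in the field of two elements -/

open Classical in
/-- One summand of a coboundary map.  The value at a cell `X` is the sum of the values of the cochain
`c` over those sides of `X` (counted in a polygon or polyhedron with no identification of sides)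
that are orbits of flags under the moves in `S₁`. -/
noncomputable def sides (S₁ : Finset Move) {S S' : Finset Move} (h : S₁ ⊆ S) (h' : S₁ ⊆ S') :
    (T.Cell S' → ZMod 2) →ₗ[ZMod 2] (T.Cell S → ZMod 2) where
  toFun c X := ∑ Y : T.Cell S₁ with Y.proj h = X, c (Y.proj h')
  map_add' c d := by ext X; simp [Finset.sum_add_distrib]
  map_smul' a c := by ext X; simp [Finset.mul_sum]

/-- 1-cochains that vanish on the boundary -/
abbrev C1rel := T.LongEdges → ZMod 2
/-- 1-cochains of the boundary -/
abbrev C1bd := (T.MediumEdges → ZMod 2) × (T.ShortEdges → ZMod 2)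
abbrev C1 := T.C1rel × T.C1bd
/-- 2-cochains that vanish on the boundary -/
abbrev C2rel := (T.LargeHexagons → ZMod 2) × (T.Rectangles → ZMod 2)
/-- 2-cochains of the boundary -/
abbrev C2bd := (T.BoundaryHexagons → ZMod 2) × (T.EdgeDiscs → ZMod 2)
abbrev C2 := T.C2rel × T.C2bd
abbrev C3 := (T.Tetrahedra → ZMod 2) × (T.Edges → ZMod 2)

/-- The coboundary of a 1-cochain of the boundary. -/
noncomputable def d1bd : T.C1bd →ₗ[ZMod 2] T.C2bd where
  toFun c :=
    (T.sides {.medium} (by decide) (by decide) c.1 + T.sides {.short} (by decide) (by decide) c.2,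
     T.sides {.short} (by decide) (by decide) c.2)
  map_add' c d := by ext <;> simp <;> ring
  map_smul' a c := by ext <;> simp

/-- The coboundary of a 1-cochain. -/
noncomputable def d1 : T.C1 →ₗ[ZMod 2] T.C2 where
  toFun c :=
    ((T.sides {.long, .glue} (by decide) (by decide) c.1
        + T.sides {.medium, .glue} (by decide) (by decide) c.2.1,
      T.sides {.long} (by decide) (by decide) c.1
        + T.sides {.short} (by decide) (by decide) c.2.2),
     T.d1bd c.2)
  map_add' c d := by ext <;> simp <;> ring
  map_smul' a c := by ext <;> simp

/-- The coboundary of a 2-cochain. -/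
noncomputable def d2 : T.C2 →ₗ[ZMod 2] T.C3 where
  toFun c :=
    (T.sides {.long, .medium} (by decide) (by decide) c.1.1
        + T.sides {.long, .short} (by decide) (by decide) c.1.2
        + T.sides {.medium, .short} (by decide) (by decide) c.2.1,
     T.sides {.long, .short} (by decide) (by decide) c.1.2
        + T.sides {.short, .glue} (by decide) (by decide) c.2.2)
  map_add' c d := by ext <;> simp <;> ring
  map_smul' a c := by ext <;> simp

/-- 2-cocycles -/
noncomputable def Z2 : Submodule (ZMod 2) T.C2 := LinearMap.ker T.d2
/-- relative 2-cocycles -/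
noncomputable def Z2rel : Submodule (ZMod 2) T.C2rel :=
  LinearMap.ker (T.d2 ∘ₗ LinearMap.inl (ZMod 2) T.C2rel T.C2bd)
/-- coboundaries -/
noncomputable def B2 : Submodule (ZMod 2) T.C2 := LinearMap.range T.d1
/-- coboundaries of relative 1-cochains -/
noncomputable def B2rel : Submodule (ZMod 2) T.C2rel :=
  LinearMap.range
    (LinearMap.fst (ZMod 2) T.C2rel T.C2bd ∘ₗ T.d1 ∘ₗ LinearMap.inl (ZMod 2) T.C1rel T.C1bd)

/-- The cohomology group `H²(M; 𝔽₂)`. -/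
abbrev H2 := T.Z2 ⧸ T.B2.submoduleOf T.Z2
/-- The cohomology group `H²(M, ∂M; 𝔽₂)`. -/
abbrev H2rel := T.Z2rel ⧸ T.B2rel.submoduleOf T.Z2rel
/-- The cohomology group `H²(∂M; 𝔽₂)`. -/
abbrev H2bd := T.C2bd ⧸ LinearMap.range T.d1bd

/-- The map `ι* : H²(M; 𝔽₂) → H²(∂M; 𝔽₂)` induced by the inclusion of the boundary. -/
noncomputable def restrict : T.H2 →ₗ[ZMod 2] T.H2bd :=
  Submodule.mapQ _ _ (LinearMap.snd (ZMod 2) T.C2rel T.C2bd ∘ₗ T.Z2.subtype) (by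
    rintro ⟨σ, hσ⟩ ⟨c, hc⟩
    exact ⟨c.2, congrArg Prod.snd hc⟩)

/-- `σ` is a cocycle in the cohomology class `c`. -/
def Represents (σ : T.C2) (c : T.H2) : Prop :=
  ∃ h : σ ∈ T.Z2, (Submodule.Quotient.mk ⟨σ, h⟩ : T.H2) = c

/-- `σ` is a relative cocycle in the relative cohomology class `c`. -/
def RepresentsRel (σ : T.C2rel) (c : T.H2rel) : Prop :=
  ∃ h : σ ∈ T.Z2rel, (Submodule.Quotient.mk ⟨σ, h⟩ : T.H2rel) = c

/-! ### Normal quadrilaterals, gluing coefficients, curves -/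

/-- Normal quadrilateral types. -/
abbrev Quad (_ : FacePairing N) : Type := Fin N × Fin 3

variable {T} in
/-- The quadrilateral type faced by the edge of a flag. -/
def quadOf (y : T.Flag) : T.Quad := (y.1, quadType (y.2 0) (y.2 1))

/-- The quadrilateral type faced by an edge of a tetrahedron; also, the one parallel to the
rectangle along this edge. -/
def rectQuad (r : T.Rectangles) : T.Quad :=
  Quot.lift quadOf (by
    rintro ⟨t, p⟩ y ⟨c, hc, rfl⟩
    fin_cases hc
    · simp [quadOf, move, quadType_comm]
    · simp [quadOf, move, Equiv.swap_apply_def]) r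

/-- The coefficient `G(E, □)`: the number of edges of tetrahedra in the class `E` facing `□`. -/
noncomputable def G (E : T.Edges) (q : T.Quad) : ℕ :=
  Nat.card {e : T.Rectangles // e.proj (by decide) = E ∧ T.rectQuad e = q}

/-- A closed curve in `M` in normal position with respect to the triangulation and without
backtracking.  It passes through the tetrahedra `tet 0, …, tet len` and returns to `tet 0`; it
enters `tet i` through the face `inFace i` and leaves it through the different face `outFace i`.
(The sum `i + 1` is cyclic.) -/
structure NormalCurve where
  len : ℕ
  tet : Fin (len + 1) → Fin N
  inFace : Fin (len + 1) → Fin 4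
  outFace : Fin (len + 1) → Fin 4
  no_backtrack : ∀ i, inFace i ≠ outFace i
  next_tet : ∀ i, tet (i + 1) = T.adj (tet i) (outFace i)
  next_inFace : ∀ i, inFace (i + 1) = T.gluing (tet i) (outFace i) (outFace i)

variable {T} in
/-- The parity of a vector along a normal curve. -/
def NormalCurve.parity (θ : T.NormalCurve) (α : T.Quad → ZMod 2) : ZMod 2 :=
  ∑ i, α (θ.tet i, quadType (θ.inFace i) (θ.outFace i))

/-- A closed oriented peripheral curve in normal position without backtracking.  It runs through the
triangles cut off by the vertices of the tetrahedra.  In the triangle at the vertex `p 0` of `t` a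
step `(t, p)` enters through the face `p 2`, leaves through the face `p 3`, and so passes around
the corner that lies on the edge `{p 0, p 1}`. -/
structure PeripheralCurve where
  len : ℕ
  step : Fin (len + 1) → T.Flag
  next_tet : ∀ i, (step (i + 1)).1 = (T.move .glue (step i)).1
  next_vertex : ∀ i, (step (i + 1)).2 0 = (T.move .glue (step i)).2 0
  next_inFace : ∀ i, (step (i + 1)).2 2 = (T.move .glue (step i)).2 3

variable {T} in
/-- The coefficient `G(γ, □)`: the number of corners on edges facing `□` that are passed
anticlockwise around the corner, as seen from the ideal vertex, minus those passed clockwise. -/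
def PeripheralCurve.coeff (γ : T.PeripheralCurve) (q : T.Quad) : ℤ :=
  ∑ i, if quadOf (γ.step i) = q then -(Equiv.Perm.sign (γ.step i).2 : ℤ) else 0

/-! ### Angle structures, shapes and flattenings -/

/-- The set of `S¹`-valued angle structures. -/
def SA : Set (T.Quad → Circle) :=
  {ω | (∀ t k, ω (t, k) * ω (t, k + 1) * ω (t, k + 2) = -1) ∧
    ∀ E, ∏ q, ω q ^ T.G E q = 1}

/-- The set of peripherally trivial `S¹`-valued angle structures. -/
def SA₀ : Set (T.Quad → Circle) :=
  {ω | ω ∈ T.SA ∧ ∀ γ : T.PeripheralCurve, ∏ q, ω q ^ γ.coeff q = 1}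

/-- The set of `𝔽₂`-valued angle structures with even parity. -/
def evenAngles : Set (T.Quad → ZMod 2) :=
  {α | (∀ t k, α (t, k) + α (t, k + 1) + α (t, k + 2) = 1) ∧
    ∀ θ : T.NormalCurve, θ.parity α = 0}

variable {T} in
/-- The function `(-1)^α`. -/
noncomputable def signs (α : T.Quad → ZMod 2) : T.Quad → Circle := fun q => (-1) ^ (α q).val

/-- The relative cochain `rect(α)`. -/
def rect (α : T.Quad → ZMod 2) : T.C2rel := (0, fun r => α (T.rectQuad r))

/-- Algebraic solutions of Thurston's gluing equations. -/
structure IsAlgebraicSolution (z : T.Quad → ℂ) : Prop where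
  ne_zero : ∀ q, z q ≠ 0
  ne_one : ∀ q, z q ≠ 1
  next : ∀ t k, z (t, k + 1) = 1 / (1 - z (t, k))
  edge : ∀ E, ∏ q, z q ^ T.G E q = 1

/-- The completeness equations: all peripheral holonomies are trivial. -/
def IsComplete (z : T.Quad → ℂ) : Prop :=
  ∀ γ : T.PeripheralCurve, ∏ q, z q ^ γ.coeff q = 1

/-- All conditions on a strong combinatorial flattening `W = Z - iπf` for `z = exp Z`, except
those along peripheral curves. -/
structure IsEdgeFlattening (z W : T.Quad → ℂ) (f : T.Quad → ℤ) : Prop where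
  exp_eq : ∀ q, Complex.exp (W q + Complex.I * Real.pi * f q) = z q
  tet : ∀ t k, W (t, k) + W (t, k + 1) + W (t, k + 2) = 0
  edge : ∀ E, ∑ q, (T.G E q : ℂ) * W q = 0
  parity : ∀ θ : T.NormalCurve, θ.parity (fun q => (f q : ZMod 2)) = 0

/-- `W = Z - iπf` is a strong combinatorial flattening for `z = exp Z`. -/
structure IsStrongFlattening (z W : T.Quad → ℂ) (f : T.Quad → ℤ) : Prop
    extends T.IsEdgeFlattening z W f where
  peripheral : ∀ γ : T.PeripheralCurve, ∑ q, (γ.coeff q : ℂ) * W q = 0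

/-! ### The fundamental group -/

/-- The action of words in the moves on flags.  A word, read from right to left, is an edge path in
the 1-skeleton; the letter `glue` stands for the constant path at a vertex of `T₀₀`. -/
def act : FreeGroup Move →* Equiv.Perm T.Flag :=
  FreeGroup.lift fun c => (T.move_involutive c).toPerm

/-- Closed edge paths based at `x`. -/
def loops (x : T.Flag) : Subgroup (FreeGroup Move) where
  carrier := {w | T.act w x = x}
  mul_mem' {a b} ha hb := by
    simp only [Set.mem_ofPred_eq, map_mul, Equiv.Perm.mul_apply] at *
    rw [hb, ha]
  one_mem' := by simp
  inv_mem' {a} ha := by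
    simp only [Set.mem_ofPred_eq, map_inv] at *
    rw [Equiv.Perm.inv_eq_iff_eq, ha]

/-- The path around a large hexagon. -/
def largeHexagonWord : FreeGroup Move := (.of .medium * .of .long) ^ 3
/-- The path around a rectangle. -/
def rectangleWord : FreeGroup Move := (.of .short * .of .long) ^ 2
/-- The path around a boundary hexagon. -/
def boundaryHexagonWord : FreeGroup Move := (.of .short * .of .medium) ^ 3
/-- The path around an edge disc, starting at the flag `y`. -/
noncomputable def edgeDiscWord (y : T.Flag) : FreeGroup Move :=
  (.of .short * .of .glue) ^ Function.minimalPeriod (fun x => T.move .short (T.move .glue x)) y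

/-- Closed paths from `y` that are contracted: edges run back and forth (the long and medium ones
possibly on the two sides of a face), and the boundaries of the 2-cells. -/
inductive Contracted (y : T.Flag) : FreeGroup Move → Prop
  | back (c : Move) : Contracted y (.of c * .of c)
  | long_glue : Contracted y ((.of .long * .of .glue) ^ 2)
  | medium_glue : Contracted y ((.of .medium * .of .glue) ^ 2)
  | largeHexagon : Contracted y largeHexagonWord
  | rectangle : Contracted y rectangleWord
  | boundaryHexagon : Contracted y boundaryHexagonWord
  | edgeDisc : Contracted y (T.edgeDiscWord y)

/-- The fundamental group of `M`: closed edge paths modulo the boundaries of the 2-cells.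
In a product `a * b` the path `b` comes first. -/
abbrev FundGroup (x : T.Flag) : Type :=
  T.loops x ⧸ Subgroup.normalClosure
    {l : T.loops x | ∃ w r, T.Contracted (T.act w x) r ∧ (l : FreeGroup Move) = w⁻¹ * r * w}

/-- Paths on the boundary. -/
def boundaryWords : Subgroup (FreeGroup Move) :=
  Subgroup.closure {.of .medium, .of .short, .of .glue}

/-! ### Labellings of the 1-cells and their holonomy -/

/-- A labelling of the oriented 1-cells by elements of a group: `label c y` is the label of the edge
that leads from `y` to `move c y`. -/
structure Labelling (A : Type) [Group A] where
  label : Move → T.Flag → A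
  reverse : ∀ c y, label c (T.move c y) = (label c y)⁻¹
  glue : ∀ y, label .glue y = 1
  long_glue : ∀ y, label .long (T.move .glue y) = label .long y
  medium_glue : ∀ y, label .medium (T.move .glue y) = label .medium y

section
variable {T} {A : Type} [Group A] (L : T.Labelling A)

/-- Parallel transport: `(y, a)` goes to `(move c y, label c y * a)`. -/
def Labelling.transport (c : Move) : Equiv.Perm (T.Flag × A) where
  toFun u := (T.move c u.1, L.label c u.1 * u.2)
  invFun u := (T.move c u.1, L.label c u.1 * u.2)
  left_inv u := by simp [T.move_involutive c u.1, L.reverse]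
  right_inv u := by simp [T.move_involutive c u.1, L.reverse]

/-- The product of the labels along a path that starts at `y`, the first label on the right. -/
def Labelling.hol (w : FreeGroup Move) (y : T.Flag) : A :=
  (FreeGroup.lift L.transport w (y, 1)).2

end

/-- The Möbius transformation `w ↦ 1 / w`. -/
noncomputable def mobInv : PSL(2, ℂ) :=
  QuotientGroup.mk ⟨!![0, Complex.I; Complex.I, 0], by simp [Matrix.det_fin_two]⟩

/-- The Möbius transformation `w ↦ 1 - w`. -/
noncomputable def mobOneSub : PSL(2, ℂ) :=
  QuotientGroup.mk ⟨!![-Complex.I, Complex.I; 0, Complex.I], by simp [Matrix.det_fin_two]⟩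

/-- The Möbius transformation `w ↦ u * w`, for `u ≠ 0`. -/
noncomputable def mobScale (u : ℂ) : PSL(2, ℂ) :=
  QuotientGroup.mk ⟨!![Complex.exp (Complex.log u / 2), 0; 0, Complex.exp (-(Complex.log u / 2))],
    by simp [Matrix.det_fin_two, ← Complex.exp_add]⟩

/-- Give each tetrahedron the shape of an ideal hyperbolic tetrahedron prescribed by `z`.  For a flag
`y = (t, p)` let `φ y` be the isometry of hyperbolic space that puts the vertices `p 0`, `p 1`,
`p 2` of a developed image of `t` at `∞`, `0`, `1`; then `p 3` is at `z` (the parameter at the edge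
`{p 0, p 1}`) if `p` is even, and at `1 / z` if `p` is odd.  The developed tetrahedra on both sides
of a face share the vertices of that face, so `φ` does not change under `glue`.
The label of the edge from `y` to `y'` is the transition `φ y' * (φ y)⁻¹`. -/
noncomputable def shapeLabel (z : T.Quad → ℂ) : Move → T.Flag → PSL(2, ℂ)
  | .long, _ => mobInv
  | .medium, _ => mobOneSub
  | .short, y =>
    if Equiv.Perm.sign y.2 = 1 then mobScale (z (quadOf y))⁻¹ else mobScale (z (quadOf y))
  | .glue, _ => 1

/-- `ρ` belongs to the conjugacy class of the monodromy of the `PSL(2, ℂ)`-labelling `L`. -/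
def IsMonodromy {x : T.Flag} (L : T.Labelling PSL(2, ℂ)) (ρ : T.FundGroup x →* PSL(2, ℂ)) : Prop :=
  ∃ g : PSL(2, ℂ), ∀ w : T.loops x, ρ (QuotientGroup.mk w) = g * L.hol w x * g⁻¹

/-- `ρ` is a representation (unique up to conjugation) determined by the shape parameters `z`. -/
def IsDeterminedBy {x : T.Flag} (z : T.Quad → ℂ) (ρ : T.FundGroup x →* PSL(2, ℂ)) : Prop :=
  ∃ L : T.Labelling PSL(2, ℂ), L.label = T.shapeLabel z ∧ T.IsMonodromy L ρ

/-- The matrix with rows `(1, b)` and `(0, 1)`. -/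
def unipotent (b : ℂ) : SL(2, ℂ) := ⟨!![1, b; 0, 1], by simp [Matrix.det_fin_two]⟩

/-- `ρ` takes the fundamental group of each boundary component (with respect to any path `w` from the
base point to this component) into a conjugate of the group of translations `z ↦ z + b`. -/
def IsBoundaryParabolic {x : T.Flag} (ρ : T.FundGroup x →* PSL(2, ℂ)) : Prop :=
  ∀ w : FreeGroup Move, ∃ g : PSL(2, ℂ), ∀ b ∈ boundaryWords, ∀ h : w⁻¹ * b * w ∈ T.loops x,
    ∃ c : ℂ, g * ρ (QuotientGroup.mk ⟨w⁻¹ * b * w, h⟩) * g⁻¹ = QuotientGroup.mk (unipotent c)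

/-! ### Obstruction classes -/

/-- The element `1` or `-1` of `SL(2, ℂ)` that corresponds to an element of `𝔽₂`. -/
def central (a : ZMod 2) : SL(2, ℂ) := (-1) ^ a.val

/-- The labelling of the 1-cells by elements of `SL(2, ℂ)` projects to a `PSL(2, ℂ)`-cocycle in the
conjugacy class of `ρ`, and `σ` is the `{±1}`-valued 2-cochain whose value at a 2-cell is the product
of the labels around the cell. -/
structure IsLift {x : T.Flag} (ρ : T.FundGroup x →* PSL(2, ℂ)) (L : T.Labelling SL(2, ℂ))
    (σ : T.C2) : Prop where
  monodromy : ∃ g : PSL(2, ℂ), ∀ w : T.loops x,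
    ρ (QuotientGroup.mk w) = g * QuotientGroup.mk (L.hol w x) * g⁻¹
  largeHexagon : ∀ y, L.hol largeHexagonWord y = central (σ.1.1 (cell _ y))
  rectangle : ∀ y, L.hol rectangleWord y = central (σ.1.2 (cell _ y))
  boundaryHexagon : ∀ y, L.hol boundaryHexagonWord y = central (σ.2.1 (cell _ y))
  edgeDisc : ∀ y, L.hol (T.edgeDiscWord y) y = central (σ.2.2 (cell _ y))

/-- The labelling determines unipotent representations of the fundamental groups of the boundary
components. -/
def IsBoundaryUnipotent (L : T.Labelling SL(2, ℂ)) : Prop :=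
  ∀ y, ∃ g : SL(2, ℂ), ∀ b ∈ boundaryWords, b ∈ T.loops y →
    ∃ c : ℂ, g * L.hol b y * g⁻¹ = unipotent c

/-- `c` is the obstruction class `Obs(ρ)` to lifting `ρ` to an `SL(2, ℂ)`-representation: the pullback
of the class of the central extension of `PSL(2, ℂ)` by `{±1}`, i.e. the class of the cocycle that
measures the failure of any lift of a cocycle for `ρ` to be an `SL(2, ℂ)`-cocycle. -/
def IsObstruction {x : T.Flag} (ρ : T.FundGroup x →* PSL(2, ℂ)) (c : T.H2) : Prop :=
  (∃ L σ, T.IsLift ρ L σ) ∧ ∀ L σ, T.IsLift ρ L σ → T.Represents σ c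

/-- `c` is the obstruction class `Obs₀(ρ)` to lifting the boundary-parabolic representation `ρ` to a
boundary-unipotent `SL(2, ℂ)`-representation: here the lifts of a cocycle for `ρ` are required to
be `SL(2, ℂ)`-cocycles with unipotent monodromy on the boundary. -/
def IsRelObstruction {x : T.Flag} (ρ : T.FundGroup x →* PSL(2, ℂ)) (c : T.H2rel) : Prop :=
  (∃ L σ, T.IsLift ρ L (σ, 0) ∧ T.IsBoundaryUnipotent L) ∧
    ∀ L σ, T.IsLift ρ L (σ, 0) → T.IsBoundaryUnipotent L → T.RepresentsRel σ c

end FacePairing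

namespace FacePairing

variable {N : ℕ} {T : FacePairing N}

/-! ### Moves on flags -/

/-! The core is a normal form. Call a solution of the homogeneous linearized tetrahedral and edge
equations a tangent vector. Every ω in 𝒮𝒜 equals exp(iW)·(-1)^α with W a real tangent vector and α
in 𝒜, and W is peripherally trivial when ω lies in 𝒮𝒜₀ (`exists_expMul`). If two such products
agree, then W' - W = πf for an integer tangent vector f that reduces to α - α' modulo 2
(`expMul_signs_eq_iff`, `isTangent_pi_mul_iff`). Scaling W joins ω to (-1)^α inside 𝒮𝒜, and near ω
every angle structure is ω times the exponential of a small tangent vector. So the components are 𝒜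
modulo the reductions of integer tangent vectors, and Φ sends exp(iW)·(-1)^α to [rect(α)]. This is
well defined, locally constant and injective on components because rect(α) - rect(α') is a
coboundary exactly if α - α' lifts to an integer tangent vector (`rect_sub_mem_B2_iff`; peripherally
trivial and relative: `rect_sub_mem_B2rel_iff`). The image is found by moving any relative cocycle
to some rect(α) (`exists_rect_of_mem_Z2rel`).

Two descriptions support this. First, elements of 𝒜 are the same as transverse orientations of the
faces with an even number of inward faces at each tetrahedron; they exist because the total defect
is 2N, and two of them differ by a function b on the faces. Second, tangent vectors arise from edge
data (`IsEdgeData`): a function e on the edges of the triangulation and a function ν on the short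
edges whose jumps across the faces form a flow on the boundary. From these one gets a value E for
every edge in a face, and the combination E₀₁ + E₀₂ - E₁₂ (`sideSum`) is a function on the sides of
the vertex triangles whose variation around the corners is a tangent vector. Conversely a tangent
vector has a side function l with 2l of this form. The factor 2 is the source of the 𝔽₂-classes: on
lifting from the circle to the reals and halving, what is left over is a 2-torsion function on the
faces, exactly a change of the even co-orientation. Flows lift along surjections because a flow with
values in the kernel can correct the divergence (`IsEdgeData.exists_lift`). The peripherally trivial
case is the case ν = 0.

For algebraic solutions, a flattening (W, f) gives an explicit lift of the shape cocycle to SL(2, ℂ)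
(`shapeLift`). Its diagonal entries combine the exponential of half a potential of W with eighth
roots of unity governed by the co-orientation (`IsSpinStructure`). Its product around a rectangle is
(-1)^f and around every other 2-cell it is 1, so the obstruction cocycle is rect(f mod 2) on the
nose. For a strong flattening the potential can be chosen constant along medium edges, and then the
boundary monodromy is unipotent. Two lifts of one representation differ by a gauge transformation
and a sign cochain, so their cocycles are cohomologous; equality of traces on the boundary makes
this work relatively. Finally, parabolic boundary monodromy forces the squares of the boundary
eigenvalues to be trivial, which gives the completeness equations (`IsLift.isComplete`). -/

theorem move_move (c : Move) (y : T.Flag) : T.move c (T.move c y) = y := T.move_involutive c y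

theorem glue_long (y : T.Flag) :
    T.move .glue (T.move .long y) = T.move .long (T.move .glue y) := by
  simp [move, mul_assoc, Equiv.swap_apply_of_ne_of_ne]

theorem glue_medium (y : T.Flag) :
    T.move .glue (T.move .medium y) = T.move .medium (T.move .glue y) := by
  simp [move, mul_assoc, Equiv.swap_apply_of_ne_of_ne]

theorem short_long (y : T.Flag) :
    T.move .short (T.move .long y) = T.move .long (T.move .short y) := by
  have : Equiv.swap (0 : Fin 4) 1 * Equiv.swap 2 3 = Equiv.swap 2 3 * Equiv.swap 0 1 := by decide
  simp [move, mul_assoc, this]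

theorem long_medium_long (y : T.Flag) :
    T.move .long (T.move .medium (T.move .long y)) =
      T.move .medium (T.move .long (T.move .medium y)) := by
  have : Equiv.swap (0 : Fin 4) 1 * (Equiv.swap 1 2 * Equiv.swap 0 1) =
    Equiv.swap 1 2 * (Equiv.swap 0 1 * Equiv.swap 1 2) := by decide
  simp [move, mul_assoc, this]

theorem short_medium_short (y : T.Flag) :
    T.move .short (T.move .medium (T.move .short y)) =
      T.move .medium (T.move .short (T.move .medium y)) := by
  have : Equiv.swap (2 : Fin 4) 3 * (Equiv.swap 1 2 * Equiv.swap 2 3) =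
    Equiv.swap 1 2 * (Equiv.swap 2 3 * Equiv.swap 1 2) := by decide
  simp [move, mul_assoc, this]

variable (T) in
/-- The sign of the permutation of a flag. -/
def sgn (y : T.Flag) : ℤˣ := Equiv.Perm.sign y.2

@[simp] theorem sgn_move (c : Move) (y : T.Flag) : T.sgn (T.move c y) = -T.sgn y := by
  cases c <;> simp [sgn, move, T.odd]

theorem sgn_eq (y : T.Flag) : T.sgn y = 1 ∨ T.sgn y = -1 := Int.units_eq_one_or _

theorem move_ne (c : Move) (y : T.Flag) : T.move c y ≠ y := fun h => by
  have := congrArg T.sgn h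
  rw [sgn_move] at this
  rcases T.sgn_eq y with e | e <;> rw [e] at this <;> exact absurd this (by decide)

theorem glue_ne {y y' : T.Flag} (h : y'.1 = y.1) (h' : y'.2 3 = y.2 3) : T.move .glue y ≠ y' := by
  rintro rfl
  exact T.distinct y.1 (y.2 3) (Prod.ext h h')

/-! ### Cells -/

theorem cell_move {S : Finset Move} {c : Move} (hc : c ∈ S) (y : T.Flag) :
    cell S (T.move c y) = cell S y :=
  (Quot.sound ⟨c, hc, rfl⟩).symm

@[simp] theorem proj_cell {S S' : Finset Move} (h : S ⊆ S') (y : T.Flag) :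
    (cell S y).proj h = cell S' y := rfl

theorem exists_cell {S : Finset Move} (Y : T.Cell S) : ∃ y, cell S y = Y := Quot.exists_rep Y

theorem cell_mono {S S' : Finset Move} (h : S ⊆ S') {y y' : T.Flag} (e : cell S y = cell S y') :
    cell S' y = cell S' y' := by
  simpa using congrArg (Cell.proj h) e

/-- The function on cells given by a function on flags that does not change under the moves. -/
def liftCell {X : Type*} (S : Finset Move) (g : T.Flag → X)
    (h : ∀ c ∈ S, ∀ y, g (T.move c y) = g y) : T.Cell S → X :=
  Quot.lift g (by rintro y _ ⟨c, hc, rfl⟩; exact (h c hc y).symm)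

@[simp] theorem liftCell_cell {X : Type*} {S : Finset Move} {g : T.Flag → X}
    (h : ∀ c ∈ S, ∀ y, g (T.move c y) = g y) (y : T.Flag) : liftCell S g h (cell S y) = g y := rfl

/-- Moves are involutions, so a property preserved by the moves is also reflected by them and
descends to the cells. This is the induction principle for orbits. -/
theorem cell_invariant {S : Finset Move} {P : T.Flag → Prop}
    (h : ∀ c ∈ S, ∀ y, P y → P (T.move c y)) {y y' : T.Flag} (e : cell S y' = cell S y)
    (hy : P y) : P y' := by
  have := congrArg (liftCell S P fun c hc y =>
    propext ⟨fun hy => by simpa [move_move] using h c hc _ hy, h c hc y⟩) e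
  simp only [liftCell_cell] at this
  exact this.mpr hy

theorem cell_single {c : Move} {y y' : T.Flag} (e : cell {c} y' = cell {c} y) :
    y' = y ∨ y' = T.move c y := by
  refine cell_invariant (P := fun y' => y' = y ∨ y' = T.move c y) ?_ e (.inl rfl)
  simp only [Finset.mem_singleton, forall_eq]
  rintro _ (rfl | rfl) <;> simp [move_move]

theorem cell_pair {c d : Move} (hcd : ∀ y : T.Flag, T.move c (T.move d y) = T.move d (T.move c y))
    {y y' : T.Flag} (e : cell {c, d} y' = cell {c, d} y) :
    y' = y ∨ y' = T.move c y ∨ y' = T.move d y ∨ y' = T.move c (T.move d y) := by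
  refine cell_invariant (P := fun y' => y' = y ∨ y' = T.move c y ∨ y' = T.move d y ∨
    y' = T.move c (T.move d y)) ?_ e (.inl rfl)
  intro b hb
  obtain rfl | rfl : b = c ∨ b = d := by simpa using hb
  · rintro _ (rfl | rfl | rfl | rfl) <;> simp [move_move]
  · rintro _ (rfl | rfl | rfl | rfl) <;> simp [move_move, ← hcd]

/-- A sum over the cells in a given cell, in terms of flags that represent them. -/
theorem sum_cells {A ι : Type*} [AddCommMonoid A] [Fintype ι] {S₁ S : Finset Move} (h : S₁ ⊆ S)
    (y : T.Flag) (ys : ι → T.Flag) (inj : ∀ i j, cell S₁ (ys i) = cell S₁ (ys j) → i = j)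
    (mem : ∀ i, cell S (ys i) = cell S y)
    (cover : ∀ y', cell S y' = cell S y → ∃ i, cell S₁ y' = cell S₁ (ys i))
    [DecidablePred fun Y : T.Cell S₁ => Y.proj h = cell S y] (g : T.Cell S₁ → A) :
    ∑ Y : T.Cell S₁ with Y.proj h = cell S y, g Y = ∑ i, g (cell S₁ (ys i)) := by
  symm
  refine Finset.sum_bij (fun i _ => cell S₁ (ys i)) ?_ ?_ ?_ ?_
  · intro i _; simpa using mem i
  · intro i _ j _ e; exact inj i j e
  · intro Y hY
    obtain ⟨y', rfl⟩ := exists_cell Y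
    obtain ⟨i, hi⟩ := cover y' (by simpa using hY)
    exact ⟨i, Finset.mem_univ _, hi.symm⟩
  · intros; rfl

/-- For a polygon with two sides of the given kind, exchanged by the move `d`; `orb` says that `d`
acts on the sides. -/
theorem sum_cells_two {A : Type*} [AddCommMonoid A] {S₁ S : Finset Move} (h : S₁ ⊆ S) {d : Move}
    (hd : d ∈ S) (hS : ∀ e ∈ S, e ∈ S₁ ∨ e = d)
    (orb : ∀ y y' : T.Flag, cell S₁ y' = cell S₁ y → cell S₁ (T.move d y') = cell S₁ (T.move d y))
    (ne : ∀ y : T.Flag, cell S₁ (T.move d y) ≠ cell S₁ y) (y : T.Flag)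
    [DecidablePred fun Y : T.Cell S₁ => Y.proj h = cell S y] (g : T.Cell S₁ → A) :
    ∑ Y : T.Cell S₁ with Y.proj h = cell S y, g Y = g (cell S₁ y) + g (cell S₁ (T.move d y)) := by
  rw [sum_cells h y ![y, T.move d y] ?_ ?_ ?_ g]
  · simp [Fin.sum_univ_two]
  · intro i j e
    fin_cases i <;> fin_cases j <;> first | rfl | exact absurd e (ne y) | exact absurd e.symm (ne y)
  · intro i; fin_cases i
    · rfl
    · exact cell_move hd y
  · intro y' e
    refine cell_invariant (P := fun y' => ∃ i, cell S₁ y' = cell S₁ (![y, T.move d y] i)) ?_ e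
      ⟨0, rfl⟩
    rintro c hc z ⟨i, hi⟩
    rcases hS c hc with h1 | rfl
    · exact ⟨i, (cell_move h1 z).trans hi⟩
    · fin_cases i
      · exact ⟨1, orb _ _ hi⟩
      · exact ⟨0, (orb _ _ hi).trans (by simp [move_move])⟩

/-- The braid relation makes `c` and `d` act through the symmetric group of a triangle. Since `c`
fixes the side of `y`, there are at most three sides, and `ne` together with the relation keeps them
apart. -/
theorem sum_cells_three {A : Type*} [AddCommMonoid A] {S₁ S : Finset Move} (h : S₁ ⊆ S)
    {c d : Move} (hc : c ∈ S₁) (hd : d ∈ S) (hS : ∀ e ∈ S, e ∈ S₁ ∨ e = d)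
    (braid : ∀ y : T.Flag,
      T.move c (T.move d (T.move c y)) = T.move d (T.move c (T.move d y)))
    (orb : ∀ y y' : T.Flag, cell S₁ y' = cell S₁ y → cell S₁ (T.move d y') = cell S₁ (T.move d y) ∨
      cell S₁ (T.move d y') = cell S₁ (T.move d (T.move c y)))
    (ne : ∀ y : T.Flag, cell S₁ (T.move d y) ≠ cell S₁ y) (y : T.Flag)
    [DecidablePred fun Y : T.Cell S₁ => Y.proj h = cell S y] (g : T.Cell S₁ → A) :
    ∑ Y : T.Cell S₁ with Y.proj h = cell S y, g Y =
      g (cell S₁ y) + g (cell S₁ (T.move d y)) + g (cell S₁ (T.move d (T.move c y))) := by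
  have ne₁ : cell S₁ (T.move d (T.move c y)) ≠ cell S₁ y := by
    rw [← cell_move hc y]; exact ne _
  have e₂ : cell S₁ (T.move d (T.move c (T.move d y))) = cell S₁ (T.move d (T.move c y)) := by
    rw [← braid, cell_move hc]
  have e₃ : cell S₁ (T.move d (T.move c (T.move d (T.move c y)))) = cell S₁ (T.move d y) := by
    rw [← braid, cell_move hc, move_move]
  have ne₂ : cell S₁ (T.move d (T.move c y)) ≠ cell S₁ (T.move d y) := by
    rw [← e₂, ← cell_move hc (T.move d y)]; exact ne _
  rw [sum_cells h y ![y, T.move d y, T.move d (T.move c y)] ?_ ?_ ?_ g]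
  · simp [Fin.sum_univ_three]
  · intro i j e
    fin_cases i <;> fin_cases j
    exacts [rfl, (ne y e.symm).elim, (ne₁ e.symm).elim, (ne y e).elim, rfl, (ne₂ e.symm).elim,
      (ne₁ e).elim, (ne₂ e).elim, rfl]
  · intro i; fin_cases i
    · rfl
    · exact cell_move hd y
    · exact (cell_move hd _).trans (cell_move (h hc) y)
  · intro y' e
    refine cell_invariant
      (P := fun y' => ∃ i, cell S₁ y' = cell S₁ (![y, T.move d y, T.move d (T.move c y)] i)) ?_ e
      ⟨0, rfl⟩
    rintro b hb z ⟨i, hi⟩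
    rcases hS b hb with h1 | rfl
    · exact ⟨i, (cell_move h1 z).trans hi⟩
    · fin_cases i
      · rcases orb _ _ hi with h | h
        · exact ⟨1, h⟩
        · exact ⟨2, h⟩
      · rcases orb _ _ hi with h | h
        · exact ⟨0, h.trans (by simp [move_move])⟩
        · exact ⟨2, h.trans e₂⟩
      · rcases orb _ _ hi with h | h
        · exact ⟨0, h.trans (by simp [move_move, cell_move hc])⟩
        · exact ⟨1, h.trans e₃⟩

theorem move_ne_move {c d : Move} (h : c ≠ d) (hc : c ≠ .glue) (hd : d ≠ .glue) (y : T.Flag) :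
    T.move c y ≠ T.move d y := by
  obtain ⟨t, p⟩ := y
  intro e
  have : ∀ a b : Equiv.Perm (Fin 4), (t, p * a) = (t, p * b) → a = b := by
    intro a b h; simpa using h
  cases c <;> cases d <;>
    first | exact h rfl | exact hc rfl | exact hd rfl | exact absurd (this _ _ e) (by decide)

theorem cell_single_ne {c d : Move} (h : c ≠ d) (hc : c ≠ .glue) (hd : d ≠ .glue) (y : T.Flag) :
    cell {c} (T.move d y) ≠ cell {c} y := fun e => by
  rcases cell_single e with e | e
  · exact move_ne d y e
  · exact move_ne_move h.symm hd hc y e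

/-- Moves `long` and `medium` stay in one face of one tetrahedron, so a coincidence involving `glue`
would glue a face to itself, which `distinct` forbids. -/
theorem cell_glue_ne {c d : Move} (h : c ≠ d) (hc : c = .long ∨ c = .medium)
    (hd : d = .long ∨ d = .medium) (y : T.Flag) :
    cell {c, .glue} (T.move d y) ≠ cell {c, .glue} y := fun e => by
  have comm : ∀ y : T.Flag, T.move c (T.move .glue y) = T.move .glue (T.move c y) := by
    rcases hc with rfl | rfl
    · exact fun y => (glue_long y).symm
    · exact fun y => (glue_medium y).symm
  have aux : ∀ e, e = .long ∨ e = .medium → (T.move e y).1 = y.1 ∧ (T.move e y).2 3 = y.2 3 := by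
    rintro e (rfl | rfl) <;> simp [move, Equiv.swap_apply_of_ne_of_ne]
  rcases cell_pair comm e with e | e | e | e
  · exact move_ne d y e
  · exact move_ne_move h.symm (by rintro rfl; simp at hd) (by rintro rfl; simp at hc) y e
  · exact glue_ne (aux d hd).1 (aux d hd).2 e.symm
  · rw [comm] at e
    exact glue_ne ((aux d hd).1.trans (aux c hc).1.symm) ((aux d hd).2.trans (aux c hc).2.symm)
      e.symm

theorem cell_single_orbit {c d : Move}
    (y y' : T.Flag) (e : cell {c} y' = cell {c} y) :
    cell {c} (T.move d y') = cell {c} (T.move d y) ∨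
      cell {c} (T.move d y') = cell {c} (T.move d (T.move c y)) := by
  rcases cell_single e with rfl | rfl
  · exact .inl rfl
  · exact .inr rfl

theorem cell_glue_orbit {c d : Move} (hc : c = .long ∨ c = .medium)
    (hd : d = .long ∨ d = .medium) (y y' : T.Flag)
    (e : cell {c, .glue} y' = cell {c, .glue} y) :
    cell {c, .glue} (T.move d y') = cell {c, .glue} (T.move d y) ∨
      cell {c, .glue} (T.move d y') = cell {c, .glue} (T.move d (T.move c y)) := by
  have comm : ∀ c, c = .long ∨ c = .medium →
      ∀ y : T.Flag, T.move c (T.move .glue y) = T.move .glue (T.move c y) := by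
    rintro c (rfl | rfl)
    · exact fun y => (glue_long y).symm
    · exact fun y => (glue_medium y).symm
  have hg : Move.glue ∈ ({c, .glue} : Finset Move) := by simp
  rcases cell_pair (comm c hc) e with rfl | rfl | rfl | rfl
  · exact .inl rfl
  · exact .inr rfl
  · exact .inl (by rw [comm d hd, cell_move hg])
  · exact .inr (by rw [comm c hc, comm d hd, cell_move hg])

/-! ### Explicit coboundaries -/

theorem sides_apply (S₁ : Finset Move) {S S' : Finset Move} (h : S₁ ⊆ S) (h' : S₁ ⊆ S')
    (c : T.Cell S' → ZMod 2) (X : T.Cell S)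
    [DecidablePred fun Y : T.Cell S₁ => Y.proj h = X] :
    T.sides S₁ h h' c X = ∑ Y : T.Cell S₁ with Y.proj h = X, c (Y.proj h') := by
  simp only [sides, LinearMap.coe_mk, AddHom.coe_mk]
  congr!

theorem sum_hexagon_long {A : Type*} [AddCommMonoid A] (h : ({.long, .glue} : Finset Move) ⊆ {.long, .medium, .glue})
    (y : T.Flag) [DecidablePred fun Y : T.LongEdges => Y.proj h = cell {.long, .medium, .glue} y]
    (g : T.LongEdges → A) :
    ∑ Y : T.LongEdges with Y.proj h = cell _ y, g Y =
      g (cell _ y) + g (cell _ (T.move .medium y)) +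
        g (cell _ (T.move .medium (T.move .long y))) :=
  sum_cells_three h (c := .long) (d := .medium) (by decide) (by decide) (by decide)
    long_medium_long (cell_glue_orbit (.inl rfl) (.inr rfl))
    (cell_glue_ne (by decide) (.inl rfl) (.inr rfl)) y g

theorem sum_hexagon_medium {A : Type*} [AddCommMonoid A]
    (h : ({.medium, .glue} : Finset Move) ⊆ {.long, .medium, .glue}) (y : T.Flag)
    [DecidablePred fun Y : T.MediumEdges => Y.proj h = cell {.long, .medium, .glue} y]
    (g : T.MediumEdges → A) :
    ∑ Y : T.MediumEdges with Y.proj h = cell _ y, g Y =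
      g (cell _ y) + g (cell _ (T.move .long y)) +
        g (cell _ (T.move .long (T.move .medium y))) :=
  sum_cells_three h (c := .medium) (d := .long) (by decide) (by decide) (by decide)
    (fun y => (long_medium_long y).symm) (cell_glue_orbit (.inr rfl) (.inl rfl))
    (cell_glue_ne (by decide) (.inr rfl) (.inl rfl)) y g

theorem sum_face_long {A : Type*} [AddCommMonoid A] (h : ({.long} : Finset Move) ⊆ {.long, .medium})
    (y : T.Flag) [DecidablePred fun Y : T.Cell {.long} => Y.proj h = cell {.long, .medium} y]
    (g : T.Cell {.long} → A) :
    ∑ Y : T.Cell {.long} with Y.proj h = cell _ y, g Y =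
      g (cell _ y) + g (cell _ (T.move .medium y)) +
        g (cell _ (T.move .medium (T.move .long y))) :=
  sum_cells_three h (c := .long) (d := .medium) (by decide) (by decide) (by decide)
    long_medium_long cell_single_orbit
    (cell_single_ne (by decide) (by decide) (by decide)) y g

theorem sum_face_medium {A : Type*} [AddCommMonoid A] (h : ({.medium} : Finset Move) ⊆ {.long, .medium})
    (y : T.Flag) [DecidablePred fun Y : T.Cell {.medium} => Y.proj h = cell {.long, .medium} y]
    (g : T.Cell {.medium} → A) :
    ∑ Y : T.Cell {.medium} with Y.proj h = cell _ y, g Y =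
      g (cell _ y) + g (cell _ (T.move .long y)) +
        g (cell _ (T.move .long (T.move .medium y))) :=
  sum_cells_three h (c := .medium) (d := .long) (by decide) (by decide) (by decide)
    (fun y => (long_medium_long y).symm) cell_single_orbit
    (cell_single_ne (by decide) (by decide) (by decide)) y g

theorem sum_triangle_medium {A : Type*} [AddCommMonoid A] (h : ({.medium} : Finset Move) ⊆ {.medium, .short})
    (y : T.Flag) [DecidablePred fun Y : T.Cell {.medium} => Y.proj h = cell {.medium, .short} y]
    (g : T.Cell {.medium} → A) :
    ∑ Y : T.Cell {.medium} with Y.proj h = cell _ y, g Y =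
      g (cell _ y) + g (cell _ (T.move .short y)) +
        g (cell _ (T.move .short (T.move .medium y))) :=
  sum_cells_three h (c := .medium) (d := .short) (by decide) (by decide) (by decide)
    (fun y => (short_medium_short y).symm) cell_single_orbit
    (cell_single_ne (by decide) (by decide) (by decide)) y g

theorem sum_triangle_short {A : Type*} [AddCommMonoid A] (h : ({.short} : Finset Move) ⊆ {.medium, .short})
    (y : T.Flag) [DecidablePred fun Y : T.Cell {.short} => Y.proj h = cell {.medium, .short} y]
    (g : T.Cell {.short} → A) :
    ∑ Y : T.Cell {.short} with Y.proj h = cell _ y, g Y =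
      g (cell _ y) + g (cell _ (T.move .medium y)) +
        g (cell _ (T.move .medium (T.move .short y))) :=
  sum_cells_three h (c := .short) (d := .medium) (by decide) (by decide) (by decide)
    short_medium_short cell_single_orbit
    (cell_single_ne (by decide) (by decide) (by decide)) y g

theorem sum_rectangle_long {A : Type*} [AddCommMonoid A] (h : ({.long} : Finset Move) ⊆ {.long, .short})
    (y : T.Flag) [DecidablePred fun Y : T.Cell {.long} => Y.proj h = cell {.long, .short} y]
    (g : T.Cell {.long} → A) :
    ∑ Y : T.Cell {.long} with Y.proj h = cell _ y, g Y =
      g (cell _ y) + g (cell _ (T.move .short y)) := by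
  refine sum_cells_two h (d := .short) (by decide) (by decide) ?_
    (cell_single_ne (by decide) (by decide) (by decide)) y g
  intro y y' e
  rcases cell_single_orbit (d := .short) y y' e with e | e
  · exact e
  · rw [e, short_long, cell_move (by decide)]

theorem sum_rectangle_short {A : Type*} [AddCommMonoid A] (h : ({.short} : Finset Move) ⊆ {.long, .short})
    (y : T.Flag) [DecidablePred fun Y : T.Cell {.short} => Y.proj h = cell {.long, .short} y]
    (g : T.Cell {.short} → A) :
    ∑ Y : T.Cell {.short} with Y.proj h = cell _ y, g Y =
      g (cell _ y) + g (cell _ (T.move .long y)) := by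
  refine sum_cells_two h (d := .long) (by decide) (by decide) ?_
    (cell_single_ne (by decide) (by decide) (by decide)) y g
  intro y y' e
  rcases cell_single_orbit (d := .long) y y' e with e | e
  · exact e
  · rw [e, ← short_long, cell_move (by decide)]

theorem d1_largeHexagon (c : T.C1) (y : T.Flag) :
    (T.d1 c).1.1 (cell _ y) =
      c.1 (cell _ y) + c.1 (cell _ (T.move .medium y))
        + c.1 (cell _ (T.move .medium (T.move .long y)))
      + (c.2.1 (cell _ y) + c.2.1 (cell _ (T.move .long y))
        + c.2.1 (cell _ (T.move .long (T.move .medium y)))) := by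
  classical
  simp only [d1, LinearMap.coe_mk, AddHom.coe_mk, Pi.add_apply, sides_apply]
  rw [sum_hexagon_long, sum_hexagon_medium]
  rfl

theorem d1_rectangle (c : T.C1) (y : T.Flag) :
    (T.d1 c).1.2 (cell _ y) =
      c.1 (cell _ y) + c.1 (cell _ (T.move .short y))
      + (c.2.2 (cell _ y) + c.2.2 (cell _ (T.move .long y))) := by
  classical
  simp only [d1, LinearMap.coe_mk, AddHom.coe_mk, Pi.add_apply, sides_apply]
  rw [sum_rectangle_long, sum_rectangle_short]
  rfl

theorem d1bd_boundaryHexagon (c : T.C1bd) (y : T.Flag) :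
    (T.d1bd c).1 (cell _ y) =
      c.1 (cell _ y) + c.1 (cell _ (T.move .short y))
        + c.1 (cell _ (T.move .short (T.move .medium y)))
      + (c.2 (cell _ y) + c.2 (cell _ (T.move .medium y))
        + c.2 (cell _ (T.move .medium (T.move .short y)))) := by
  classical
  simp only [d1bd, LinearMap.coe_mk, AddHom.coe_mk, Pi.add_apply, sides_apply]
  rw [sum_triangle_medium, sum_triangle_short]
  rfl

open Classical in
theorem d1bd_edgeDisc (c : T.C1bd) (D : T.EdgeDiscs) :
    (T.d1bd c).2 D = ∑ Y : T.ShortEdges with Y.proj (by decide) = D, c.2 Y := by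
  simp only [d1bd, LinearMap.coe_mk, AddHom.coe_mk, sides_apply]
  refine Finset.sum_congr rfl fun Y _ => ?_
  obtain ⟨y, rfl⟩ := exists_cell Y
  rfl

theorem d1_snd (c : T.C1) : (T.d1 c).2 = T.d1bd c.2 := rfl

/-- Fubini for nested cells. It rewrites the coboundary of a coboundary as sums over the edges of a
3-cell, where each edge is met twice. -/
theorem sum_sum_cells {A : Type*} [AddCommMonoid A] {S₁ S₂ S : Finset Move} (h₁ : S₁ ⊆ S₂)
    (h₂ : S₂ ⊆ S) [∀ X, DecidablePred fun Y : T.Cell S₁ => Y.proj h₁ = X] (Z : T.Cell S)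
    [DecidablePred fun Y : T.Cell S₁ => Y.proj (h₁.trans h₂) = Z]
    [DecidablePred fun X : T.Cell S₂ => X.proj h₂ = Z] (g : T.Cell S₁ → A) :
    ∑ X : T.Cell S₂ with X.proj h₂ = Z, ∑ Y : T.Cell S₁ with Y.proj h₁ = X, g Y =
      ∑ Y : T.Cell S₁ with Y.proj (h₁.trans h₂) = Z, g Y := by
  classical
  have key : ∀ Y : T.Cell S₁, (Y.proj h₁).proj h₂ = Y.proj (h₁.trans h₂) := by
    intro Y; obtain ⟨y, rfl⟩ := exists_cell Y; rfl
  rw [← Finset.sum_fiberwise_of_maps_to (s := Finset.univ.filter fun Y : T.Cell S₁ =>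
    Y.proj (h₁.trans h₂) = Z) (t := Finset.univ.filter fun X : T.Cell S₂ => X.proj h₂ = Z)
    (g := fun Y => Y.proj h₁)]
  · refine Finset.sum_congr rfl fun X hX => Finset.sum_congr ?_ fun _ _ => rfl
    ext Y
    simp only [Finset.mem_filter, Finset.mem_univ, true_and] at hX ⊢
    constructor
    · rintro rfl; exact ⟨(key Y).symm.trans hX, rfl⟩
    · exact fun h => h.2
  · intro Y hY
    simpa [key] using hY

end FacePairing

/-! ### Potentials on finite graphs -/

section Potential

variable {X Y A : Type*} [AddCommGroup A]

/-- `WeightedWalk n s w x x' a`: there is a walk from `x` to `x'` of weight `a` in the graph that has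
for every `y` an edge of weight `w y` from `s y` to `s (n y)`. -/
inductive WeightedWalk (n : Equiv.Perm Y) (s : Y → X) (w : Y → A) (x : X) : X → A → Prop
  | nil : WeightedWalk n s w x x 0
  | snoc (y : Y) (a : A) :
      WeightedWalk n s w x (s y) a → WeightedWalk n s w x (s (n y)) (a + w y)

namespace WeightedWalk

variable {n : Equiv.Perm Y} {s : Y → X} {w : Y → A}

theorem append {x x' x'' : X} {a b : A} (h : WeightedWalk n s w x x' a)
    (h' : WeightedWalk n s w x' x'' b) : WeightedWalk n s w x x'' (a + b) := by
  induction h' with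
  | nil => simpa using h
  | snoc y b _ ih => rw [← add_assoc]; exact .snoc y _ ih

theorem exists_seq {x x' : X} {a : A} (h : WeightedWalk n s w x x' a) :
    (x = x' ∧ a = 0) ∨ ∃ (len : ℕ) (y : ℕ → Y), s (y 0) = x ∧
      (∀ i < len, s (y (i + 1)) = s (n (y i))) ∧ s (n (y len)) = x' ∧
        a = ∑ i ∈ Finset.range (len + 1), w (y i) := by
  induction h with
  | nil => exact .inl ⟨rfl, rfl⟩
  | snoc y a _ ih =>
    right
    rcases ih with ⟨hx, ha⟩ | ⟨len, u, h0, hi, hl, ha⟩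
    · exact ⟨0, fun _ => y, hx.symm, by simp, rfl, by simp [ha]⟩
    · refine ⟨len + 1, fun i => if i ≤ len then u i else y, by simpa using h0, ?_, by simp, ?_⟩
      · intro i hi'
        rcases Nat.lt_succ_iff_lt_or_eq.mp hi' with h | rfl
        · simpa [h.le, Nat.succ_le_of_lt h] using hi i h
        · simpa using hl.symm
      · rw [Finset.sum_range_succ, ha]
        congr 1
        · refine Finset.sum_congr rfl fun i hi => ?_
          simp only [if_pos (Nat.lt_succ_iff.mp (Finset.mem_range.mp hi))]
        · simp

/-- The permutation `n` has finite order, so continuing along `n y, n (n y), …` leads back to `y`.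
No inverse edges are needed, and only curves that run forward without backtracking have to be
tested. -/
theorem reverse_step [Finite Y] (y : Y) : ∃ b, WeightedWalk n s w (s (n y)) (s y) b := by
  have key : ∀ (k : ℕ) (z : Y), ∃ b, WeightedWalk n s w (s z) (s ((n ^ k) z)) b := by
    intro k z
    induction k with
    | zero => exact ⟨0, .nil⟩
    | succ k ih =>
      obtain ⟨b, hb⟩ := ih
      refine ⟨b + w ((n ^ k) z), ?_⟩
      rw [pow_succ', Equiv.Perm.mul_apply]
      exact .snoc _ _ hb
  obtain ⟨b, hb⟩ := key (orderOf n - 1) (n y)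
  refine ⟨b, ?_⟩
  rwa [← Equiv.Perm.mul_apply, ← pow_succ,
    Nat.sub_add_cancel (isOfFinOrder_of_finite n).orderOf_pos, pow_orderOf_eq_one] at hb

theorem reverse [Finite Y] {x x' : X} {a : A} (h : WeightedWalk n s w x x' a) :
    ∃ b, WeightedWalk n s w x' x b := by
  induction h with
  | nil => exact ⟨0, .nil⟩
  | snoc y a _ ih =>
    obtain ⟨b, hb⟩ := ih
    obtain ⟨c, hc⟩ := reverse_step (n := n) (s := s) (w := w) y
    exact ⟨_, hc.append hb⟩

end WeightedWalk

/-- If the weights of all closed walks are zero, then the weights are the differences of a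
potential. -/
theorem exists_potential [Finite Y] (n : Equiv.Perm Y) (s : Y → X) (w : Y → A)
    (hw : ∀ (len : ℕ) (y : Fin (len + 1) → Y), (∀ i, s (y (i + 1)) = s (n (y i))) →
      ∑ i, w (y i) = 0) :
    ∃ h : X → A, ∀ y, h (s (n y)) = h (s y) + w y := by
  have closed : ∀ x a, WeightedWalk n s w x x a → a = 0 := by
    intro x a h
    rcases h.exists_seq with ⟨_, h⟩ | ⟨len, y, h0, hi, hl, ha⟩
    · exact h
    · rw [ha, Finset.sum_range]
      refine hw len (fun i => y i) fun i => ?_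
      rcases Fin.eq_castSucc_or_eq_last i with ⟨j, rfl⟩ | rfl
      · simpa using hi j j.2
      · simpa using h0.trans hl.symm
  have unique : ∀ x x' a a', WeightedWalk n s w x x' a → WeightedWalk n s w x x' a' → a = a' := by
    intro x x' a a' h h'
    obtain ⟨b, hb⟩ := h.reverse
    exact add_right_cancel ((closed _ _ (h.append hb)).trans (closed _ _ (h'.append hb)).symm)
  -- The potential at a point is the weight of any walk from the chosen base point of its component.
  let r : Setoid X :=
    { r := fun x x' => ∃ a, WeightedWalk n s w x x' a
      iseqv := ⟨fun x => ⟨0, .nil⟩, fun ⟨_, h⟩ => h.reverse,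
        fun ⟨_, h⟩ ⟨_, h'⟩ => ⟨_, h.append h'⟩⟩ }
  have rep : ∀ x, ∃ a, WeightedWalk n s w (Quotient.mk r x).out x a := fun x =>
    Quotient.exact (Quotient.out_eq (Quotient.mk r x))
  choose h hh using rep
  refine ⟨h, fun y => ?_⟩
  have e : Quotient.mk r (s (n y)) = Quotient.mk r (s y) :=
    Quotient.sound (s := r) (WeightedWalk.reverse_step y)
  refine unique _ _ _ _ (hh (s (n y))) ?_
  rw [e]
  exact .snoc y _ (hh (s y))

/-- Transport all values within a fiber of `π` to one representative; each transport lies in `H`,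
and what accumulates at the representative is the sum over the fiber, which is zero. -/
theorem mem_of_sum_fiber_eq_zero [Fintype X] [DecidableEq X] [DecidableEq Y]
    (H : AddSubgroup (X → A)) (r : X → X → Prop)
    (hr : ∀ x y a, r x y → (Pi.single x a - Pi.single y a : X → A) ∈ H) (π : X → Y)
    (hπ : ∀ x y, π x = π y → Relation.EqvGen r x y) (f : X → A)
    (hf : ∀ y, ∑ x with π x = y, f x = 0) : f ∈ H := by
  have hr' : ∀ x y, Relation.EqvGen r x y → ∀ a, (Pi.single x a - Pi.single y a : X → A) ∈ H := by
    intro x y h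
    induction h with
    | rel x y h => exact fun a => hr x y a h
    | refl x => intro a; simp [H.zero_mem]
    | symm x y _ ih => intro a; simpa using H.neg_mem (ih a)
    | trans x y z _ _ ih ih' => intro a; simpa using H.add_mem (ih a) (ih' a)
  rcases isEmpty_or_nonempty X with hX | hX
  · rw [Subsingleton.elim f 0]; exact H.zero_mem
  let σ : Y → X := Function.invFun π
  have hσ : ∀ x, π (σ (π x)) = π x := fun x => Function.invFun_eq ⟨x, rfl⟩
  have e₁ : f = ∑ x, (Pi.single x (f x) - Pi.single (σ (π x)) (f x) : X → A)
      + ∑ x, Pi.single (σ (π x)) (f x) := by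
    rw [Finset.sum_sub_distrib, sub_add_cancel, Finset.univ_sum_single]
  have e₂ : ∑ x, (Pi.single (σ (π x)) (f x) : X → A) = 0 := by
    rw [← Finset.sum_fiberwise_of_maps_to (s := Finset.univ) (t := Finset.univ.image π) (g := π)
      (by simp)]
    refine Finset.sum_eq_zero fun y _ => ?_
    have : ∑ x with π x = y, (Pi.single (σ (π x)) (f x) : X → A) =
        ∑ x with π x = y, AddMonoidHom.single (fun _ => A) (σ y) (f x) := by
      refine Finset.sum_congr rfl fun x hx => ?_
      rw [(Finset.mem_filter.mp hx).2]; rfl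
    rw [this, ← map_sum, hf, map_zero]
  rw [e₁, e₂, add_zero]
  exact H.sum_mem fun x _ => hr' _ _ (hπ _ _ (hσ x).symm) _

end Potential

namespace FacePairing

variable {N : ℕ} {T : FacePairing N}

/-! ### Rotation around an edge -/

variable (T) in
/-- The rotation of the flags around the edges of the triangulation. -/
def rot : Equiv.Perm T.Flag :=
  (T.move_involutive .short).toPerm * (T.move_involutive .glue).toPerm

theorem rot_apply (y : T.Flag) : T.rot y = T.move .short (T.move .glue y) := rfl

theorem rot_symm_apply (y : T.Flag) : T.rot⁻¹ y = T.move .glue (T.move .short y) := by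
  rw [Equiv.Perm.inv_eq_iff_eq, rot_apply, move_move, move_move]

@[simp] theorem sgn_rot (y : T.Flag) : T.sgn (T.rot y) = T.sgn y := by simp [rot_apply]

theorem sgn_rot_zpow (k : ℤ) (y : T.Flag) : T.sgn ((T.rot ^ k) y) = T.sgn y := by
  induction k generalizing y with
  | zero => simp
  | succ k ih => rw [zpow_add_one, Equiv.Perm.mul_apply, ih, sgn_rot]
  | pred k ih =>
    rw [zpow_sub_one, Equiv.Perm.mul_apply, ih, rot_symm_apply]
    simp

theorem cell_rot_zpow (k : ℤ) (y : T.Flag) :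
    cell {.short, .glue} ((T.rot ^ k) y) = cell {.short, .glue} y := by
  induction k generalizing y with
  | zero => simp
  | succ k ih =>
    rw [zpow_add_one, Equiv.Perm.mul_apply, ih, rot_apply, cell_move (by decide),
      cell_move (by decide)]
  | pred k ih =>
    rw [zpow_sub_one, Equiv.Perm.mul_apply, ih, rot_symm_apply, cell_move (by decide),
      cell_move (by decide)]

/-- The involutions `short` and `glue` generate a dihedral group with rotation `rot`, so an orbit is
a rotation orbit together with its image under `glue`. -/
theorem edgeDisc_orbit {y y' : T.Flag} (e : cell {.short, .glue} y' = cell {.short, .glue} y) :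
    ∃ k : ℤ, y' = (T.rot ^ k) y ∨ y' = T.move .glue ((T.rot ^ k) y) := by
  refine cell_invariant (P := fun y' => ∃ k : ℤ, y' = (T.rot ^ k) y ∨
    y' = T.move .glue ((T.rot ^ k) y)) ?_ e ⟨0, .inl rfl⟩
  intro c hc
  obtain rfl | rfl : c = .short ∨ c = .glue := by simpa using hc
  · rintro _ ⟨k, rfl | rfl⟩
    · refine ⟨-1 + k, .inr ?_⟩
      rw [zpow_add, Equiv.Perm.mul_apply, zpow_neg_one, rot_symm_apply, move_move]
    · refine ⟨1 + k, .inl ?_⟩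
      rw [zpow_add, Equiv.Perm.mul_apply, zpow_one, rot_apply]
  · rintro _ ⟨k, rfl | rfl⟩
    · exact ⟨k, .inr rfl⟩
    · exact ⟨k, .inl (by rw [move_move])⟩

/-- The two ends of an edge of the triangulation are different. -/
theorem edgeDisc_long_ne (y : T.Flag) :
    cell {.short, .glue} (T.move .long y) ≠ cell {.short, .glue} y := fun e => by
  obtain ⟨k, h | h⟩ := edgeDisc_orbit e
  · have := congrArg T.sgn h
    rw [sgn_rot_zpow, sgn_move] at this
    rcases T.sgn_eq y with e | e <;> rw [e] at this <;> exact absurd this (by decide)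
  -- `E` exchanges the ends of the edge and conjugates the rotation to its inverse. If both ends had
  -- the same disc, `E` would act on the rotation orbit as a reflection.
  set E : Equiv.Perm T.Flag :=
    (T.move_involutive .long).toPerm * (T.move_involutive .glue).toPerm
  have hE : ∀ z, E z = T.move .long (T.move .glue z) := fun _ => rfl
  have sc : SemiconjBy E T.rot T.rot⁻¹ := by
    ext1 z
    simp only [Equiv.Perm.mul_apply, hE, rot_symm_apply, rot_apply]
    rw [← glue_long, ← short_long]
  have hk : (T.rot ^ k) y = E y := by
    rw [hE, ← glue_long, h, move_move]
  have scj : ∀ j : ℤ, (T.rot ^ (-j)) (E y) = E ((T.rot ^ j) y) := by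
    intro j
    rw [zpow_neg, ← inv_zpow, ← Equiv.Perm.mul_apply, ← (sc.zpow_right j).eq,
      Equiv.Perm.mul_apply]
  -- A reflection of a cycle has a fixed vertex (then a face is glued to itself) or flips an
  -- adjacent pair (then `long` and `short` agree at a flag).
  rcases Int.even_or_odd' k with ⟨j, rfl | rfl⟩
  · have := scj j
    rw [← hk, ← Equiv.Perm.mul_apply, ← zpow_add, show -j + 2 * j = j by ring, hE] at this
    refine glue_ne (y := (T.rot ^ j) y) (y' := T.move .long ((T.rot ^ j) y)) rfl ?_ ?_
    · simp [move, Equiv.swap_apply_of_ne_of_ne]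
    · conv_rhs => rw [this, move_move]
  · have := scj j
    rw [← hk, ← Equiv.Perm.mul_apply, ← zpow_add, show -j + (2 * j + 1) = 1 + j by ring, zpow_add,
      Equiv.Perm.mul_apply, zpow_one, hE, rot_apply] at this
    exact move_ne_move (by decide) (by decide) (by decide) _ this

theorem rot_zpow_eq_iterate (k : ℤ) (y : T.Flag) :
    ∃ i < Function.minimalPeriod T.rot y, (T.rot ^ k) y = T.rot^[i] y := by
  obtain ⟨n, hn⟩ : T.rot ^ k ∈ Submonoid.powers T.rot :=
    mem_powers_iff_mem_zpowers.mpr ⟨k, rfl⟩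
  have pos : 0 < Function.minimalPeriod T.rot y :=
    Function.minimalPeriod_pos_of_mem_periodicPts (T.rot.injective.mem_periodicPts y)
  refine ⟨n % Function.minimalPeriod T.rot y, Nat.mod_lt _ pos, ?_⟩
  rw [Function.iterate_mod_minimalPeriod_eq, ← hn]
  simp [Equiv.Perm.iterate_eq_pow]

/-- Rotation preserves the sign while the two flags of a short edge have opposite signs, so one full
turn meets each short edge of the disc once. As `rot` is `short` after `glue`, the short edge
traversed in the step from `rot^i y` starts at its image under `glue`. -/
theorem sum_minimalPeriod {A : Type*} [AddCommMonoid A] (g : T.ShortEdges → A) (y : T.Flag)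
    [DecidablePred fun Y : T.ShortEdges => Y.proj (by decide) = cell {.short, .glue} y] :
    ∑ i ∈ Finset.range (Function.minimalPeriod T.rot y),
        g (cell _ (T.move .glue (T.rot^[i] y))) =
      ∑ Y : T.ShortEdges with Y.proj (by decide) = cell {.short, .glue} y, g Y := by
  have it : ∀ i, T.rot^[i] y = (T.rot ^ (i : ℤ)) y := fun i => by
    simp [Equiv.Perm.iterate_eq_pow]
  rw [Finset.sum_range]
  symm
  refine sum_cells _ y
    (fun i : Fin (Function.minimalPeriod T.rot y) => T.move .glue (T.rot^[i] y)) ?_ ?_ ?_ g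
  · intro i j e
    rcases cell_single e with e | e
    · exact Fin.ext (Function.iterate_injOn_Iio_minimalPeriod i.2 j.2
        ((T.move_involutive .glue).injective e))
    · have := congrArg T.sgn e
      simp only [sgn_move, it, sgn_rot_zpow] at this
      rcases T.sgn_eq y with e | e <;> rw [e] at this <;> exact absurd this (by decide)
  · intro i
    rw [cell_move (by decide), it, cell_rot_zpow]
  · intro y' e
    obtain ⟨k, rfl | rfl⟩ := edgeDisc_orbit e
    · obtain ⟨i, hi, e⟩ := rot_zpow_eq_iterate (-1 + k) y
      refine ⟨⟨i, hi⟩, ?_⟩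
      simp only [← e]
      rw [zpow_add, Equiv.Perm.mul_apply, zpow_neg_one, rot_symm_apply, move_move,
        cell_move (by decide)]
    · obtain ⟨i, hi, e⟩ := rot_zpow_eq_iterate k y
      exact ⟨⟨i, hi⟩, by simp only [← e]⟩

/-- A function on the short edges is the variation of a function on the flags around every edge disc
if its sum over every edge disc is zero. -/
theorem exists_discPotential {A : Type*} [AddCommGroup A]
    [∀ D : T.EdgeDiscs, DecidablePred fun Y : T.ShortEdges => Y.proj (by decide) = D]
    (g : T.ShortEdges → A)
    (hg : ∀ D : T.EdgeDiscs, ∑ Y : T.ShortEdges with Y.proj (by decide) = D, g Y = 0) :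
    ∃ ν : T.Flag → A, (∀ y, ν (T.move .glue y) = ν y) ∧
      ∀ y, ν (T.move .short y) = ν y + (T.sgn y : ℤ) • g (cell _ y) := by
  -- A rotation step runs along the short edge from `glue y`, whose sign is opposite to that of `y`;
  -- hence the minus sign at even flags. Values at odd flags are transferred by `glue` at the end.
  let w : T.Flag → A := fun y => if T.sgn y = 1 then -g (cell _ (T.move .glue y)) else 0
  obtain ⟨h, hh⟩ := exists_potential T.rot id w (by
    intro len u hu
    simp only [id] at hu
    have hu' : ∀ i : ℕ, ∀ hi : i < len + 1, u ⟨i, hi⟩ = T.rot^[i] (u 0) := by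
      intro i
      induction i with
      | zero => intro _; rfl
      | succ i ih =>
        intro hi
        rw [Function.iterate_succ_apply', ← ih (by omega), ← hu]
        congr 1
        ext
        rw [Fin.val_add_one_of_lt (by simp [Fin.lt_def]; omega)]
    have per : Function.IsPeriodicPt T.rot (len + 1) (u 0) := by
      have := hu (Fin.last len)
      rw [Fin.last_add_one] at this
      rw [Function.IsPeriodicPt, Function.IsFixedPt, Function.iterate_succ_apply', ← hu' len (by omega)]
      exact this.symm
    have e : ∑ i, w (u i) = ∑ i ∈ Finset.range (len + 1), w (T.rot^[i] (u 0)) := by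
      rw [Finset.sum_range]
      exact Finset.sum_congr rfl fun i _ => by rw [← hu' i i.2]
    rw [e]
    clear e hu' hu
    generalize u 0 = z at per ⊢
    clear u
    have sg : ∀ i, T.sgn (T.rot^[i] z) = T.sgn z := by
      intro i
      rw [show T.rot^[i] z = (T.rot ^ (i : ℤ)) z by simp [Equiv.Perm.iterate_eq_pow],
        sgn_rot_zpow]
    by_cases h1 : T.sgn z = 1
    -- A closed walk turns `c` times around the disc, and each turn contributes the sum over the
    -- disc.
    · obtain ⟨c, hc⟩ := per.minimalPeriod_dvd
      rw [hc]
      clear hc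
      induction c with
      | zero => simp
      | succ c ih =>
        rw [Nat.mul_succ, Finset.sum_range_add, ih, zero_add]
        have : ∀ i, T.rot^[Function.minimalPeriod T.rot z * c + i] z = T.rot^[i] z := by
          intro i
          rw [← Function.iterate_mod_minimalPeriod_eq, Nat.mul_add_mod,
            Function.iterate_mod_minimalPeriod_eq]
        simp only [this, w, sg, h1, if_true, Finset.sum_neg_distrib]
        rw [sum_minimalPeriod, hg, neg_zero]
    · exact Finset.sum_eq_zero fun i _ => by simp [w, sg, h1])
  simp only [id] at hh
  refine ⟨fun y => if T.sgn y = 1 then h y else h (T.move .glue y), fun y => ?_, fun y => ?_⟩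
  · rcases T.sgn_eq y with e | e <;> simp [e, move_move]
  · rcases T.sgn_eq y with e | e
    · have := hh (T.move .glue (T.move .short y))
      simp only [w, rot_apply, move_move, sgn_move, neg_neg, e, if_true] at this
      rw [cell_move (by decide)] at this
      simp [e, this]
    · have := hh (T.move .glue y)
      simp only [w, rot_apply, move_move, sgn_move, neg_neg, e, if_true] at this
      simp [e, this]

/-- The sum telescopes along one turn of the rotation. This is the way in which edge equations are
verified below. -/
theorem sum_edgeDisc_eq_zero {A : Type*} [AddCommGroup A] (g : T.ShortEdges → A) (ν : T.Flag → A)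
    (h₁ : ∀ y, ν (T.move .glue y) = ν y)
    (h₂ : ∀ y, ν (T.move .short y) = ν y + (T.sgn y : ℤ) • g (cell _ y)) (D : T.EdgeDiscs)
    [DecidablePred fun Y : T.ShortEdges => Y.proj (by decide) = D] :
    ∑ Y : T.ShortEdges with Y.proj (by decide) = D, g Y = 0 := by
  obtain ⟨y, rfl⟩ := exists_cell D
  rw [← sum_minimalPeriod]
  have key : ∀ i, g (cell _ (T.move .glue (T.rot^[i] y))) =
      -(T.sgn y : ℤ) • (ν (T.rot^[i + 1] y) - ν (T.rot^[i] y)) := by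
    intro i
    rw [Function.iterate_succ_apply', rot_apply, h₂, h₁, add_sub_cancel_left, sgn_move]
    rw [show T.sgn (T.rot^[i] y) = T.sgn y by
      rw [show T.rot^[i] y = (T.rot ^ (i : ℤ)) y by simp [Equiv.Perm.iterate_eq_pow], sgn_rot_zpow]]
    rcases T.sgn_eq y with e | e <;> simp [e]
  simp only [key]
  rw [← Finset.smul_sum, Finset.sum_range_sub (fun i => ν (T.rot^[i] y)),
    Function.iterate_minimalPeriod]
  simp

/-! ### Sums over the edges of tetrahedra in an edge class -/

theorem sum_G {A : Type*} [AddCommMonoid A] (E : T.Edges) (f : T.Quad → A)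
    [DecidablePred fun r : T.Rectangles => r.proj (by decide) = E] :
    ∑ q, T.G E q • f q = ∑ r : T.Rectangles with r.proj (by decide) = E, f (T.rectQuad r) := by
  rw [← Finset.sum_fiberwise (g := T.rectQuad)]
  refine Finset.sum_congr rfl fun q _ => ?_
  rw [Finset.sum_congr rfl (g := fun _ => f q) fun r hr => by rw [(Finset.mem_filter.mp hr).2],
    Finset.sum_const, G, Nat.card_eq_fintype_card, Finset.filter_filter, Fintype.card_subtype]

/-- The two ends of an edge are different discs (`edgeDisc_long_ne`), so every rectangle along the
edge has exactly one short side on the disc at the given end. An edge equation thereby becomes a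
condition on a single disc. -/
theorem sum_rectangles {A : Type*} [AddCommMonoid A] (g : T.Rectangles → A) (y : T.Flag)
    [DecidablePred fun r : T.Rectangles => r.proj (by decide) = cell {.long, .short, .glue} y]
    [DecidablePred fun Y : T.ShortEdges => Y.proj (by decide) = cell {.short, .glue} y] :
    ∑ r : T.Rectangles with r.proj (by decide) = cell {.long, .short, .glue} y, g r =
      ∑ Y : T.ShortEdges with Y.proj (by decide) = cell {.short, .glue} y,
        g (Y.proj (by decide)) := by
  symm
  refine Finset.sum_bij (fun Y _ => Y.proj (by decide)) ?_ ?_ ?_ fun _ _ => rfl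
  · intro Y hY
    obtain ⟨z, rfl⟩ := exists_cell Y
    simp only [Finset.mem_filter, Finset.mem_univ, true_and, proj_cell] at hY ⊢
    exact cell_mono (by decide) hY
  · intro Y hY Z hZ e
    obtain ⟨z, rfl⟩ := exists_cell Y
    obtain ⟨z', rfl⟩ := exists_cell Z
    simp only [Finset.mem_filter, Finset.mem_univ, true_and, proj_cell] at hY hZ e
    have ne := edgeDisc_long_ne z'
    rcases cell_pair (fun y => (short_long y).symm) e with rfl | rfl | rfl | rfl
    · rfl
    · exact absurd (hY.trans hZ.symm) ne
    · exact cell_move (by decide) _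
    · rw [← short_long, cell_move (by decide)] at hY
      exact absurd (hY.trans hZ.symm) ne
  · intro r hr
    obtain ⟨z, rfl⟩ := exists_cell r
    simp only [Finset.mem_filter, Finset.mem_univ, true_and, proj_cell] at hr
    have : cell {.short, .glue} z = cell {.short, .glue} y ∨
        cell {.short, .glue} (T.move .long z) = cell {.short, .glue} y := by
      refine cell_invariant (P := fun z => cell {.short, .glue} z = cell {.short, .glue} y ∨
        cell {.short, .glue} (T.move .long z) = cell {.short, .glue} y) ?_ hr (.inl rfl)
      intro c hc z hz
      obtain rfl | rfl | rfl : c = .long ∨ c = .short ∨ c = .glue := by simpa using hc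
      · rw [move_move]; exact hz.symm
      · rwa [← short_long, cell_move (by decide), cell_move (by decide)]
      · rwa [← glue_long, cell_move (by decide), cell_move (by decide)]
    rcases this with h | h
    · exact ⟨cell _ z, by simpa using h, rfl⟩
    · exact ⟨cell _ (T.move .long z), by simpa using h, cell_move (by decide) z⟩

/-! ### Angle structures of even parity and co-orientations of the faces -/

theorem sum_quadType {A : Type*} [AddCommMonoid A] (f : Fin 3 → A) {i j k : Fin 4} (hij : i ≠ j)
    (hjk : j ≠ k) (hik : i ≠ k) :
    f (quadType i j) + f (quadType j k) + f (quadType i k) = f 0 + f 1 + f 2 := by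
  fin_cases i <;> fin_cases j <;> fin_cases k <;> first
    | exact absurd rfl hij
    | exact absurd rfl hjk
    | exact absurd rfl hik
    | (simp [quadType]; try abel)

theorem sum_add_one {A : Type*} [AddCommMonoid A] (f : Fin 3 → A) (k : Fin 3) :
    f k + f (k + 1) + f (k + 2) = f 0 + f 1 + f 2 := by
  fin_cases k
  · rfl
  · change f 1 + f 2 + f 0 = _; abel
  · change f 2 + f 0 + f 1 = _; abel

variable (T) in
/-- A transverse orientation of the faces for which an even number of faces of each tetrahedron are
oriented inwards. -/
structure IsEvenCoorientation (ρ : Fin N → Fin 4 → ZMod 2) : Prop where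
  glue : ∀ t f, ρ (T.adj t f) (T.gluing t f f) = ρ t f + 1
  even : ∀ t, ρ t 0 + ρ t 1 + ρ t 2 + ρ t 3 = 0

/-- Normal curves are the closed walks in the graph whose vertices are the sides of faces and whose
edges are the passages through tetrahedra. Vanishing parity makes `α` the variation of a potential
there, and that potential is the co-orientation. -/
theorem exists_coorientation {α : T.Quad → ZMod 2} (hα : α ∈ T.evenAngles) :
    ∃ ρ, T.IsEvenCoorientation ρ ∧
      ∀ t i j, i ≠ j → α (t, quadType i j) = 1 + ρ t i + ρ t j := by
  obtain ⟨h, hh⟩ := exists_potential T.rot (fun y => (y.1, y.2 2))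
    (fun y => α (y.1, quadType (y.2 2) (y.2 3))) (by
      intro len u hu
      exact hα.2 ⟨len, fun i => (u i).1, fun i => (u i).2 2, fun i => (u i).2 3,
        fun i e => absurd ((u i).2.injective e) (by decide),
        fun i => congrArg Prod.fst (hu i), fun i => by
          refine (congrArg Prod.snd (hu i)).trans ?_
          simp [rot_apply, move]⟩)
  have h1 : ∀ t i j, i ≠ j →
      h (T.adj t j, T.gluing t j j) = h (t, i) + α (t, quadType i j) := by
    intro t i j hij
    obtain ⟨p, hp, hp'⟩ : ∃ p : Equiv.Perm (Fin 4), p 2 = i ∧ p 3 = j := by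
      revert i j; decide
    simpa [rot_apply, move, hp, hp'] using hh (t, p)
  have h2 : ∀ t i j, i ≠ j → α (t, quadType i j) = 1 + h (t, i) + h (t, j) := by
    intro t i j hij
    -- The passages from `i` and from `j` out through a third face `k` arrive at the same side. This
    -- compares the potentials at `i` and `j` through the values at `{i, k}` and `{j, k}`, and the
    -- tetrahedral equation trades these for the value at `{i, j}`.
    obtain ⟨k, hik, hjk⟩ : ∃ k, i ≠ k ∧ j ≠ k := by revert i j; decide
    have e₁ := h1 t i k hik
    have e₂ := h1 t j k hjk
    have e₃ := sum_quadType (fun k => α (t, k)) hij hjk hik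
    rw [← hα.1 t 0] at *
    simp only [zero_add] at e₃ ⊢
    rw [e₁] at e₂
    rw [← e₃]
    generalize α (t, quadType i j) = a at *
    generalize α (t, quadType i k) = b at *
    generalize α (t, quadType j k) = c at *
    generalize h (t, i) = d at *
    generalize h (t, j) = e at *
    clear e₁ e₃ h1 hh
    revert a b c d e; decide
  refine ⟨fun t f => h (t, f), ⟨fun t f => ?_, fun t => ?_⟩, h2⟩
  · obtain ⟨k, hk⟩ : ∃ k, k ≠ f := by revert f; decide
    rw [h1 t k f hk, h2 t k f hk]
    generalize h (t, k) = a
    generalize h (t, f) = b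
    revert a b; decide
  · have e₁ := h2 t 0 1 (by decide)
    have e₂ := h2 t 2 3 (by decide)
    rw [show quadType 2 3 = quadType 0 1 from rfl, e₁] at e₂
    generalize h (t, 0) = a at *
    generalize h (t, 1) = b at *
    generalize h (t, 2) = c at *
    generalize h (t, 3) = d at *
    clear e₁ h1 h2 hh
    revert a b c d; decide

/-- Since `ρ` changes by 1 across a face, each passage contributes the sum of `ρ` at two consecutive
entrances, and these cancel in pairs around a closed curve. -/
theorem mem_evenAngles {α : T.Quad → ZMod 2} {ρ : Fin N → Fin 4 → ZMod 2}
    (hρ : T.IsEvenCoorientation ρ)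
    (h : ∀ t i j, i ≠ j → α (t, quadType i j) = 1 + ρ t i + ρ t j) : α ∈ T.evenAngles := by
  refine ⟨fun t k => ?_, fun θ => ?_⟩
  · rw [sum_add_one (fun k => α (t, k))]
    have e₀ := h t 0 1 (by decide)
    have e₁ := h t 0 2 (by decide)
    have e₂ := h t 0 3 (by decide)
    have e := hρ.even t
    simp only [quadType] at e₀ e₁ e₂
    change α (t, 0) = _ at e₀
    change α (t, 1) = _ at e₁
    change α (t, 2) = _ at e₂
    rw [e₀, e₁, e₂]
    generalize ρ t 0 = a at *
    generalize ρ t 1 = b at *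
    generalize ρ t 2 = c at *
    generalize ρ t 3 = d at *
    clear e₀ e₁ e₂
    revert a b c d; decide
  · have step : ∀ i, α (θ.tet i, quadType (θ.inFace i) (θ.outFace i)) =
        ρ (θ.tet i) (θ.inFace i) + ρ (θ.tet (i + 1)) (θ.inFace (i + 1)) := by
      intro i
      rw [h _ _ _ (θ.no_backtrack i), θ.next_tet, θ.next_inFace, hρ.glue]
      ring
    simp only [NormalCurve.parity, step]
    have e := Equiv.sum_comp (Equiv.addRight (1 : Fin (θ.len + 1)))
      (fun i => ρ (θ.tet i) (θ.inFace i))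
    simp only [Equiv.coe_addRight] at e
    rw [Finset.sum_add_distrib, e]
    exact CharTwo.add_self_eq_zero _

variable (T) in
/-- The other side of a side of a face. -/
def otherSide (s : Fin N × Fin 4) : Fin N × Fin 4 := (T.adj s.1 s.2, T.gluing s.1 s.2 s.2)

theorem otherSide_involutive : Function.Involutive T.otherSide := by
  rintro ⟨t, f⟩
  simp [otherSide, T.adj_adj, T.gluing_gluing]

theorem exists_side_function :
    ∃ r : Fin N × Fin 4 → ZMod 2, ∀ s, r (T.otherSide s) = r s + 1 := by
  classical
  let e := Fintype.equivFin (Fin N × Fin 4)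
  refine ⟨fun s => if e s < e (T.otherSide s) then 0 else 1, fun s => ?_⟩
  have ne : e (T.otherSide s) ≠ e s := fun h => T.distinct s.1 s.2 (e.injective h)
  simp only [otherSide_involutive s]
  rcases lt_or_gt_of_ne ne with h | h
  · rw [if_pos h, if_neg h.le.not_gt]; decide
  · rw [if_neg h.le.not_gt, if_pos h]; decide

/-- One side of every face has value 1, so the sum counts the 2N faces. -/
theorem sum_side_function {r : Fin N × Fin 4 → ZMod 2}
    (hr : ∀ s, r (T.otherSide s) = r s + 1) : ∑ s, r s = 0 := by
  classical
  have h1 : ∀ a : ZMod 2, a = if a = 1 then 1 else 0 := by decide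
  have card : (Finset.univ.filter fun s => r s = 1).card =
      (Finset.univ.filter fun s => ¬ r s = 1).card := by
    refine Finset.card_bij (fun s _ => T.otherSide s) ?_
      (fun _ _ _ _ e => otherSide_involutive.injective e) ?_
    · intro s hs
      simp only [Finset.mem_filter, Finset.mem_univ, true_and] at hs ⊢
      rw [hr, hs]; decide
    · intro s hs
      simp only [Finset.mem_filter, Finset.mem_univ, true_and] at hs
      refine ⟨T.otherSide s, ?_, otherSide_involutive s⟩
      simp only [Finset.mem_filter, Finset.mem_univ, true_and, hr]
      generalize r s = a at hs
      revert a; decide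
  have total := Finset.card_filter_add_card_filter_not (s := Finset.univ) (fun s => r s = 1)
  rw [← card, Finset.card_univ, Fintype.card_prod, Fintype.card_fin, Fintype.card_fin] at total
  rw [Finset.sum_congr rfl fun s _ => h1 (r s), Finset.sum_boole,
    show (Finset.univ.filter fun s => r s = 1).card = 2 * N by omega]
  push_cast
  rw [show (2 : ZMod 2) = 0 from rfl, zero_mul]

/-- Start from any co-orientation. The parities of the numbers of inward faces add up to 2N = 0, and
reversing a face changes the parities of the tetrahedra on its two sides. By connectedness all odd
tetrahedra can be removed in pairs. -/
theorem exists_isEvenCoorientation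
    (hT : ∀ s t : Fin N, Relation.ReflTransGen (fun a b => ∃ f, T.adj a f = b) s t) :
    ∃ ρ, T.IsEvenCoorientation ρ := by
  classical
  obtain ⟨r, hr⟩ := exists_side_function (T := T)
  let H : AddSubgroup (Fin N → ZMod 2) :=
    { carrier := {g | ∃ β : Fin N × Fin 4 → ZMod 2, (∀ s, β (T.otherSide s) = β s) ∧
        ∀ t, g t = ∑ f, β (t, f)}
      add_mem' := by
        rintro _ _ ⟨β, h, h'⟩ ⟨β', k, k'⟩
        exact ⟨β + β', fun s => by simp [h, k], fun t => by simp [h', k', Finset.sum_add_distrib]⟩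
      zero_mem' := ⟨0, by simp, by simp⟩
      neg_mem' := by
        rintro _ ⟨β, h, h'⟩
        exact ⟨-β, fun s => by simp [h], fun t => by simp [h']⟩ }
  have key : (fun t => ∑ f, r (t, f)) ∈ H := by
    refine mem_of_sum_fiber_eq_zero H (fun a b => ∃ f, T.adj a f = b) ?_ (fun _ => ())
      (fun x y _ => ?_) _ ?_
    · rintro t _ a ⟨f, rfl⟩
      refine ⟨Pi.single (t, f) a + Pi.single (T.otherSide (t, f)) a, fun s => ?_, fun t' => ?_⟩
      · have : ∀ u, (T.otherSide s = u ↔ s = T.otherSide u) := fun u =>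
          ⟨fun h => by rw [← h, otherSide_involutive], fun h => by rw [h, otherSide_involutive]⟩
        simp only [Pi.add_apply, Pi.single_apply, this, otherSide_involutive (t, f)]
        rw [add_comm]
      · have : ∀ u : Fin N × Fin 4, ∑ f', (Pi.single u a : Fin N × Fin 4 → ZMod 2) (t', f') =
            (Pi.single u.1 a : Fin N → ZMod 2) t' := by
          intro u
          simp only [Pi.single_apply, Prod.ext_iff]
          by_cases h : t' = u.1 <;> simp [h]
        simp only [Pi.add_apply, Finset.sum_add_distrib, this, Pi.sub_apply]
        rw [sub_eq_add_neg, CharTwo.neg_eq]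
        rfl
    · induction hT x y with
      | refl => exact .refl _
      | tail _ h ih => exact .trans _ _ _ ih (.rel _ _ h)
    · intro _
      rw [← sum_side_function hr, Fintype.sum_prod_type]
      simp
  obtain ⟨β, h, h'⟩ := key
  refine ⟨fun t f => r (t, f) + β (t, f), fun t f => ?_, fun t => ?_⟩
  · have h₁ := hr (t, f)
    have h₂ := h (t, f)
    simp only [otherSide] at h₁ h₂
    rw [h₁, h₂]; ring
  · have := h' t
    simp only [Fin.sum_univ_four] at this
    calc _ = (r (t, 0) + r (t, 1) + r (t, 2) + r (t, 3)) +
          (β (t, 0) + β (t, 1) + β (t, 2) + β (t, 3)) := by ring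
      _ = 0 := by rw [this]; exact CharTwo.add_self_eq_zero _

/-- The angle structure of even parity given by an even co-orientation. -/
def turn (ρ : Fin N → Fin 4 → ZMod 2) (q : T.Quad) : ZMod 2 := 1 + ρ q.1 0 + ρ q.1 q.2.succ

/-- `turn` reads off the pair of faces that contains the face 0; by evenness the complementary pair
gives the same value. -/
theorem turn_quadType {ρ : Fin N → Fin 4 → ZMod 2} (hρ : T.IsEvenCoorientation ρ) (t : Fin N)
    {i j : Fin 4} (hij : i ≠ j) :
    turn (T := T) ρ (t, quadType i j) = 1 + ρ t i + ρ t j := by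
  have := hρ.even t
  have key : ∀ (x : Fin 4 → ZMod 2) (i j : Fin 4), i ≠ j → x 0 + x 1 + x 2 + x 3 = 0 →
      1 + x 0 + x (quadType i j).succ = 1 + x i + x j := by decide
  exact key (ρ t) i j hij this

theorem turn_mem_evenAngles {ρ : Fin N → Fin 4 → ZMod 2} (hρ : T.IsEvenCoorientation ρ) :
    turn ρ ∈ T.evenAngles :=
  mem_evenAngles hρ fun t _ _ h => turn_quadType hρ t h

theorem evenAngles_eq_turn {α : T.Quad → ZMod 2} (hα : α ∈ T.evenAngles) :
    ∃ ρ, T.IsEvenCoorientation ρ ∧ α = turn ρ := by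
  obtain ⟨ρ, hρ, h⟩ := exists_coorientation hα
  refine ⟨ρ, hρ, ?_⟩
  ext ⟨t, k⟩
  obtain ⟨i, j, hij, rfl⟩ : ∃ i j : Fin 4, i ≠ j ∧ quadType i j = k := by revert k; decide
  rw [h t i j hij, turn_quadType hρ t hij]

theorem turn_quadOf {ρ : Fin N → Fin 4 → ZMod 2} (hρ : T.IsEvenCoorientation ρ) (y : T.Flag) :
    turn ρ (quadOf y) = 1 + ρ y.1 (y.2 2) + ρ y.1 (y.2 3) := by
  rw [quadOf, ← quadType_compl, turn_quadType hρ y.1 fun e => absurd (y.2.injective e) (by decide)]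

/-! ### Linearized gluing equations -/

section Tangent

variable {A : Type*} [AddCommGroup A]

variable (T) in
/-- Solutions of the homogeneous linearized gluing equations, with values in an abelian group. -/
structure IsTangent (f : T.Quad → A) : Prop where
  tet : ∀ t, f (t, 0) + f (t, 1) + f (t, 2) = 0
  edge : ∀ E, ∑ q, T.G E q • f q = 0

variable (T) in
/-- The linearized completeness equations. -/
def IsPeripherallyTrivial (f : T.Quad → A) : Prop :=
  ∀ γ : T.PeripheralCurve, ∑ q, γ.coeff q • f q = 0

variable (T) in
/-- `l` is a function on the sides of the triangles cut off by the vertices of the tetrahedra (the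
flag `y` stands for the side in its face, at its vertex), whose variation around the corners of the
triangles is given by `f`. -/
structure IsSideFunction (f : T.Quad → A) (l : T.Flag → A) : Prop where
  medium : ∀ y, l (T.move .medium y) = l y
  short : ∀ y, l (T.move .short y) = l y + (T.sgn y : ℤ) • f (quadOf y)

theorem apply_eq_of_medium {X : Type*} {l : T.Flag → X} (hl : ∀ y, l (T.move .medium y) = l y)
    {y y' : T.Flag} (h : y'.1 = y.1) (h₀ : y'.2 0 = y.2 0) (h₃ : y'.2 3 = y.2 3) : l y' = l y := by
  obtain ⟨t, p⟩ := y
  obtain ⟨t', p'⟩ := y'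
  obtain rfl : t' = t := h
  have : ∀ p' p : Equiv.Perm (Fin 4), p' 0 = p 0 → p' 3 = p 3 → p' = p ∨ p' = p * Equiv.swap 1 2 := by
    intro p' p h₀ h₃
    have : ∀ q : Equiv.Perm (Fin 4), q 0 = 0 → q 3 = 3 → q = 1 ∨ q = Equiv.swap 1 2 := by decide
    rcases this (p⁻¹ * p') (by simp [h₀]) (by simp [h₃]) with h | h
    · exact .inl (inv_mul_eq_one.mp h).symm
    · exact .inr (inv_mul_eq_iff_eq_mul.mp h)
  rcases this p' p h₀ h₃ with rfl | rfl
  · rfl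
  · exact hl (t', p)

@[simp] theorem quadOf_short (y : T.Flag) : quadOf (T.move .short y) = quadOf y := by
  simp [quadOf, move, Equiv.swap_apply_of_ne_of_ne]

@[simp] theorem quadOf_long (y : T.Flag) : quadOf (T.move .long y) = quadOf y := by
  simp [quadOf, move, quadType_comm]

/-- The three corners of a vertex triangle lie on edges that face the three different quadrilateral
types. -/
theorem sum_quadOf (f : T.Quad → A) (y : T.Flag) :
    f (quadOf y) + f (quadOf (T.move .medium y)) + f (quadOf (T.move .medium (T.move .short y))) =
      f (y.1, 0) + f (y.1, 1) + f (y.1, 2) := by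
  obtain ⟨t, p⟩ := y
  have e : quadType (p 0) (p 3) = quadType (p 1) (p 2) := by
    revert p; decide
  rw [← sum_quadType (fun k => f (t, k)) (p.injective.ne (by decide : (0 : Fin 4) ≠ 1))
    (p.injective.ne (by decide : (1 : Fin 4) ≠ 2)) (p.injective.ne (by decide : (0 : Fin 4) ≠ 2))]
  simp only [quadOf, move, Equiv.Perm.mul_apply, Equiv.swap_apply_left,
    show Equiv.swap (1 : Fin 4) 2 0 = 0 by decide, show Equiv.swap (2 : Fin 4) 3 0 = 0 by decide, e]
  abel

/-- Go once around a vertex triangle: the variation at the three corners must add up to zero. -/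
theorem IsSideFunction.tet {f : T.Quad → A} {l : T.Flag → A} (h : T.IsSideFunction f l)
    (t : Fin N) : f (t, 0) + f (t, 1) + f (t, 2) = 0 := by
  have e₁ := h.short (t, 1)
  have e₂ := h.short (T.move .medium (t, 1))
  have e₃ := h.short (T.move .medium (T.move .short (t, 1)))
  rw [h.medium] at e₂
  rw [short_medium_short, h.medium, h.medium, e₂, e₁] at e₃
  rw [← sum_quadOf f (t, 1)]
  simp only [sgn_move] at e₂ e₃
  rw [show T.sgn (t, 1) = 1 by simp [sgn]] at e₂ e₃
  simp only [Units.val_neg, Units.val_one, neg_smul, one_smul, neg_neg] at e₃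
  generalize f (quadOf (t, 1)) = a at *
  generalize f (quadOf (T.move .medium (t, 1))) = b at *
  generalize f (quadOf (T.move .medium (T.move .short (t, 1)))) = c at *
  have : l (t, 1) + (a + b + c) = l (t, 1) := by
    calc _ = l (t, 1) + a + c + b := by abel
      _ = _ := by rw [← e₃]; abel
  simpa using this

theorem exists_sideFunction {f : T.Quad → A} (hf : ∀ t, f (t, 0) + f (t, 1) + f (t, 2) = 0) :
    ∃ l, T.IsSideFunction f l := by
  -- The side in the face opposite to `p 3` is indexed by the type `k` of the edge `{p 0, p 3}`,
  -- i.e. by the opposite corner. The corner of type `k` joins the sides `k + 1` and `k + 2`, whose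
  -- values must differ by `f k`; the tetrahedral equation makes the three demands compatible.
  refine ⟨fun y => ![0, -f (y.1, 2), f (y.1, 1)] (quadType (y.2 0) (y.2 3)), fun y => ?_, ?_⟩
  · simp [move, Equiv.swap_apply_of_ne_of_ne]
  rintro ⟨t, p⟩
  have hΛ : ∀ k : Fin 3, (![0, -f (t, 2), f (t, 1)] : Fin 3 → A) (k + 1) =
      (![0, -f (t, 2), f (t, 1)] : Fin 3 → A) (k + 2) + f (t, k) := by
    intro k
    have := hf t
    fin_cases k
    · change -f (t, 2) = f (t, 1) + f (t, 0)
      rw [neg_eq_iff_add_eq_zero, ← this]; abel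
    · change f (t, 1) = 0 + f (t, 1)
      rw [zero_add]
    · change 0 = -f (t, 2) + f (t, 2)
      rw [neg_add_cancel]
  have key : ∀ p : Equiv.Perm (Fin 4),
      (Equiv.Perm.sign p = 1 ∧ quadType (p 0) (p 2) = quadType (p 0) (p 1) + 1 ∧
        quadType (p 0) (p 3) = quadType (p 0) (p 1) + 2) ∨
      (Equiv.Perm.sign p = -1 ∧ quadType (p 0) (p 2) = quadType (p 0) (p 1) + 2 ∧
        quadType (p 0) (p 3) = quadType (p 0) (p 1) + 1) := by
    decide
  simp only [move, quadOf, sgn, Equiv.Perm.mul_apply, Equiv.swap_apply_right,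
    show Equiv.swap (2 : Fin 4) 3 0 = 0 by decide]
  rcases key p with ⟨h, h₂, h₃⟩ | ⟨h, h₂, h₃⟩
  · rw [h, h₂, h₃, hΛ]; simp
  · rw [h, h₂, h₃, hΛ]; simp

theorem sum_coeff (γ : T.PeripheralCurve) (f : T.Quad → A) :
    ∑ q, γ.coeff q • f q = ∑ i, -((T.sgn (γ.step i) : ℤ) • f (quadOf (γ.step i))) := by
  simp only [PeripheralCurve.coeff, Finset.sum_smul]
  rw [Finset.sum_comm]
  refine Finset.sum_congr rfl fun i _ => ?_
  rw [Finset.sum_eq_single (quadOf (γ.step i))]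
  · simp [sgn]
  · intro q _ h; rw [if_neg h.symm, zero_smul]
  · simp

/-- Along a peripheral curve each corner contributes the difference of `l` at exit and entrance. If
`l` agrees on both sides of each face, these differences cancel cyclically. -/
theorem IsSideFunction.isPeripherallyTrivial {f : T.Quad → A} {l : T.Flag → A}
    (h : T.IsSideFunction f l) (hl : ∀ y, l (T.move .glue y) = l y) :
    T.IsPeripherallyTrivial f := by
  intro γ
  have next : ∀ i, l (T.move .short (γ.step (i + 1))) = l (γ.step i) := by
    intro i
    rw [← hl (γ.step i)]
    refine apply_eq_of_medium h.medium (γ.next_tet i) ?_ ?_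
    · rw [← γ.next_vertex i]; simp [move, Equiv.swap_apply_of_ne_of_ne]
    · rw [← γ.next_inFace i]; simp [move]
  have e := Equiv.sum_comp (Equiv.addRight (1 : Fin (γ.len + 1)))
    (fun i => l (T.move .short (γ.step i)))
  simp only [Equiv.coe_addRight, next] at e
  rw [sum_coeff, Finset.sum_neg_distrib, neg_eq_zero]
  have : ∀ i, (T.sgn (γ.step i) : ℤ) • f (quadOf (γ.step i)) =
      l (T.move .short (γ.step i)) - l (γ.step i) := by
    intro i; rw [h.short, add_sub_cancel_left]
  simp only [this, Finset.sum_sub_distrib, e, sub_self]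

/-- If the peripheral holonomies are trivial, then there is a side function that takes the same
values on both sides of the faces. -/
theorem exists_glue_sideFunction {f : T.Quad → A} (hf : ∀ t, f (t, 0) + f (t, 1) + f (t, 2) = 0)
    (hf' : T.IsPeripherallyTrivial f) :
    ∃ l, T.IsSideFunction f l ∧ ∀ y, l (T.move .glue y) = l y := by
  obtain ⟨h, hh⟩ := exists_potential T.rot (fun y => (y.1, y.2 0, y.2 2))
    (fun y => -((T.sgn y : ℤ) • f (quadOf y))) (by
      intro len u hu
      let γ : T.PeripheralCurve :=
        { len := len
          step := u
          next_tet := fun i => (Prod.ext_iff.mp (hu i)).1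
          next_vertex := fun i => by
            refine (congrArg (fun x => x.2.1) (hu i)).trans ?_
            simp [rot_apply, move, Equiv.swap_apply_of_ne_of_ne]
          next_inFace := fun i => by
            refine (congrArg (fun x => x.2.2) (hu i)).trans ?_
            simp [rot_apply, move] }
      exact (sum_coeff γ f).symm.trans (hf' γ))
  -- The potential compares an entrance with the entrance of the next triangle. Here the entrances
  -- `p 2` and `p 3` are both led out through the third side `p 1` of the triangle; the tetrahedral
  -- equation replaces the two corners passed by the remaining one.
  have comp : ∀ t (p : Equiv.Perm (Fin 4)),
      h (t, p 0, p 2) = h (t, p 0, p 3) + (T.sgn (t, p) : ℤ) • f (quadOf (t, p)) := by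
    intro t p
    have e₂ := hh (T.move .short (T.move .medium (t, p)))
    have e₁ := hh (T.move .medium (T.move .short (T.move .medium (t, p))))
    rw [rot_apply] at e₁ e₂
    rw [glue_medium] at e₁
    have e₃ := sum_quadOf f (t, p)
    rw [hf, ← quadOf_short (T.move .medium (T.move .short (t, p))), short_medium_short,
      ← quadOf_short (T.move .medium (t, p))] at e₃
    simp only [sgn_move, neg_neg] at e₁ e₂
    have same : ∀ z : T.Flag, ((T.move .short (T.move .medium z)).1,
        (T.move .short (T.move .medium z)).2 0, (T.move .short (T.move .medium z)).2 2) =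
        ((T.move .short z).1, (T.move .short z).2 0, (T.move .short z).2 2) := by
      intro z; simp [move, Equiv.swap_apply_of_ne_of_ne]
    rw [same, e₂] at e₁
    have e₄ : ((T.move .short (T.move .medium (t, p))).1,
        (T.move .short (T.move .medium (t, p))).2 0, (T.move .short (T.move .medium (t, p))).2 2) =
        (t, p 0, p 3) := by simp [move, Equiv.swap_apply_of_ne_of_ne]
    have e₅ : ((T.move .medium (T.move .short (T.move .medium (t, p)))).1,
        (T.move .medium (T.move .short (T.move .medium (t, p)))).2 0,
        (T.move .medium (T.move .short (T.move .medium (t, p)))).2 2) =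
        (t, p 0, p 2) := by simp [move, Equiv.swap_apply_of_ne_of_ne]
    rw [e₄, e₅] at e₁
    rw [eq_neg_of_add_eq_zero_left ((add_assoc _ _ _).symm.trans e₃), smul_neg, smul_add]
    simp only [Units.val_neg, neg_smul, neg_neg] at e₁
    rw [← sub_eq_iff_eq_add] at e₁
    rw [← e₁]
    abel
  refine ⟨fun y => h (y.1, y.2 0, y.2 3), ⟨fun y => ?_, fun y => ?_⟩, fun y => ?_⟩
  · simp [move, Equiv.swap_apply_of_ne_of_ne]
  · simpa [move, Equiv.swap_apply_of_ne_of_ne] using comp y.1 y.2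
  · have e := hh y
    rw [comp y.1 y.2] at e
    simpa [rot_apply, move, Equiv.swap_apply_of_ne_of_ne] using e

end Tangent

/-! ### Solutions of the linearized equations from data on the edges. -/

theorem exists_pair_function {X : Type*} {m : T.Flag → X} (hl : ∀ y, m (T.move .long y) = m y)
    (hs : ∀ y, m (T.move .short y) = m y) :
    ∃ μ : Fin N → Fin 4 → Fin 4 → X, (∀ t a b, a ≠ b → μ t a b = μ t b a) ∧
      ∀ y : T.Flag, m y = μ y.1 (y.2 0) (y.2 1) := by
  have ex : ∀ a b : Fin 4, ∃ p : Equiv.Perm (Fin 4), a ≠ b → p 0 = a ∧ p 1 = b := by decide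
  choose P hP using ex
  have key : ∀ y : T.Flag, m y = m (y.1, P (y.2 0) (y.2 1)) := by
    rintro ⟨t, p⟩
    have h01 := hP (p 0) (p 1) (p.injective.ne (by decide))
    have : ∀ q p : Equiv.Perm (Fin 4), q 0 = p 0 → q 1 = p 1 → q = p ∨ q = p * Equiv.swap 2 3 := by
      intro q p h₀ h₁
      have : ∀ q : Equiv.Perm (Fin 4), q 0 = 0 → q 1 = 1 → q = 1 ∨ q = Equiv.swap 2 3 := by decide
      rcases this (p⁻¹ * q) (by simp [h₀]) (by simp [h₁]) with h | h
      · exact .inl (inv_mul_eq_one.mp h).symm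
      · exact .inr (inv_mul_eq_iff_eq_mul.mp h)
    rcases this _ _ h01.1 h01.2 with h | h
    · simp only [h]
    · simp only [h]
      exact (hs (t, p)).symm
  refine ⟨fun t a b => m (t, P a b), fun t a b hab => ?_, key⟩
  have e := key (T.move .long (t, P a b))
  rw [hl] at e
  simpa [move, (hP a b hab).1, (hP a b hab).2] using e

section

variable {A : Type*} [AddCommGroup A]

/-- The three permutations generate the stabilizer of a quadrilateral type, the dihedral group of
order 8. -/
theorem exists_quad_function {X : Type*} (Φ : Equiv.Perm (Fin 4) → X)
    (h₁ : ∀ p, Φ (p * Equiv.swap 0 1) = Φ p) (h₂ : ∀ p, Φ (p * Equiv.swap 2 3) = Φ p)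
    (h₃ : ∀ p, Φ (p * (Equiv.swap 0 2 * Equiv.swap 1 3)) = Φ p) :
    ∃ g : Fin 3 → X, ∀ p, Φ p = g (quadType (p 0) (p 1)) := by
  -- The 3-cycle 1 → 2 → 3 → 1 fixes the vertex 0, and its powers represent the three types.
  let c : Equiv.Perm (Fin 4) := Equiv.swap 1 2 * Equiv.swap 2 3
  refine ⟨fun k => Φ (c ^ k.val), fun p => ?_⟩
  have key : ∀ p : Equiv.Perm (Fin 4), ∃ q ∈ [c ^ (quadType (p 0) (p 1)).val,
      c ^ (quadType (p 0) (p 1)).val * (Equiv.swap 0 2 * Equiv.swap 1 3)],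
      p = q ∨ p = q * Equiv.swap 0 1 ∨ p = q * Equiv.swap 2 3 ∨
        p = q * Equiv.swap 0 1 * Equiv.swap 2 3 := by
    decide
  obtain ⟨q, hq, h⟩ := key p
  have hp : Φ p = Φ q := by rcases h with rfl | rfl | rfl | rfl <;> simp [h₁, h₂]
  rw [hp]
  simp only [List.mem_cons, List.not_mem_nil, or_false] at hq
  rcases hq with rfl | rfl
  · rfl
  · exact h₃ _

variable (T) in
/-- The data of a function `e` on the edges of the triangulation and a function `ν` on the short
edges whose jumps at the faces are the same at both ends of every medium edge. -/
structure IsEdgeData (e ν : T.Flag → A) : Prop where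
  long : ∀ y, e (T.move .long y) = e y
  short : ∀ y, e (T.move .short y) = e y
  glue : ∀ y, e (T.move .glue y) = e y
  short' : ∀ y, ν (T.move .short y) = ν y
  jump : ∀ y, ν (T.move .glue (T.move .medium y)) - ν (T.move .medium y) =
    ν (T.move .glue y) - ν y

/-- The function on the edges of the tetrahedra given by edge data. -/
def edgeSum (e ν : T.Flag → A) (y : T.Flag) : A := e y + ν y + ν (T.move .long y)

/-- The function on the sides of triangles given by edge data. -/
def sideSum (e ν : T.Flag → A) (y : T.Flag) : A :=
  edgeSum e ν y + edgeSum e ν (T.move .medium y) - edgeSum e ν (T.move .medium (T.move .long y))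

namespace IsEdgeData

variable {e ν : T.Flag → A}

theorem edgeSum_long (h : T.IsEdgeData e ν) (y : T.Flag) : edgeSum e ν (T.move .long y) = edgeSum e ν y := by
  simp only [edgeSum, h.long, move_move]; abel

theorem edgeSum_short (h : T.IsEdgeData e ν) (y : T.Flag) : edgeSum e ν (T.move .short y) = edgeSum e ν y := by
  simp only [edgeSum, h.short, h.short', ← short_long]

theorem edgeSum_glue (h : T.IsEdgeData e ν) (y : T.Flag) : edgeSum e ν (T.move .glue y) =
    edgeSum e ν y + (ν (T.move .glue y) - ν y) +
      (ν (T.move .glue (T.move .long y)) - ν (T.move .long y)) := by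
  simp only [edgeSum, h.glue, glue_long]; abel

theorem sideSum_medium (h : T.IsEdgeData e ν) (y : T.Flag) : sideSum e ν (T.move .medium y) = sideSum e ν y := by
  simp only [sideSum, move_move, ← long_medium_long, h.edgeSum_long]; abel

theorem sideSum_long (h : T.IsEdgeData e ν) (y : T.Flag) :
    sideSum e ν y + sideSum e ν (T.move .long y) = edgeSum e ν y + edgeSum e ν y := by
  simp only [sideSum, move_move, h.edgeSum_long]; abel

/-- Across a face the value of an edge jumps by the flow at each of its two ends. In the combination
of the three edges the jumps at the other two vertices cancel, and the one at the vertex of `y` is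
counted twice. -/
theorem sideSum_glue (h : T.IsEdgeData e ν) (y : T.Flag) : sideSum e ν (T.move .glue y) =
    sideSum e ν y + (ν (T.move .glue y) - ν y) + (ν (T.move .glue y) - ν y) := by
  have e₁ := h.edgeSum_glue y
  have e₂ := h.edgeSum_glue (T.move .medium y)
  have e₃ := h.edgeSum_glue (T.move .medium (T.move .long y))
  rw [h.jump] at e₂ e₃
  have e₄ := h.jump (T.move .long (T.move .medium y))
  rw [← long_medium_long] at e₄
  rw [e₄] at e₃
  rw [sideSum, ← glue_medium, ← glue_long, ← glue_medium, e₁, e₂, e₃, sideSum]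
  abel

end IsEdgeData

/-- Edge data determine a solution of the linearized gluing equations. -/
theorem IsEdgeData.exists_sideFunction {e ν : T.Flag → A} (h : T.IsEdgeData e ν) :
    ∃ f : T.Quad → A, T.IsSideFunction f (sideSum e ν) := by
  obtain ⟨μ, sym, hμ⟩ := exists_pair_function h.edgeSum_long h.edgeSum_short
  -- The edge `{p 0, p 1}` is common to both sides of the corner and drops out of the variation.
  -- What remains is the difference of the two other pairs of opposite edges, which depends only on
  -- the quadrilateral type once the orientation sign is included.
  let F : Fin N → Equiv.Perm (Fin 4) → A := fun t p => (Equiv.Perm.sign p : ℤ) •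
    (μ t (p 0) (p 3) - μ t (p 1) (p 3) - μ t (p 0) (p 2) + μ t (p 1) (p 2))
  have hF : ∀ t, ∃ g : Fin 3 → A, ∀ p, F t p = g (quadType (p 0) (p 1)) := by
    intro t
    refine exists_quad_function (F t) (fun p => ?_) (fun p => ?_) fun p => ?_
    · simp only [F, Equiv.Perm.sign_mul, Equiv.Perm.mul_apply, Equiv.Perm.sign_swap
        (by decide : (0 : Fin 4) ≠ 1), Equiv.swap_apply_left, Equiv.swap_apply_right,
        show Equiv.swap (0 : Fin 4) 1 2 = 2 by decide, show Equiv.swap (0 : Fin 4) 1 3 = 3 by decide]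
      rw [mul_neg_one, Units.val_neg, neg_smul, ← smul_neg]
      congr 1; abel
    · simp only [F, Equiv.Perm.sign_mul, Equiv.Perm.mul_apply, Equiv.Perm.sign_swap
        (by decide : (2 : Fin 4) ≠ 3), Equiv.swap_apply_left, Equiv.swap_apply_right,
        show Equiv.swap (2 : Fin 4) 3 0 = 0 by decide, show Equiv.swap (2 : Fin 4) 3 1 = 1 by decide]
      rw [mul_neg_one, Units.val_neg, neg_smul, ← smul_neg]
      congr 1; abel
    · have s : ∀ i j : Fin 4, i ≠ j → μ t (p i) (p j) = μ t (p j) (p i) := fun i j hij =>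
        sym t _ _ (p.injective.ne hij)
      simp only [F, Equiv.Perm.sign_mul, Equiv.Perm.mul_apply,
        show Equiv.swap (0 : Fin 4) 2 (Equiv.swap 1 3 0) = 2 by decide,
        show Equiv.swap (0 : Fin 4) 2 (Equiv.swap 1 3 1) = 3 by decide,
        show Equiv.swap (0 : Fin 4) 2 (Equiv.swap 1 3 2) = 0 by decide,
        show Equiv.swap (0 : Fin 4) 2 (Equiv.swap 1 3 3) = 1 by decide,
        Equiv.Perm.sign_swap (by decide : (0 : Fin 4) ≠ 2),
        Equiv.Perm.sign_swap (by decide : (1 : Fin 4) ≠ 3)]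
      rw [s 2 1 (by decide), s 3 1 (by decide), s 2 0 (by decide), s 3 0 (by decide)]
      rw [neg_one_mul, neg_neg, mul_one]
      congr 1; abel
  choose g hg using hF
  refine ⟨fun q => g q.1 q.2, h.sideSum_medium, fun y => ?_⟩
  rw [quadOf, ← hg]
  simp only [F]
  rw [show (T.sgn y : ℤ) = (Equiv.Perm.sign y.2 : ℤ) from rfl, smul_smul,
    show ((Equiv.Perm.sign y.2 : ℤ) * (Equiv.Perm.sign y.2 : ℤ)) = 1 by
      rw [← Units.val_mul, Int.units_mul_self]; rfl, one_smul]
  simp only [sideSum, h.edgeSum_short]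
  simp only [hμ, move, Equiv.Perm.mul_apply, Equiv.swap_apply_left,
    show Equiv.swap (1 : Fin 4) 2 0 = 0 by decide, show Equiv.swap (2 : Fin 4) 3 0 = 0 by decide,
    show Equiv.swap (2 : Fin 4) 3 1 = 1 by decide, show Equiv.swap (0 : Fin 4) 1 2 = 2 by decide]
  abel

/-- A side function whose jumps are those of a function on the short edges belongs to a solution of
the edge equations. -/
theorem IsSideFunction.isTangent {f : T.Quad → A} {l ν : T.Flag → A} (h : T.IsSideFunction f l)
    (hν : ∀ y, ν (T.move .short y) = ν y)
    (hg : ∀ y, l (T.move .glue y) - ν (T.move .glue y) = l y - ν y) : T.IsTangent f := by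
  classical
  refine ⟨h.tet, fun E => ?_⟩
  obtain ⟨y, rfl⟩ := exists_cell E
  rw [sum_G, sum_rectangles]
  refine sum_edgeDisc_eq_zero (fun Y => f (T.rectQuad (Y.proj (by decide)))) (fun y => l y - ν y)
    hg (fun y => ?_) _
  rw [h.short, hν]
  change _ = _ + (T.sgn y : ℤ) • f (quadOf y)
  abel

theorem IsTangent.exists_discPotential {f : T.Quad → A} (hf : T.IsTangent f) :
    ∃ ν : T.Flag → A, (∀ y, ν (T.move .glue y) = ν y) ∧
      ∀ y, ν (T.move .short y) = ν y + (T.sgn y : ℤ) • f (quadOf y) := by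
  classical
  refine FacePairing.exists_discPotential (fun Y => f (T.rectQuad (Y.proj (by decide)))) fun D => ?_
  obtain ⟨y, rfl⟩ := exists_cell D
  rw [← sum_rectangles (fun r => f (T.rectQuad r)), ← sum_G, hf.edge]

end

/-! ### Flows on the boundary and lifting of edge data. -/

section

variable {A B : Type*} [AddCommGroup A] [AddCommGroup B]

/-- The function on the short edges that is given by the values of `J` at the even flags. -/
def evenPart (J : T.Flag → A) : T.ShortEdges → A :=
  liftCell {.short} (fun y => if T.sgn y = 1 then J y else J (T.move .short y)) (by
    simp only [Finset.mem_singleton, forall_eq]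
    intro y
    rcases T.sgn_eq y with e | e <;> simp [e, move_move])

theorem sum_evenPart {S : Finset Move} (h : {.short} ⊆ S) (Z : T.Cell S)
    [DecidablePred fun Y : T.ShortEdges => Y.proj h = Z]
    [DecidablePred fun y : T.Flag => T.sgn y = 1 ∧ cell S y = Z] (J : T.Flag → A) :
    ∑ Y : T.ShortEdges with Y.proj h = Z, evenPart J Y =
      ∑ y : T.Flag with T.sgn y = 1 ∧ cell S y = Z, J y := by
  symm
  refine Finset.sum_bij (fun y _ => cell _ y) ?_ ?_ ?_ ?_
  · intro y hy
    simpa using (Finset.mem_filter.mp hy).2.2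
  · intro y hy y' hy' e
    rcases cell_single e with e | e
    · exact e
    · have := congrArg T.sgn e
      rw [sgn_move, (Finset.mem_filter.mp hy).2.1, (Finset.mem_filter.mp hy').2.1] at this
      exact absurd this (by decide)
  · intro Y hY
    obtain ⟨y, rfl⟩ := exists_cell Y
    simp only [Finset.mem_filter, Finset.mem_univ, true_and, proj_cell] at hY
    rcases T.sgn_eq y with e | e
    · exact ⟨y, by simp [e, hY], rfl⟩
    · exact ⟨T.move .short y, by
        simp only [Finset.mem_filter, Finset.mem_univ, true_and, sgn_move, e, neg_neg]
        rw [cell_move (Finset.singleton_subset_iff.mp h), hY], cell_move (by decide) y⟩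
  · intro y hy
    simp [evenPart, (Finset.mem_filter.mp hy).2.1]

/-- Jumps of a function on the short edges have no divergence: around a disc the sum telescopes. -/
theorem sum_evenPart_jump {ν : T.Flag → A} (hν : ∀ y, ν (T.move .short y) = ν y) (D : T.EdgeDiscs)
    [DecidablePred fun Y : T.ShortEdges => Y.proj (by decide) = D] :
    ∑ Y : T.ShortEdges with Y.proj (by decide) = D,
      evenPart (fun y => ν (T.move .glue y) - ν y) Y = 0 := by
  refine sum_edgeDisc_eq_zero _
    (fun y => -(if T.sgn y = 1 then ν (T.move .glue y) else ν y)) (fun y => ?_) (fun y => ?_) D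
  · rcases T.sgn_eq y with e | e <;> simp [e, move_move]
  · rcases T.sgn_eq y with e | e <;> simp [e, hν, evenPart] <;> abel

/-- Vanishing divergence at every disc is the only obstruction for a flow to be a jump; integrate
the flow around each disc. -/
theorem exists_jump_eq {J : T.Flag → A} (hJ : ∀ y, J (T.move .glue y) = -J y)
    [∀ D : T.EdgeDiscs, DecidablePred fun Y : T.ShortEdges => Y.proj (by decide) = D]
    (h : ∀ D : T.EdgeDiscs, ∑ Y : T.ShortEdges with Y.proj (by decide) = D, evenPart J Y = 0) :
    ∃ ν : T.Flag → A, (∀ y, ν (T.move .short y) = ν y) ∧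
      ∀ y, ν (T.move .glue y) - ν y = J y := by
  obtain ⟨ν, h₁, h₂⟩ := exists_discPotential (evenPart J) h
  refine ⟨fun y => -(if T.sgn y = 1 then ν (T.move .short y) else ν y), fun y => ?_, fun y => ?_⟩
  · rcases T.sgn_eq y with e | e <;> simp [e, move_move]
  · rcases T.sgn_eq y with e | e
    · simp [e, h₁, h₂, evenPart]
    · have := h₂ (T.move .glue y)
      simp only [sgn_move, e, h₁, neg_neg, evenPart, liftCell_cell, if_true, hJ] at this
      simp [e, this]

/-- A flow along the medium edges with the given divergence. -/
theorem exists_flow (f : T.EdgeDiscs → A)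
    [∀ V : T.Ends, DecidablePred fun D : T.EdgeDiscs => D.proj (by decide) = V]
    [∀ D : T.EdgeDiscs, DecidablePred fun Y : T.ShortEdges => Y.proj (by decide) = D]
    (hf : ∀ V : T.Ends, ∑ D : T.EdgeDiscs with D.proj (by decide) = V, f D = 0) :
    ∃ J : T.Flag → A, (∀ y, J (T.move .medium y) = J y) ∧ (∀ y, J (T.move .glue y) = -J y) ∧
      ∀ D : T.EdgeDiscs, ∑ Y : T.ShortEdges with Y.proj (by decide) = D, evenPart J Y = f D := by
  classical
  let H : AddSubgroup (T.EdgeDiscs → A) :=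
    { carrier := {f | ∃ J : T.Flag → A, (∀ y, J (T.move .medium y) = J y) ∧
        (∀ y, J (T.move .glue y) = -J y) ∧
        ∀ D, ∑ y : T.Flag with T.sgn y = 1 ∧ cell {.short, .glue} y = D, J y = f D}
      add_mem' := by
        rintro f f' ⟨J, h, k, l⟩ ⟨J', h', k', l'⟩
        exact ⟨J + J', fun y => by simp [h, h'], fun y => by simp [k, k', add_comm],
          fun D => by simp [← l, ← l', Finset.sum_add_distrib]⟩
      zero_mem' := ⟨0, by simp, by simp, by simp⟩
      neg_mem' := by
        rintro f ⟨J, h, k, l⟩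
        exact ⟨-J, fun y => by simp [h], fun y => by simp [k], fun D => by simp [← l]⟩ }
  have sub : ({.short, .glue} : Finset Move) ⊆ {.medium, .short, .glue} := by decide
  have key : f ∈ H := by
    refine mem_of_sum_fiber_eq_zero H (fun D D' => ∃ y : T.Flag, T.sgn y = 1 ∧ cell _ y = D ∧
      cell _ (T.move .medium y) = D') ?_ (Cell.proj sub) ?_ f fun V => ?_
    · rintro _ _ a ⟨y, hy, rfl, rfl⟩
      -- The flow `a` through one medium edge. Among its four flags the even ones are `y`, with
      -- value `a`, and `glue (medium y)`, with value `-a`, so the divergence is `a` at the disc of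
      -- `y` and `-a` at the disc of `medium y`.
      refine ⟨fun z => (if z = y ∨ z = T.move .medium y then a else 0) -
        (if T.move .glue z = y ∨ T.move .glue z = T.move .medium y then a else 0), ?_, ?_, ?_⟩
      · intro z
        have : ∀ z : T.Flag, T.move .medium z = y ↔ z = T.move .medium y := fun z =>
          ⟨fun h => by rw [← h, move_move], fun h => by rw [h, move_move]⟩
        have inj : ∀ z : T.Flag, T.move .medium z = T.move .medium y ↔ z = y := fun z =>
          (T.move_involutive .medium).injective.eq_iff
        simp only [glue_medium, this, inj]
        simp only [or_comm]
      · intro z; simp [move_move]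
      · intro D
        rw [Finset.sum_sub_distrib, ← Finset.sum_filter, ← Finset.sum_filter]
        simp only [Finset.filter_filter, Pi.sub_apply, Pi.single_apply]
        have c : ∀ u : T.Flag, T.sgn u = 1 →
            ∀ (P : T.Flag → Prop) [DecidablePred P], (∀ z, T.sgn z = 1 → (P z ↔ z = u)) →
            ∑ z : T.Flag with (T.sgn z = 1 ∧ cell {.short, .glue} z = D) ∧ P z, a =
              if D = cell {.short, .glue} u then a else 0 := by
          intro u hu P _ hP
          split_ifs with h
          · rw [Finset.sum_eq_single_of_mem u (by simp [hu, h, hP])]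
            intro z hz hzu
            simp only [Finset.mem_filter, Finset.mem_univ, true_and] at hz
            exact absurd ((hP z hz.1.1).mp hz.2) hzu
          · refine Finset.sum_eq_zero fun z hz => ?_
            simp only [Finset.mem_filter, Finset.mem_univ, true_and] at hz
            rw [(hP z hz.1.1).mp hz.2] at hz
            exact absurd hz.1.2.symm h
        rw [c y hy (fun z => z = y ∨ z = T.move .medium y) fun z hz => ?_,
          c (T.move .glue (T.move .medium y)) (by simp [hy])
            (fun z => T.move .glue z = y ∨ T.move .glue z = T.move .medium y) fun z hz => ?_,
          cell_move (by decide) (T.move .medium y)]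
        · constructor
          · rintro (h | h)
            · have := congrArg T.sgn h
              rw [sgn_move, hy, hz] at this
              exact absurd this (by decide)
            · rw [← h, move_move]
          · rintro rfl; right; rw [move_move]
        · constructor
          · rintro (h | h)
            · exact h
            · have := congrArg T.sgn h
              rw [sgn_move, hy, hz] at this
              exact absurd this (by decide)
          · exact Or.inl
    · intro D D' e
      obtain ⟨y, rfl⟩ := exists_cell D
      obtain ⟨y', rfl⟩ := exists_cell D'
      refine cell_invariant (P := fun z => Relation.EqvGen _ (cell {.short, .glue} z)
        (cell {.short, .glue} y')) ?_ (by simpa using e) (.refl _)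
      intro c hc z hz
      obtain rfl | rfl | rfl : c = .medium ∨ c = .short ∨ c = .glue := by simpa using hc
      · rcases T.sgn_eq z with e | e
        · exact .trans _ _ _ (.symm _ _ (.rel _ _ ⟨z, e, rfl, rfl⟩)) hz
        · exact .trans _ _ _ (.rel _ _ ⟨T.move .medium z, by simp [e], rfl, by rw [move_move]⟩) hz
      · rwa [cell_move (by decide)]
      · rwa [cell_move (by decide)]
    · convert hf V
  obtain ⟨J, h, k, l⟩ := key
  refine ⟨J, h, k, fun D => ?_⟩
  rw [sum_evenPart, l]

/-- The sum of the divergences of a flow is zero. -/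
theorem sum_divergence {J : T.Flag → A} (h : ∀ y, J (T.move .medium y) = J y)
    (k : ∀ y, J (T.move .glue y) = -J y) (V : T.Ends)
    [DecidablePred fun D : T.EdgeDiscs => D.proj (by decide) = V]
    [∀ D : T.EdgeDiscs, DecidablePred fun Y : T.ShortEdges => Y.proj (by decide) = D] :
    ∑ D : T.EdgeDiscs with D.proj (by decide) = V,
      ∑ Y : T.ShortEdges with Y.proj (by decide) = D, evenPart J Y = 0 := by
  classical
  rw [sum_sum_cells, sum_evenPart]
  -- The two even flags of a medium edge carry opposite values of the flow. They are distinct since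
  -- no face is glued to itself.
  refine Finset.sum_involution (fun y _ => T.move .medium (T.move .glue y)) ?_ ?_ ?_ ?_
  · intro y _; rw [h, k, add_neg_cancel]
  · intro y _ _ e
    exact glue_ne (y := y) (y' := T.move .medium y) rfl
      (by simp [move, Equiv.swap_apply_of_ne_of_ne]) (by conv_rhs => rw [← e, move_move])
  · intro y hy
    simp only [Finset.mem_filter, Finset.mem_univ, true_and, sgn_move, neg_neg] at hy ⊢
    rw [cell_move (by decide), cell_move (by decide)]
    exact hy
  · intro y _
    rw [glue_medium, move_move, move_move]

/-- The function `e` can be lifted value by value; the difficulty is `ν`, because its jumps must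
remain a flow. An arbitrary lift of the jump flow has divergence in the kernel of `φ`, with sum zero
on each boundary component, so a flow with values in the kernel corrects it. A function on the short
edges with the corrected jumps then exists. -/
theorem IsEdgeData.exists_lift (φ : A →+ B) (hφ : Function.Surjective φ) {e ν : T.Flag → B}
    (h : T.IsEdgeData e ν) :
    ∃ e' ν' : T.Flag → A, T.IsEdgeData e' ν' ∧ (∀ y, φ (e' y) = e y) ∧ ∀ y, φ (ν' y) = ν y := by
  classical
  obtain ⟨r, hr⟩ := exists_side_function (T := T)
  have two : ∀ a : ZMod 2, a = 0 ∨ a = 1 := by decide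
  obtain ⟨σ, hσ⟩ := hφ.hasRightInverse
  let J : T.Flag → B := fun y => ν (T.move .glue y) - ν y
  have jm : ∀ y, J (T.move .medium y) = J y := h.jump
  have jg : ∀ y, J (T.move .glue y) = -J y := fun y => by simp [J, move_move]
  have rm : ∀ y : T.Flag, r ((T.move .medium y).1, (T.move .medium y).2 3) = r (y.1, y.2 3) := by
    intro y; simp [move, Equiv.swap_apply_of_ne_of_ne]
  have rg : ∀ y : T.Flag, r ((T.move .glue y).1, (T.move .glue y).2 3) = r (y.1, y.2 3) + 1 :=
    fun y => hr (y.1, y.2 3)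
  -- The side function `r` selects one side of each face. Lifting there and transferring with a
  -- minus sign keeps the lift antisymmetric under `glue`, although `σ` is no homomorphism.
  let J₁ : T.Flag → A := fun y => if r (y.1, y.2 3) = 0 then σ (J y) else -σ (J (T.move .glue y))
  have jm₁ : ∀ y, J₁ (T.move .medium y) = J₁ y := fun y => by
    simp only [J₁, rm, jm, glue_medium]
  have jg₁ : ∀ y, J₁ (T.move .glue y) = -J₁ y := fun y => by
    simp only [J₁, rg, move_move]
    rcases two (r (y.1, y.2 3)) with e | e
    · rw [e, if_neg (by decide), if_pos rfl]
    · rw [e, if_pos (by decide), if_neg (by decide), neg_neg]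
  have φJ : ∀ y, φ (J₁ y) = J y := fun y => by
    simp only [J₁]
    split_ifs
    · exact hσ _
    · rw [map_neg, hσ, jg, neg_neg]
  have φe : ∀ J' : T.Flag → A, ∀ Y, φ (evenPart J' Y) = evenPart (fun y => φ (J' y)) Y := by
    intro J' Y
    obtain ⟨y, rfl⟩ := exists_cell Y
    simp only [evenPart, liftCell_cell]
    split_ifs <;> rfl
  have hf (D : T.EdgeDiscs) :
      φ (∑ Y : T.ShortEdges with Y.proj (by decide) = D, evenPart J₁ Y) = 0 := by
    rw [map_sum]
    simp only [φe, φJ]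
    exact sum_evenPart_jump h.short' D
  -- The divergence of the lifted flow lies in the kernel because the original flow, being a jump,
  -- has none.
  let f : T.EdgeDiscs → φ.ker := fun D => ⟨_, hf D⟩
  obtain ⟨J₀, jm₀, jg₀, d₀⟩ := exists_flow f fun V => by
    ext
    rw [AddSubgroup.val_finsetSum]
    exact sum_divergence jm₁ jg₁ V
  have d₀' : ∀ Y, ((evenPart J₀ Y : φ.ker) : A) = evenPart (fun y => (J₀ y : A)) Y := by
    intro Y
    obtain ⟨y, rfl⟩ := exists_cell Y
    simp only [evenPart, liftCell_cell]
    split_ifs <;> rfl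
  obtain ⟨ν₁, hs₁, hj₁⟩ := exists_jump_eq (J := fun y => J₁ y - J₀ y)
    (fun y => by rw [jg₁, jg₀, AddSubgroup.coe_neg]; abel) fun D => by
      have e := congrArg Subtype.val (d₀ D)
      rw [AddSubgroup.val_finsetSum] at e
      simp only [d₀', f] at e
      have : ∀ Y, evenPart (fun y => J₁ y - (J₀ y : A)) Y =
          evenPart J₁ Y - evenPart (fun y => (J₀ y : A)) Y := by
        intro Y
        obtain ⟨y, rfl⟩ := exists_cell Y
        simp only [evenPart, liftCell_cell]
        split_ifs <;> rfl
      simp only [this, Finset.sum_sub_distrib]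
      rw [e, sub_self]
  have φj : ∀ y, φ (ν₁ (T.move .glue y)) - φ (ν₁ y) = J y := by
    intro y
    rw [← map_sub, hj₁, map_sub, φJ, (AddMonoidHom.mem_ker).mp (J₀ y).2, sub_zero]
  -- After the jumps have been matched, the remaining error does not change under `glue`, so lifting
  -- it value by value creates no new jump.
  let δ : T.Flag → B := fun y => ν y - φ (ν₁ y)
  have δs : ∀ y, δ (T.move .short y) = δ y := fun y => by simp only [δ, h.short', hs₁]
  have δg : ∀ y, δ (T.move .glue y) = δ y := fun y => by
    have := φj y
    simp only [J] at this
    simp only [δ]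
    rw [sub_eq_sub_iff_sub_eq_sub, this]
  refine ⟨fun y => σ (e y), fun y => ν₁ y + σ (δ y), ⟨fun y => ?_, fun y => ?_, fun y => ?_,
    fun y => ?_, fun y => ?_⟩, fun y => hσ _, fun y => ?_⟩
  · simp only [h.long]
  · simp only [h.short]
  · simp only [h.glue]
  · simp only [hs₁, δs]
  · simp only [δg, add_sub_add_right_eq_sub, hj₁, jm₁, jm₀]
  · rw [map_add, hσ]; simp [δ]

end

/-! ### Lifting tangent vectors to the reals, up to 2-torsion on the faces. -/

section

variable {A B : Type*} [AddCommGroup A] [AddCommGroup B]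

/-- A side function and a potential around the edges form edge data. -/
theorem IsSideFunction.isEdgeData {f : T.Quad → A} {l n : T.Flag → A} (hl : T.IsSideFunction f l)
    (hg : ∀ y, n (T.move .glue y) = n y)
    (hs : ∀ y, n (T.move .short y) = n y + (T.sgn y : ℤ) • f (quadOf y)) :
    T.IsEdgeData (fun y => n y + n (T.move .long y)) (fun y => l y - n y) where
  long y := by rw [move_move, add_comm]
  short y := by rw [← short_long, hs, hs, sgn_move, quadOf_long, Units.val_neg, neg_smul]; abel
  glue y := by rw [← glue_long, hg, hg]
  short' y := by rw [hl.short, hs]; abel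
  jump y := by rw [glue_medium, hl.medium, hl.medium, ← glue_medium, hg, hg]; abel

/-- In a face with vertices 0, 1, 2 this is 2l₀ = (l₀ + l₁) + (l₀ + l₂) - (l₁ + l₂). -/
theorem add_self_eq_sideSum {l e ν : T.Flag → A} (hl : ∀ y, l (T.move .medium y) = l y)
    (hm : ∀ y, l y + l (T.move .long y) = edgeSum e ν y) (y : T.Flag) :
    l y + l y = sideSum e ν y := by
  rw [sideSum, ← hm, ← hm, ← hm, long_medium_long, hl, hl, hl]
  abel

/-- Both `2l` and the image of the real `sideSum` are given by the same edge data. Half of the real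
function therefore lifts `l` up to an error `b` with `2b = 0`, and this error is the same at all
three vertices and on both sides of a face. -/
theorem exists_real_lift_aux (φ : ℝ →+ B) {f : T.Quad → B} {l e ν : T.Flag → B}
    (hl : T.IsSideFunction f l) (hm : ∀ y, l y + l (T.move .long y) = edgeSum e ν y)
    (hj : ∀ y, l (T.move .glue y) - ν (T.move .glue y) = l y - ν y) {e' ν' : T.Flag → ℝ}
    (h : T.IsEdgeData e' ν') (he : ∀ y, φ (e' y) = e y) (hν : ∀ y, φ (ν' y) = ν y) :
    ∃ (W : T.Quad → ℝ) (b : T.Flag → B), T.IsTangent W ∧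
      ((∀ y, ν' y = 0) → T.IsPeripherallyTrivial W) ∧ (∀ y, b (T.move .long y) = b y) ∧
      (∀ y, b (T.move .medium y) = b y) ∧ (∀ y, b (T.move .glue y) = b y) ∧ (∀ y, b y + b y = 0) ∧
      ∀ y, f (quadOf y) = φ (W (quadOf y)) + b y + b (T.move .short y) := by
  obtain ⟨w, hw⟩ := h.exists_sideFunction
  let s : T.Flag → ℝ := fun y => sideSum e' ν' y / 2
  have hs : T.IsSideFunction (fun q => w q / 2) s :=
    ⟨fun y => by simp only [s, hw.medium], fun y => by
      simp only [s, hw.short, zsmul_eq_mul]; ring⟩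
  have sg : ∀ y, s (T.move .glue y) = s y + (ν' (T.move .glue y) - ν' y) := fun y => by
    simp only [s, h.sideSum_glue]; ring
  have sm : ∀ y, φ (edgeSum e' ν' y) = edgeSum e ν y := fun y => by
    simp only [edgeSum, map_add, he, hν]
  have ss : ∀ y, φ (s y) + φ (s y) = l y + l y := fun y => by
    rw [← map_add, add_halves, add_self_eq_sideSum hl.medium hm]
    simp only [sideSum, map_add, map_sub, sm]
  have two : ∀ y, (l y - φ (s y)) + (l y - φ (s y)) = 0 := fun y => by
    rw [sub_add_sub_comm, ss, sub_self]
  -- At the two ends of an edge in a face, the values of `l` and those of the lift have the same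
  -- sum, so the errors are opposite; being 2-torsion they are equal.
  have nl : ∀ y, l (T.move .long y) - φ (s (T.move .long y)) = l y - φ (s y) := fun y => by
    have : l (T.move .long y) - φ (s (T.move .long y)) + (l y - φ (s y)) = 0 := by
      rw [sub_add_sub_comm, add_comm, hm, ← map_add, add_comm (s _)]
      simp only [s]
      rw [← add_div, h.sideSum_long, add_self_div_two, sm, sub_self]
    rw [← two y] at this
    exact add_right_cancel this
  refine ⟨fun q => w q / 2, fun y => l y - φ (s y), ?_, fun h0 => ?_, nl, fun y => ?_, fun y => ?_,
    two, fun y => ?_⟩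
  · refine hs.isTangent h.short' fun y => ?_
    rw [sg]; ring
  · exact hs.isPeripherallyTrivial fun y => by rw [sg, h0, h0]; ring
  · simp only [hl.medium, hs.medium]
  · change l (T.move .glue y) - φ (s (T.move .glue y)) = l y - φ (s y)
    rw [sg, map_add, map_sub, hν, hν, ← sub_eq_zero]
    have := hj y
    rw [← sub_eq_zero] at this
    rw [← this]; abel
  · have e₁ := hl.short y
    have e₂ := congrArg φ (hs.short y)
    rw [map_add, map_zsmul] at e₂
    have e₃ : l (T.move .short y) - φ (s (T.move .short y)) = l y - φ (s y) +
        (T.sgn y : ℤ) • (f (quadOf y) - φ (w (quadOf y) / 2)) := by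
      rw [e₁, e₂, smul_sub]; abel
    change f (quadOf y) = φ (w (quadOf y) / 2) + (l y - φ (s y)) +
      (l (T.move .short y) - φ (s (T.move .short y)))
    rw [e₃]
    have e₄ := two y
    have e₅ := two (T.move .short y)
    rw [e₃] at e₅
    generalize l y - φ (s y) = c at *
    -- The sign of the flag is immaterial because the errors at both sides of the corner are
    -- 2-torsion.
    rcases T.sgn_eq y with e | e
    · rw [e, Units.val_one, one_smul, add_assoc, ← add_assoc c, e₄]; abel
    · rw [e, Units.val_neg, Units.val_one, neg_smul, one_smul] at e₅ ⊢
      generalize φ (w (quadOf y) / 2) = d at *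
      have : d + c + (c + -(f (quadOf y) - d)) - f (quadOf y) = 0 := by
        rw [← e₅]; abel
      exact (sub_eq_zero.mp this).symm

/-- In the peripherally trivial case the `glue`-invariant side function serves as its own potential
around the edges. Then `ν` vanishes and is lifted by zero, which keeps the lift peripherally
trivial. Otherwise the side function and the potential are chosen independently and their difference
is lifted as a flow. -/
theorem exists_real_lift (φ : ℝ →+ B) (hφ : Function.Surjective φ) {f : T.Quad → B}
    (hf : T.IsTangent f) :
    ∃ (W : T.Quad → ℝ) (b : T.Flag → B), T.IsTangent W ∧
      (T.IsPeripherallyTrivial f → T.IsPeripherallyTrivial W) ∧ (∀ y, b (T.move .long y) = b y) ∧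
      (∀ y, b (T.move .medium y) = b y) ∧ (∀ y, b (T.move .glue y) = b y) ∧ (∀ y, b y + b y = 0) ∧
      ∀ y, f (quadOf y) = φ (W (quadOf y)) + b y + b (T.move .short y) := by
  by_cases hp : T.IsPeripherallyTrivial f
  · obtain ⟨l, hl, hg⟩ := exists_glue_sideFunction hf.tet hp
    have h := hl.isEdgeData hg hl.short
    simp only [sub_self] at h
    obtain ⟨σ, hσ⟩ := hφ.hasRightInverse
    obtain ⟨W, b, h₁, h₂, h₃⟩ := exists_real_lift_aux φ (ν := fun _ => 0) hl
      (e := fun y => l y + l (T.move .long y))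
      (fun y => by simp [edgeSum]) (fun y => by rw [hg])
      (e' := fun y => σ (l y + l (T.move .long y))) (ν' := fun _ => 0)
      ⟨fun y => congrArg σ (h.long y), fun y => congrArg σ (h.short y),
        fun y => congrArg σ (h.glue y), fun _ => rfl, fun _ => rfl⟩ (fun y => hσ _)
      (fun y => map_zero φ)
    exact ⟨W, b, h₁, fun _ => h₂ fun _ => rfl, h₃⟩
  · obtain ⟨l, hl⟩ := exists_sideFunction hf.tet
    obtain ⟨n, hg, hs⟩ := hf.exists_discPotential
    obtain ⟨e', ν', h, he, hν⟩ := (hl.isEdgeData hg hs).exists_lift φ hφ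
    obtain ⟨W, b, h₁, _, h₃⟩ := exists_real_lift_aux φ hl
      (fun y => by simp only [edgeSum]; abel) (fun y => by rw [hg]; abel) h he hν
    exact ⟨W, b, h₁, fun h => absurd h hp, h₃⟩

end

/-! ### Circle-valued angle structures -/

/-- The parity of a permutation, as an element of `𝔽₂`. -/
def flagParity (y : T.Flag) : ZMod 2 := if T.sgn y = 1 then 0 else 1

@[simp] theorem flagParity_move (c : Move) (y : T.Flag) :
    flagParity (T.move c y) = flagParity y + 1 := by
  rcases T.sgn_eq y with e | e <;> (simp [flagParity, e]; try rfl)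

theorem sgn_smul_zmod (y : T.Flag) (a : ZMod 2) : (T.sgn y : ℤ) • a = a := by
  rcases T.sgn_eq y with e | e <;> simp [e, CharTwo.neg_eq]

theorem evenAngles_tet {α : T.Quad → ZMod 2} (hα : α ∈ T.evenAngles) (t : Fin N) :
    α (t, 0) + α (t, 1) + α (t, 2) = 1 := hα.1 t 0

/-- The co-orientation and the parity of the flag both change under `glue`; their sum is a potential
around the edge whose variation at each corner is `α`. -/
theorem evenAngles_edge {α : T.Quad → ZMod 2} (hα : α ∈ T.evenAngles) (E : T.Edges) :
    ∑ q, T.G E q • α q = 0 := by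
  classical
  obtain ⟨ρ, hρ, rfl⟩ := evenAngles_eq_turn hα
  obtain ⟨y, rfl⟩ := exists_cell E
  rw [sum_G, sum_rectangles]
  refine sum_edgeDisc_eq_zero (fun Y => turn ρ (T.rectQuad (Y.proj (by decide))))
    (fun y => ρ y.1 (y.2 3) + flagParity y) (fun y => ?_) (fun y => ?_) _
  · have := hρ.glue y.1 (y.2 3)
    simp only [flagParity_move]
    simp only [move, Equiv.Perm.mul_apply, this]
    generalize ρ y.1 (y.2 3) = a
    generalize flagParity y = b
    revert a b; decide
  · change _ = _ + (T.sgn y : ℤ) • turn ρ (quadOf y)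
    rw [turn_quadOf hρ, sgn_smul_zmod, flagParity_move]
    simp only [move, Equiv.Perm.mul_apply, Equiv.swap_apply_right]
    generalize ρ y.1 (y.2 3) = a
    generalize ρ y.1 (y.2 2) = c
    generalize flagParity y = b
    revert a b c; decide

/-- Modulo 2 the turning directions are irrelevant and a peripheral curve is a normal curve. The
corner edge and the opposite edge, which indexes entrance and exit faces, face the same type. -/
theorem evenAngles_peripheral {α : T.Quad → ZMod 2} (hα : α ∈ T.evenAngles) :
    T.IsPeripherallyTrivial α := by
  intro γ
  rw [sum_coeff]
  simp only [sgn_smul_zmod, CharTwo.neg_eq]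
  rw [← hα.2 ⟨γ.len, fun i => (γ.step i).1, fun i => (γ.step i).2 2, fun i => (γ.step i).2 3,
    fun i e => absurd ((γ.step i).2.injective e) (by decide), γ.next_tet, γ.next_inFace⟩]
  simp only [NormalCurve.parity, quadType_compl]
  rfl

/-- The homomorphism `a ↦ (-1)^a`. -/
noncomputable def signHom : ZMod 2 →+ Additive Circle where
  toFun a := Additive.ofMul ((-1) ^ a.val)
  map_zero' := by simp
  map_add' a b := by
    rw [← ofMul_mul]
    congr 1
    have : ∀ a : ZMod 2, a = 0 ∨ a = 1 := by decide
    rcases this a with rfl | rfl <;> rcases this b with rfl | rfl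
    · simp
    · simp [ZMod.val_one]
    · simp [ZMod.val_one]
    · rw [show (1 : ZMod 2) + 1 = 0 from rfl]
      simp [ZMod.val_one]

theorem ofMul_signs (α : T.Quad → ZMod 2) (q : T.Quad) :
    Additive.ofMul (signs α q) = signHom (α q) := rfl

theorem ofMul_prod_pow {ι : Type*} [Fintype ι] (ω : ι → Circle) (c : ι → ℕ) :
    Additive.ofMul (∏ q, ω q ^ c q) = ∑ q, c q • Additive.ofMul (ω q) := by
  simp [ofMul_prod, ofMul_pow]

theorem ofMul_prod_zpow {ι : Type*} [Fintype ι] (ω : ι → Circle) (c : ι → ℤ) :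
    Additive.ofMul (∏ q, ω q ^ c q) = ∑ q, c q • Additive.ofMul (ω q) := by
  simp [ofMul_prod, ofMul_zpow]

theorem mem_SA_iff {ω : T.Quad → Circle} : ω ∈ T.SA ↔
    (∀ t, ω (t, 0) * ω (t, 1) * ω (t, 2) = -1) ∧
      ∀ E, ∑ q, T.G E q • Additive.ofMul (ω q) = 0 := by
  simp only [← ofMul_prod_pow, ofMul_eq_zero]
  refine and_congr ⟨fun h t => h t 0, fun h t k => ?_⟩ Iff.rfl
  rw [← h t]
  exact Additive.ofMul.injective (sum_add_one (fun k => Additive.ofMul (ω (t, k))) k)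

theorem mem_SA₀_iff {ω : T.Quad → Circle} : ω ∈ T.SA₀ ↔
    ω ∈ T.SA ∧ T.IsPeripherallyTrivial fun q => Additive.ofMul (ω q) := by
  simp only [SA₀, IsPeripherallyTrivial, ← ofMul_prod_zpow, ofMul_eq_zero]
  rfl

theorem signs_mem_SA₀ {α : T.Quad → ZMod 2} (hα : α ∈ T.evenAngles) : signs α ∈ T.SA₀ := by
  rw [mem_SA₀_iff, mem_SA_iff]
  simp only [ofMul_signs, IsPeripherallyTrivial]
  refine ⟨⟨fun t => ?_, fun E => ?_⟩, fun γ => ?_⟩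
  · apply Additive.ofMul.injective
    rw [ofMul_mul, ofMul_mul, ofMul_signs, ofMul_signs, ofMul_signs, ← map_add, ← map_add,
      evenAngles_tet hα]
    simp [signHom, ZMod.val_one]
  · simp only [← map_nsmul, ← map_sum, evenAngles_edge hα, map_zero]
  · simp only [← map_zsmul, ← map_sum, evenAngles_peripheral hα γ, map_zero]

theorem isTangent_div {ω ω' : T.Quad → Circle} (h : ω ∈ T.SA) (h' : ω' ∈ T.SA) :
    T.IsTangent fun q => Additive.ofMul (ω q / ω' q) := by
  rw [mem_SA_iff] at h h'
  refine ⟨fun t => ?_, fun E => ?_⟩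
  · rw [← ofMul_mul, ← ofMul_mul, div_mul_div_comm, div_mul_div_comm, h.1, h'.1, div_self', ofMul_one]
  · simp only [ofMul_div, smul_sub, Finset.sum_sub_distrib, h.2, h'.2, sub_self]

theorem isPeripherallyTrivial_div {ω ω' : T.Quad → Circle} (h : ω ∈ T.SA₀) (h' : ω' ∈ T.SA₀) :
    T.IsPeripherallyTrivial fun q => Additive.ofMul (ω q / ω' q) := by
  rw [mem_SA₀_iff] at h h'
  intro γ
  simp only [ofMul_div, smul_sub, Finset.sum_sub_distrib, h.2 γ, h'.2 γ, sub_self]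

theorem mul_mem_SA {ω κ : T.Quad → Circle} (h : ω ∈ T.SA)
    (hκ : T.IsTangent fun q => Additive.ofMul (κ q)) : κ * ω ∈ T.SA := by
  rw [mem_SA_iff] at h ⊢
  refine ⟨fun t => ?_, fun E => ?_⟩
  · have : κ (t, 0) * κ (t, 1) * κ (t, 2) = 1 := Additive.ofMul.injective (hκ.tet t)
    simp only [Pi.mul_apply]
    rw [mul_mul_mul_comm (κ (t, 0)), mul_mul_mul_comm (κ (t, 0) * κ (t, 1)), this, h.1, one_mul]
  · simp only [Pi.mul_apply, ofMul_mul, smul_add, Finset.sum_add_distrib, hκ.edge, h.2, add_zero]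

theorem mul_mem_SA₀ {ω κ : T.Quad → Circle} (h : ω ∈ T.SA₀)
    (hκ : T.IsTangent fun q => Additive.ofMul (κ q))
    (hκ' : T.IsPeripherallyTrivial fun q => Additive.ofMul (κ q)) : κ * ω ∈ T.SA₀ := by
  rw [mem_SA₀_iff] at h ⊢
  refine ⟨mul_mem_SA h.1 hκ, fun γ => ?_⟩
  simp only [Pi.mul_apply, ofMul_mul, smul_add, Finset.sum_add_distrib, hκ' γ, h.2 γ, add_zero]

/-- The product of a circle-valued function with the exponential of a real-valued one. -/
noncomputable def expMul (W : T.Quad → ℝ) (ω : T.Quad → Circle) : T.Quad → Circle :=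
  fun q => Circle.exp (W q) * ω q

theorem isTangent_map {A B : Type*} [AddCommGroup A] [AddCommGroup B] (φ : A →+ B) {f : T.Quad → A}
    (hf : T.IsTangent f) : T.IsTangent fun q => φ (f q) :=
  ⟨fun t => by rw [← map_add, ← map_add, hf.tet, map_zero],
    fun E => by simp only [← map_nsmul, ← map_sum, hf.edge, map_zero]⟩

theorem isPeripherallyTrivial_map {A B : Type*} [AddCommGroup A] [AddCommGroup B] (φ : A →+ B)
    {f : T.Quad → A} (hf : T.IsPeripherallyTrivial f) : T.IsPeripherallyTrivial fun q => φ (f q) :=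
  fun γ => by simp only [← map_zsmul, ← map_sum, hf γ, map_zero]

theorem expMul_mem_SA {W : T.Quad → ℝ} (hW : T.IsTangent W) {ω : T.Quad → Circle}
    (h : ω ∈ T.SA) : expMul W ω ∈ T.SA :=
  mul_mem_SA h (isTangent_map Circle.expHom hW)

theorem expMul_mem_SA₀ {W : T.Quad → ℝ} (hW : T.IsTangent W) (hW' : T.IsPeripherallyTrivial W)
    {ω : T.Quad → Circle} (h : ω ∈ T.SA₀) : expMul W ω ∈ T.SA₀ :=
  mul_mem_SA₀ h (isTangent_map Circle.expHom hW) (isPeripherallyTrivial_map Circle.expHom hW')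

/-! ### Functions on the faces and changes of even angle structures. -/

theorem exists_face_function {X : Type*} {b : T.Flag → X} (hl : ∀ y, b (T.move .long y) = b y)
    (hm : ∀ y, b (T.move .medium y) = b y) :
    ∃ β : Fin N → Fin 4 → X, ∀ y, b y = β y.1 (y.2 3) := by
  refine ⟨fun t f => b (t, Equiv.swap 3 f), ?_⟩
  rintro ⟨t, p⟩
  have key : ∀ q : Equiv.Perm (Fin 4), q 3 = 3 → q = 1 ∨ q = Equiv.swap 0 1 ∨ q = Equiv.swap 1 2 ∨
      q = Equiv.swap 0 1 * Equiv.swap 1 2 ∨ q = Equiv.swap 1 2 * Equiv.swap 0 1 ∨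
      q = Equiv.swap 0 1 * Equiv.swap 1 2 * Equiv.swap 0 1 := by decide
  have hl' : ∀ p, b (t, p * Equiv.swap 0 1) = b (t, p) := fun p => hl (t, p)
  have hm' : ∀ p, b (t, p * Equiv.swap 1 2) = b (t, p) := fun p => hm (t, p)
  have : ∀ p q : Equiv.Perm (Fin 4), q 3 = 3 → b (t, p * q) = b (t, p) := by
    intro p q hq
    rcases key q hq with rfl | rfl | rfl | rfl | rfl | rfl <;>
      simp only [mul_one, ← mul_assoc, hl', hm']
  have e := this (Equiv.swap 3 (p 3)) ((Equiv.swap 3 (p 3))⁻¹ * p) (by simp)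
  rw [mul_inv_cancel_left] at e
  exact e

theorem exists_face_function_glue {X : Type*} {b : T.Flag → X}
    (hl : ∀ y, b (T.move .long y) = b y) (hm : ∀ y, b (T.move .medium y) = b y)
    (hg : ∀ y, b (T.move .glue y) = b y) :
    ∃ β : Fin N → Fin 4 → X, (∀ y, b y = β y.1 (y.2 3)) ∧
      ∀ t f, β (T.adj t f) (T.gluing t f f) = β t f := by
  obtain ⟨β, hβ⟩ := exists_face_function hl hm
  refine ⟨β, hβ, fun t f => ?_⟩
  have e := hg (t, Equiv.swap 3 f)
  rw [hβ, hβ] at e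
  simpa [move] using e

theorem exists_quadOf (t : Fin N) (k : Fin 3) :
    ∃ y : T.Flag, y.1 = t ∧ y.2 3 = 0 ∧ y.2 2 = k.succ ∧ quadOf y = (t, k) := by
  have : ∀ k : Fin 3, ∃ p : Equiv.Perm (Fin 4), p 3 = 0 ∧ p 2 = k.succ ∧
      quadType (p 0) (p 1) = k := by decide
  obtain ⟨p, h₃, h₂, h⟩ := this k
  exact ⟨(t, p), rfl, h₃, h₂, Prod.ext rfl h⟩

theorem exists_quadOf_eq (q : T.Quad) : ∃ y : T.Flag, quadOf y = q :=
  have ⟨y, _, _, _, h⟩ := exists_quadOf q.1 q.2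
  ⟨y, h⟩

/-- An even angle structure can be changed by a function on the faces as long as the tetrahedral
equations persist. -/
theorem mem_evenAngles_of_add {α α' : T.Quad → ZMod 2} (hα : α ∈ T.evenAngles) {b : T.Flag → ZMod 2}
    (hl : ∀ y, b (T.move .long y) = b y) (hm : ∀ y, b (T.move .medium y) = b y)
    (hg : ∀ y, b (T.move .glue y) = b y) (tet : ∀ t, α' (t, 0) + α' (t, 1) + α' (t, 2) = 1)
    (h : ∀ y, α' (quadOf y) = α (quadOf y) + (b y + b (T.move .short y))) :
    α' ∈ T.evenAngles := by
  obtain ⟨ρ, hρ, rfl⟩ := evenAngles_eq_turn hα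
  obtain ⟨β, hβ, hβ'⟩ := exists_face_function_glue hl hm hg
  have val : ∀ t k, α' (t, k) = 1 + (ρ t 0 + β t 0) + (ρ t k.succ + β t k.succ) := by
    intro t k
    obtain ⟨y, rfl, h₃, h₂, hq⟩ := exists_quadOf (T := T) t k
    rw [← hq, h, turn_quadOf hρ, hβ, hβ, h₃, h₂]
    simp only [move, Equiv.Perm.mul_apply, Equiv.swap_apply_right, h₂]
    ring
  have hρ' : T.IsEvenCoorientation fun t f => ρ t f + β t f := by
    refine ⟨fun t f => by rw [hρ.glue, hβ']; ring, fun t => ?_⟩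
    have e := tet t
    rw [val, val, val] at e
    change 1 + (ρ t 0 + β t 0) + (ρ t 1 + β t 1) + (1 + (ρ t 0 + β t 0) + (ρ t 2 + β t 2)) +
      (1 + (ρ t 0 + β t 0) + (ρ t 3 + β t 3)) = 1 at e
    generalize ρ t 0 + β t 0 = x₀ at *
    generalize ρ t 1 + β t 1 = x₁ at *
    generalize ρ t 2 + β t 2 = x₂ at *
    generalize ρ t 3 + β t 3 = x₃ at *
    clear val h
    revert x₀ x₁ x₂ x₃; decide
  have : α' = turn fun t f => ρ t f + β t f := by
    ext ⟨t, k⟩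
    rw [val]; rfl
  rw [this]
  exact turn_mem_evenAngles hρ'

/-- The difference of two even angle structures comes from a function on the faces. -/
theorem exists_face_function_of_evenAngles {α α' : T.Quad → ZMod 2} (hα : α ∈ T.evenAngles)
    (hα' : α' ∈ T.evenAngles) :
    ∃ b : T.Flag → ZMod 2, (∀ y, b (T.move .long y) = b y) ∧ (∀ y, b (T.move .medium y) = b y) ∧
      (∀ y, b (T.move .glue y) = b y) ∧
      ∀ y, α' (quadOf y) = α (quadOf y) + (b y + b (T.move .short y)) := by
  obtain ⟨ρ, hρ, rfl⟩ := evenAngles_eq_turn hα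
  obtain ⟨ρ', hρ', rfl⟩ := evenAngles_eq_turn hα'
  refine ⟨fun y => ρ y.1 (y.2 3) + ρ' y.1 (y.2 3), fun y => ?_, fun y => ?_, fun y => ?_,
    fun y => ?_⟩
  · simp [move, Equiv.swap_apply_of_ne_of_ne]
  · simp [move, Equiv.swap_apply_of_ne_of_ne]
  · simp only [move, Equiv.Perm.mul_apply, hρ.glue, hρ'.glue]
    rw [add_add_add_comm, show (1 : ZMod 2) + 1 = 0 from rfl, add_zero]
  · rw [turn_quadOf hρ, turn_quadOf hρ']
    simp only [move, Equiv.Perm.mul_apply, Equiv.swap_apply_right]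
    generalize ρ y.1 (y.2 3) = a
    generalize ρ y.1 (y.2 2) = b
    generalize ρ' y.1 (y.2 3) = c
    generalize ρ' y.1 (y.2 2) = d
    revert a b c d; decide

theorem circle_sq_eq_one {a : Circle} (h : a * a = 1) : a = 1 ∨ a = -1 := by
  have e : (a : ℂ) * a = 1 := by rw [← Circle.coe_mul, h, Circle.coe_one]
  rcases mul_self_eq_one_iff.mp e with e | e
  · exact .inl (Circle.ext (by simpa using e))
  · exact .inr (Circle.ext (by simpa using e))

theorem signHom_one : signHom 1 = Additive.ofMul (-1) := by simp [signHom, ZMod.val_one]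

theorem signHom_injective : Function.Injective signHom := by
  rw [injective_iff_map_eq_zero]
  intro a
  have : ∀ a : ZMod 2, a = 0 ∨ a = 1 := by decide
  rcases this a with rfl | rfl
  · simp
  · rw [signHom_one, ofMul_eq_zero]
    intro h
    have := congrArg (fun z : Circle => (z : ℂ).re) h
    norm_num at this

theorem expHom_surjective : Function.Surjective Circle.expHom := fun z =>
  ⟨Complex.arg z.toMul, congrArg Additive.ofMul (Circle.exp_arg z.toMul)⟩

theorem expMul_eq {ω : T.Quad → Circle} {W : T.Quad → ℝ} {α : T.Quad → ZMod 2}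
    (h : ∀ y : T.Flag, Additive.ofMul (ω (quadOf y)) =
      Circle.expHom (W (quadOf y)) + signHom (α (quadOf y))) : ω = expMul W (signs α) := by
  ext q
  obtain ⟨y, rfl⟩ := exists_quadOf_eq q
  exact congrArg (fun z : Additive Circle => (z.toMul : ℂ)) (h y)

/-- Every circle-valued angle structure is the product of one with values `1`, `-1` and even parity
and the exponential of a tangent vector. -/
theorem exists_expMul
    (hT : ∀ s t : Fin N, Relation.ReflTransGen (fun a b => ∃ f, T.adj a f = b) s t)
    {ω : T.Quad → Circle} (hω : ω ∈ T.SA) :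
    ∃ W : T.Quad → ℝ, ∃ α ∈ T.evenAngles, T.IsTangent W ∧
      (ω ∈ T.SA₀ → T.IsPeripherallyTrivial W) ∧ ω = expMul W (signs α) := by
  classical
  obtain ⟨ρ, hρ⟩ := exists_isEvenCoorientation hT
  have hα := turn_mem_evenAngles hρ
  have h₀ := signs_mem_SA₀ hα
  have tan := isTangent_div hω h₀.1
  obtain ⟨W, b, hW, hp, hl, hm, hg, htwo, h⟩ := exists_real_lift _ expHom_surjective tan
  -- The 2-torsion of the circle is `{1, -1}`, so the error of the real lift is a sign attached to
  -- each face.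
  have hb : ∀ y, ∃ c : ZMod 2, b y = signHom c := fun y => by
    rcases circle_sq_eq_one (a := (b y).toMul) (htwo y) with e | e
    · exact ⟨0, by rw [map_zero]; exact e⟩
    · exact ⟨1, by rw [signHom_one]; exact e⟩
  choose c hc using hb
  have inv : ∀ {y y'}, b y' = b y → c y' = c y := fun {y y'} e =>
    signHom_injective (by rw [← hc, ← hc, e])
  have hcl := fun y => inv (hl y)
  have hcm := fun y => inv (hm y)
  have hcg := fun y => inv (hg y)
  obtain ⟨β, hβ⟩ := exists_face_function hcl hcm
  let α : T.Quad → ZMod 2 := fun q => turn ρ q + (β q.1 0 + β q.1 q.2.succ)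
  have hf : ∀ t k, Additive.ofMul (ω (t, k) / signs (T := T) (turn ρ) (t, k)) =
      Circle.expHom (W (t, k)) + signHom (β t 0 + β t k.succ) := by
    intro t k
    obtain ⟨y, rfl, h₃, h₂, hq⟩ := exists_quadOf (T := T) t k
    have e := h y
    rw [hq, hc, hc, hβ, hβ, h₃, add_assoc, ← map_add] at e
    simpa only [move, Equiv.Perm.mul_apply, Equiv.swap_apply_right, h₂] using e
  -- A face function need not preserve the tetrahedral equation. Here it does, because both the
  -- quotient of angle structures and the exponential of `W` satisfy the homogeneous equation.
  have tet : ∀ t, α (t, 0) + α (t, 1) + α (t, 2) = 1 := by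
    intro t
    have e₁ := tan.tet t
    have e₂ := congrArg Circle.expHom (hW.tet t)
    have e₃ := evenAngles_tet hα t
    simp only [hf] at e₁
    rw [map_add, map_add, map_zero] at e₂
    have e₄ : signHom ((β t 0 + β t (0 : Fin 3).succ) + (β t 0 + β t (1 : Fin 3).succ) +
        (β t 0 + β t (2 : Fin 3).succ)) = signHom 0 := by
      rw [map_add, map_add, map_zero, ← e₁, ← sub_eq_zero]
      rw [← neg_eq_zero, ← e₂]; abel
    calc _ = (turn (T := T) ρ (t, 0) + turn (T := T) ρ (t, 1) + turn (T := T) ρ (t, 2)) +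
          ((β t 0 + β t (0 : Fin 3).succ) + (β t 0 + β t (1 : Fin 3).succ) +
        (β t 0 + β t (2 : Fin 3).succ)) := by simp only [α]; ring
      _ = 1 := by rw [e₃, signHom_injective e₄, add_zero]
  have hα' : ∀ y : T.Flag, α (quadOf y) = turn ρ (quadOf y) + (c y + c (T.move .short y)) := by
    intro y
    apply signHom_injective
    have e := h y
    have e' := hf (quadOf y).1 (quadOf y).2
    rw [Prod.mk.eta] at e'
    rw [e', hc, hc, add_assoc, ← map_add] at e
    change signHom (turn ρ _ + (β _ 0 + β _ _)) = _
    rw [map_add, add_left_cancel e, ← map_add]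
  refine ⟨W, α, mem_evenAngles_of_add hα hcl hcm hcg tet hα', hW,
    fun h => hp (isPeripherallyTrivial_div h h₀), expMul_eq fun y => ?_⟩
  have e := h y
  rw [hc, hc, add_assoc, ← map_add, ofMul_div, sub_eq_iff_eq_add, ofMul_signs] at e
  rw [e, hα', map_add signHom (turn ρ _)]
  abel

/-! ### Coboundaries are cocycles -/

section

open Classical in
theorem d1_largeHexagon_proj (c : T.C1) (F : T.Cell {.long, .medium}) :
    (T.d1 c).1.1 (F.proj (by decide)) =
      (∑ Y : T.Cell {.long} with Y.proj (by decide) = F, c.1 (Y.proj (by decide))) +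
      ∑ Y : T.Cell {.medium} with Y.proj (by decide) = F, c.2.1 (Y.proj (by decide)) := by
  obtain ⟨y, rfl⟩ := exists_cell F
  rw [sum_face_long, sum_face_medium]
  exact d1_largeHexagon c y

open Classical in
theorem d1_rectangle_sum (c : T.C1) (R : T.Rectangles) :
    (T.d1 c).1.2 R =
      (∑ Y : T.Cell {.long} with Y.proj (by decide) = R, c.1 (Y.proj (by decide))) +
      ∑ Y : T.Cell {.short} with Y.proj (by decide) = R, c.2.2 Y := by
  obtain ⟨y, rfl⟩ := exists_cell R
  rw [sum_rectangle_long, sum_rectangle_short]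
  exact d1_rectangle c y

open Classical in
theorem d1bd_boundaryHexagon_sum (c : T.C1bd) (B : T.BoundaryHexagons) :
    (T.d1bd c).1 B =
      (∑ Y : T.Cell {.medium} with Y.proj (by decide) = B, c.1 (Y.proj (by decide))) +
      ∑ Y : T.Cell {.short} with Y.proj (by decide) = B, c.2 Y := by
  obtain ⟨y, rfl⟩ := exists_cell B
  rw [sum_triangle_medium, sum_triangle_short]
  exact d1bd_boundaryHexagon c y

open Classical in
theorem d2_tetrahedra (c : T.C2) (X : T.Tetrahedra) :
    (T.d2 c).1 X =
      (∑ F : T.Cell {.long, .medium} with F.proj (by decide) = X, c.1.1 (F.proj (by decide))) +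
      (∑ R : T.Rectangles with R.proj (by decide) = X, c.1.2 R) +
      ∑ B : T.BoundaryHexagons with B.proj (by decide) = X, c.2.1 B := by
  simp only [d2, LinearMap.coe_mk, AddHom.coe_mk, Pi.add_apply, sides_apply]
  congr 1
  · congr 1
    refine Finset.sum_congr rfl fun Y _ => ?_
    obtain ⟨y, rfl⟩ := exists_cell Y
    rfl
  · refine Finset.sum_congr rfl fun Y _ => ?_
    obtain ⟨y, rfl⟩ := exists_cell Y
    rfl

open Classical in
theorem d2_edges (c : T.C2) (E : T.Edges) :
    (T.d2 c).2 E =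
      (∑ R : T.Rectangles with R.proj (by decide) = E, c.1.2 R) +
      ∑ D : T.EdgeDiscs with D.proj (by decide) = E, c.2.2 D := by
  simp only [d2, LinearMap.coe_mk, AddHom.coe_mk, Pi.add_apply, sides_apply]
  congr 1
  · refine Finset.sum_congr rfl fun Y _ => ?_
    obtain ⟨y, rfl⟩ := exists_cell Y
    rfl
  · refine Finset.sum_congr rfl fun Y _ => ?_
    obtain ⟨y, rfl⟩ := exists_cell Y
    rfl

open Classical in
-- Each long edge lies in a face and is seen from its two sides; `glue` pairs the two views, which
-- cancel modulo 2.
theorem sum_long_edges (l : T.LongEdges → ZMod 2) (E : T.Edges) :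
    ∑ Y : T.Cell {.long} with Y.proj (by decide) = E, l (Y.proj (by decide)) = 0 := by
  let g : T.Cell {.long} → T.Cell {.long} := liftCell _ (fun y => cell _ (T.move .glue y)) (by
    simp only [Finset.mem_singleton, forall_eq]
    intro y
    rw [glue_long, cell_move (by decide)])
  have hg : ∀ Y, (g Y).proj (S' := {.long, .glue}) (by decide) = Y.proj (by decide) := by
    intro Y
    obtain ⟨y, rfl⟩ := exists_cell Y
    exact cell_move (by decide) y
  refine Finset.sum_involution (fun Y _ => g Y) ?_ ?_ ?_ ?_
  · intro Y _
    rw [hg]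
    exact CharTwo.add_self_eq_zero _
  · intro Y _ _ e
    obtain ⟨y, rfl⟩ := exists_cell Y
    change cell _ (T.move .glue y) = cell _ y at e
    rcases cell_single e with e | e
    · exact move_ne _ _ e
    · exact glue_ne (y := y) (y' := T.move .long y) rfl
        (by simp [move, Equiv.swap_apply_of_ne_of_ne]) e
  · intro Y hY
    obtain ⟨y, rfl⟩ := exists_cell Y
    simp only [Finset.mem_filter, Finset.mem_univ, true_and] at hY ⊢
    rw [← hY]
    exact cell_move (by decide) y
  · intro Y _
    obtain ⟨y, rfl⟩ := exists_cell Y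
    change cell _ (T.move .glue (T.move .glue y)) = _
    rw [move_move]

theorem d2_d1 (c : T.C1) : T.d2 (T.d1 c) = 0 := by
  classical
  ext X
  · rw [d2_tetrahedra]
    simp only [d1_largeHexagon_proj, d1_rectangle_sum, d1_snd, d1bd_boundaryHexagon_sum,
      Finset.sum_add_distrib]
    have e₁ := sum_sum_cells (S₁ := {.long}) (S₂ := {.long, .medium}) (by decide) (by decide) X
      fun Y => c.1 (Y.proj (by decide))
    have e₂ := sum_sum_cells (S₁ := {.medium}) (S₂ := {.long, .medium}) (by decide) (by decide) X
      fun Y => c.2.1 (Y.proj (by decide))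
    have e₃ := sum_sum_cells (S₁ := {.long}) (S₂ := {.long, .short}) (by decide) (by decide) X
      fun Y => c.1 (Y.proj (by decide))
    have e₄ := sum_sum_cells (S₁ := {.short}) (S₂ := {.long, .short}) (by decide) (by decide) X
      fun Y => c.2.2 Y
    have e₅ := sum_sum_cells (S₁ := {.medium}) (S₂ := {.medium, .short}) (by decide) (by decide) X
      fun Y => c.2.1 (Y.proj (by decide))
    have e₆ := sum_sum_cells (S₁ := {.short}) (S₂ := {.medium, .short}) (by decide) (by decide) X
      fun Y => c.2.2 Y
    rw [e₁, e₂, e₃, e₄, e₅, e₆]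
    exact (by decide : ∀ a b c : ZMod 2, a + b + (a + c) + (b + c) = 0) _ _ _
  · rw [d2_edges]
    simp only [d1_rectangle_sum, d1_snd, d1bd_edgeDisc, Finset.sum_add_distrib]
    have e₁ := sum_sum_cells (S₁ := {.long}) (S₂ := {.long, .short}) (by decide) (by decide) X
      fun Y => c.1 (Y.proj (by decide))
    have e₂ := sum_sum_cells (S₁ := {.short}) (S₂ := {.long, .short}) (by decide) (by decide) X
      fun Y => c.2.2 Y
    have e₃ := sum_sum_cells (S₁ := {.short}) (S₂ := {.short, .glue}) (by decide) (by decide) X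
      fun Y => c.2.2 Y
    rw [e₁, e₂, e₃, sum_long_edges, zero_add]
    exact CharTwo.add_self_eq_zero _

theorem d1_mem_Z2 (c : T.C1) : T.d1 c ∈ T.Z2 := d2_d1 c

open Classical in
-- Opposite edges of a tetrahedron face the same type, so the six rectangles cancel in pairs. The
-- permutation `o` exchanges opposite edges without fixing any rectangle.
theorem sum_tetrahedron_quad (α : T.Quad → ZMod 2) (X : T.Tetrahedra) :
    ∑ R : T.Rectangles with R.proj (by decide) = X, α (T.rectQuad R) = 0 := by
  let o : Equiv.Perm (Fin 4) := Equiv.swap 0 2 * Equiv.swap 1 3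
  let g : T.Rectangles → T.Rectangles := liftCell _ (fun y => cell _ (y.1, y.2 * o)) (by
    intro c hc y
    have h₁ : Equiv.swap (0 : Fin 4) 1 * o = o * Equiv.swap 2 3 := by decide
    have h₂ : Equiv.swap (2 : Fin 4) 3 * o = o * Equiv.swap 0 1 := by decide
    obtain rfl | rfl : c = .long ∨ c = .short := by simpa using hc
    · simp only [move, mul_assoc, h₁]
      exact cell_move (c := .short) (by decide) (y.1, y.2 * o)
    · simp only [move, mul_assoc, h₂]
      exact cell_move (c := .long) (by decide) (y.1, y.2 * o))
  refine Finset.sum_involution (fun Y _ => g Y) ?_ ?_ ?_ ?_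
  · intro Y _
    obtain ⟨y, rfl⟩ := exists_cell Y
    change α (quadOf y) + α (quadOf (y.1, y.2 * o)) = 0
    have : quadOf (T := T) (y.1, y.2 * o) = quadOf y := Prod.ext rfl (quadType_compl y.2)
    rw [this]
    exact CharTwo.add_self_eq_zero _
  · intro Y _ _ e
    obtain ⟨y, rfl⟩ := exists_cell Y
    change cell _ (y.1, y.2 * o) = cell _ y at e
    have key : ∀ q : Equiv.Perm (Fin 4), q = 1 ∨ q = Equiv.swap 0 1 ∨ q = Equiv.swap 2 3 ∨
      q = Equiv.swap 2 3 * Equiv.swap 0 1 → q ≠ o := by decide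
    rcases cell_pair (fun y => (short_long y).symm) e with e | e | e | e
    · exact key 1 (by decide) (mul_left_cancel ((mul_one y.2).trans (congrArg Prod.snd e).symm))
    · exact key (Equiv.swap 0 1) (by decide) (mul_left_cancel (congrArg Prod.snd e)).symm
    · exact key (Equiv.swap 2 3) (by decide) (mul_left_cancel (congrArg Prod.snd e)).symm
    · refine key (Equiv.swap 2 3 * Equiv.swap 0 1) (by decide) ?_
      have := (congrArg Prod.snd e).symm
      simp only [move, mul_assoc] at this
      exact mul_left_cancel this
  · intro Y hY
    obtain ⟨y, rfl⟩ := exists_cell Y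
    simp only [Finset.mem_filter, Finset.mem_univ, true_and] at hY ⊢
    rw [← hY]
    change cell _ (y.1, y.2 * o) = cell _ y
    have : (y.1, y.2 * o) = T.move .medium (T.move .long (T.move .short (T.move .medium y))) := by
      have : o = Equiv.swap 1 2 * (Equiv.swap 2 3 * (Equiv.swap 0 1 * Equiv.swap 1 2)) := by decide
      simp only [move, mul_assoc, this]
    rw [this, cell_move (by decide), cell_move (by decide), cell_move (by decide),
      cell_move (by decide)]
  · intro Y _
    obtain ⟨y, rfl⟩ := exists_cell Y
    change cell _ (y.1, y.2 * o * o) = _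
    rw [mul_assoc, show o * o = 1 by decide, mul_one]

theorem mem_Z2rel_iff {σ : T.C2rel} : σ ∈ T.Z2rel ↔ (σ, 0) ∈ T.Z2 := Iff.rfl

theorem rect_mem_Z2 {α : T.Quad → ZMod 2} (hα : α ∈ T.evenAngles) : T.rect α ∈ T.Z2rel := by
  classical
  change T.d2 (T.rect α, 0) = 0
  ext X
  · rw [d2_tetrahedra]
    simp [rect, sum_tetrahedron_quad]
  · rw [d2_edges]
    simp only [rect, Prod.snd_zero, Pi.zero_apply, Finset.sum_const_zero, add_zero]
    rw [← sum_G X α, evenAngles_edge hα]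

end

/-! ### Cohomologous even angle structures -/

theorem cast_val_zmod (a : ZMod 2) : (((a.val : ℕ) : ℤ) : ZMod 2) = a := by
  revert a; decide

theorem cast_sgn_smul (y : T.Flag) (a : ℤ) : (((T.sgn y : ℤ) • a : ℤ) : ZMod 2) = a := by
  rcases T.sgn_eq y with e | e <;> simp [e, CharTwo.neg_eq]

/-- Integer edge data with even values can be halved. -/
theorem IsEdgeData.exists_half {e ν : T.Flag → ℤ} (h : T.IsEdgeData e ν) (he : ∀ y, (e y : ZMod 2) = 0)
    (hν : ∀ y, (ν y : ZMod 2) = 0) :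
    ∃ e' ν' : T.Flag → ℤ, T.IsEdgeData e' ν' ∧ (∀ y, e y = 2 * e' y) ∧ ∀ y, ν y = 2 * ν' y := by
  have he' : ∀ y, e y = 2 * (e y / 2) := fun y => by
    have := (ZMod.intCast_zmod_eq_zero_iff_dvd (e y) 2).mp (he y); omega
  have hν' : ∀ y, ν y = 2 * (ν y / 2) := fun y => by
    have := (ZMod.intCast_zmod_eq_zero_iff_dvd (ν y) 2).mp (hν y); omega
  refine ⟨fun y => e y / 2, fun y => ν y / 2, ⟨fun y => ?_, fun y => ?_, fun y => ?_, fun y => ?_,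
    fun y => ?_⟩, he', hν'⟩
  · simp only [h.long]
  · simp only [h.short]
  · simp only [h.glue]
  · simp only [h.short']
  · have := h.jump y
    rw [hν' y, hν' (T.move .glue y), hν' (T.move .medium y), hν' (T.move .glue (T.move .medium y))]
      at this
    omega

/-- Edge data lift a face function to an integer tangent vector. -/
theorem exists_isTangent_of_isEdgeData {b e ν : T.Flag → ZMod 2} (h : T.IsEdgeData e ν)
    (hb : ∀ y, sideSum e ν y = b y) :
    ∃ f : T.Quad → ℤ, T.IsTangent f ∧ ((∀ y, ν y = 0) → T.IsPeripherallyTrivial f) ∧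
      ∀ y, (f (quadOf y) : ZMod 2) = b y + b (T.move .short y) := by
  have main : ∀ e' ν' : T.Flag → ℤ, T.IsEdgeData e' ν' → (∀ y, (e' y : ZMod 2) = e y) →
      (∀ y, (ν' y : ZMod 2) = ν y) → ∃ f : T.Quad → ℤ, T.IsTangent f ∧
      ((∀ y, ν' y = 0) → T.IsPeripherallyTrivial f) ∧
      ∀ y, (f (quadOf y) : ZMod 2) = b y + b (T.move .short y) := by
    intro e' ν' h' he hν
    obtain ⟨f, hf⟩ := h'.exists_sideFunction
    have cast : ∀ y, ((sideSum e' ν' y : ℤ) : ZMod 2) = b y := fun y => by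
      rw [← hb]
      simp only [sideSum, edgeSum, Int.cast_add, Int.cast_sub, he, hν]
    refine ⟨f, hf.isTangent (ν := fun y => ν' y + ν' y) (fun y => by simp only [h'.short'])
      fun y => by rw [h'.sideSum_glue]; ring, fun h0 => hf.isPeripherallyTrivial fun y => by
        rw [h'.sideSum_glue, h0, h0]; ring, fun y => ?_⟩
    have e₁ := congrArg (Int.cast : ℤ → ZMod 2) (hf.short y)
    rw [Int.cast_add, cast, cast, cast_sgn_smul] at e₁
    rw [e₁, ← add_assoc, CharTwo.add_self_eq_zero, zero_add]
  -- With `ν = 0` the residues of `e` are lifted directly and `ν` by zero; only this preserves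
  -- peripheral triviality. In general the flow has to be lifted.
  by_cases hν : ∀ y, ν y = 0
  · obtain ⟨f, h₁, h₂, h₃⟩ := main (fun y => (e y).val) (fun _ => 0)
      ⟨fun y => by rw [h.long], fun y => by rw [h.short], fun y => by rw [h.glue], fun _ => rfl,
        fun _ => rfl⟩ (fun y => cast_val_zmod _) (fun y => by rw [hν]; rfl)
    exact ⟨f, h₁, fun _ => h₂ fun _ => rfl, h₃⟩
  · obtain ⟨e', ν', h', he, hν'⟩ := h.exists_lift (Int.castAddHom (ZMod 2))
      (ZMod.intCast_surjective)
    obtain ⟨f, h₁, _, h₃⟩ := main e' ν' h' he hν'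
    exact ⟨f, h₁, fun h => absurd h hν, h₃⟩

/-- Choose an integral side function `l` and a potential around the edges that both reduce to `b`.
The associated edge data are then even, so they can be halved, and `2l = sideSum` becomes an
identity for `l` itself that can be reduced modulo 2. -/
theorem exists_isEdgeData_of_isTangent {b : T.Flag → ZMod 2} (hbl : ∀ y, b (T.move .long y) = b y)
    (hm : ∀ y, b (T.move .medium y) = b y) (hg : ∀ y, b (T.move .glue y) = b y) {f : T.Quad → ℤ}
    (hf : T.IsTangent f) (h : ∀ y, (f (quadOf y) : ZMod 2) = b y + b (T.move .short y)) :
    ∃ e ν : T.Flag → ZMod 2, T.IsEdgeData e ν ∧ (T.IsPeripherallyTrivial f → ∀ y, ν y = 0) ∧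
      ∀ y, sideSum e ν y = b y := by
  have main : ∀ l n : T.Flag → ℤ, T.IsSideFunction f l → (∀ y, n (T.move .glue y) = n y) →
      (∀ y, n (T.move .short y) = n y + (T.sgn y : ℤ) • f (quadOf y)) →
      (∀ y, (l y : ZMod 2) = b y) →
      ∃ e ν : T.Flag → ZMod 2, T.IsEdgeData e ν ∧ ((∀ y, l y = n y) → ∀ y, ν y = 0) ∧
      ∀ y, sideSum e ν y = b y := by
    intro l n hl ng ns hlb
    -- The difference `l - n` does not change under `short`, and its residue does not change under
    -- `glue`. Adding a representative of that residue makes the potential congruent to `l`, hence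
    -- to `b`.
    let n' : T.Flag → ℤ := fun y => n y + ((l y - n y : ℤ) : ZMod 2).val
    have ng' : ∀ y, n' (T.move .glue y) = n' y := fun y => by
      simp only [n', ng, Int.cast_sub, hlb, hg]
    have ns' : ∀ y, n' (T.move .short y) = n' y + (T.sgn y : ℤ) • f (quadOf y) := fun y => by
      simp only [n', ns, hl.short, add_sub_add_right_eq_sub]
      ring
    have cast : ∀ y, (n' y : ZMod 2) = b y := fun y => by
      simp only [n', Int.cast_add, cast_val_zmod, Int.cast_sub, hlb, add_sub_cancel]
    have hd := hl.isEdgeData ng' ns'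
    obtain ⟨e, ν, h', he, hν⟩ := hd.exists_half
      (fun y => by rw [Int.cast_add, cast, cast, hbl, CharTwo.add_self_eq_zero])
      (fun y => by rw [Int.cast_sub, cast, hlb, sub_self])
    have key : ∀ y, l y = sideSum e ν y := fun y => by
      have := add_self_eq_sideSum (e := fun y => n' y + n' (T.move .long y))
        (ν := fun y => l y - n' y) hl.medium (fun y => by simp only [edgeSum]; ring) y
      simp only [sideSum, edgeSum] at this ⊢
      simp only [he, hν] at this
      omega
    refine ⟨fun y => e y, fun y => ν y, ⟨fun y => ?_, fun y => ?_, fun y => ?_, fun y => ?_,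
      fun y => ?_⟩, fun h0 y => ?_, fun y => ?_⟩
    · simp only [h'.long]
    · simp only [h'.short]
    · simp only [h'.glue]
    · simp only [h'.short']
    · simpa using congrArg (Int.cast : ℤ → ZMod 2) (h'.jump y)
    · have := hν y
      simp only [n', h0, sub_self, Int.cast_zero, ZMod.val_zero, Nat.cast_zero, add_zero] at this
      have : ν y = 0 := by omega
      simp [this]
    · rw [← hlb, key]
      simp [sideSum, edgeSum]
  -- The residue of `l - b` is constant on the sides of each vertex triangle, so subtracting a
  -- representative keeps `l` a side function.
  have adjust : ∀ l : T.Flag → ℤ, T.IsSideFunction f l →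
      T.IsSideFunction f (fun y => l y - ((l y - b y : ZMod 2).val : ℤ)) := by
    intro l hl
    refine ⟨fun y => by rw [hl.medium, hm], fun y => ?_⟩
    have : ((l (T.move .short y) : ℤ) : ZMod 2) - b (T.move .short y) = l y - b y := by
      rw [hl.short, Int.cast_add, cast_sgn_smul, h]
      exact (by decide : ∀ a b c : ZMod 2, a + (b + c) - c = a - b) _ _ _
    rw [this, hl.short]
    ring
  have cast : ∀ (l : T.Flag → ℤ) y,
      ((l y - ((l y - b y : ZMod 2).val : ℤ) : ℤ) : ZMod 2) = b y := fun l y => by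
    rw [Int.cast_sub, cast_val_zmod, sub_sub_cancel]
  by_cases hp : T.IsPeripherallyTrivial f
  · obtain ⟨l, hl, lg⟩ := exists_glue_sideFunction hf.tet hp
    obtain ⟨e, ν, h₁, h₂, h₃⟩ := main _ (fun y => l y - ((l y - b y : ZMod 2).val : ℤ)) (adjust l hl) (fun y => by simp only [lg, hg])
      (adjust l hl).short (cast l)
    exact ⟨e, ν, h₁, fun _ => h₂ fun _ => rfl, h₃⟩
  · obtain ⟨l, hl⟩ := exists_sideFunction hf.tet
    obtain ⟨n, ng, ns⟩ := hf.exists_discPotential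
    obtain ⟨e, ν, h₁, _, h₃⟩ := main _ _ (adjust l hl) ng ns (cast l)
    exact ⟨e, ν, h₁, fun h => absurd h hp, h₃⟩

/-! ### The classes of the cocycles of even angle structures -/

/-- A function on the faces that comes from edge data gives a coboundary. -/
theorem exists_d1_eq_rect {b e ν : T.Flag → ZMod 2} (hl : ∀ y, b (T.move .long y) = b y)
    (hm : ∀ y, b (T.move .medium y) = b y) (hg : ∀ y, b (T.move .glue y) = b y)
    (h : T.IsEdgeData e ν) (hb : ∀ y, sideSum e ν y = b y) {a : T.Quad → ZMod 2}
    (ha : ∀ y, a (quadOf y) = b y + b (T.move .short y)) :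
    ∃ c : T.C1, ((∀ y, ν y = 0) → c.2 = 0) ∧ T.d1 c = (T.rect a, 0) := by
  -- On a rectangle the two values of `e` cancel and leave `b y + b (short y)`.
  let l : T.LongEdges → ZMod 2 := liftCell _ (fun y => b y + e y) (by
    intro c hc y
    obtain rfl | rfl : c = .long ∨ c = .glue := by simpa using hc
    · simp only [hl, h.long]
    · simp only [hg, h.glue])
  -- Each medium edge receives the values of `ν` at the short edges at its two ends, so around a
  -- boundary hexagon every short edge counts twice. Equality of the jumps makes this independent of
  -- the side of the face.
  let k : T.MediumEdges → ZMod 2 := liftCell _ (fun y => ν y + ν (T.move .medium y)) (by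
    intro c hc y
    obtain rfl | rfl : c = .medium ∨ c = .glue := by simpa using hc
    · simp only [move_move]; ring
    · have := h.jump y
      rw [← glue_medium]
      simp only [CharTwo.sub_eq_add] at this ⊢
      generalize ν (T.move .glue (T.move .medium y)) = a at *
      generalize ν (T.move .medium y) = b at *
      generalize ν (T.move .glue y) = c at *
      generalize ν y = d at *
      clear hb
      revert a b c d; decide)
  have two : (2 : ZMod 2) = 0 := rfl
  refine ⟨(l, k, 0), fun h0 => ?_, ?_⟩
  · ext Y
    · obtain ⟨y, rfl⟩ := exists_cell Y
      simp [k, h0]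
    · rfl
  · ext Y
    · obtain ⟨y, rfl⟩ := exists_cell Y
      rw [d1_largeHexagon]
      have := hb y
      simp only [sideSum, edgeSum, CharTwo.sub_eq_add] at this
      simp only [l, k, liftCell_cell, rect, Pi.zero_apply, hm, hl]
      rw [long_medium_long] at this
      linear_combination this + 2 * b y * two
    · obtain ⟨y, rfl⟩ := exists_cell Y
      rw [d1_rectangle]
      simp only [l, liftCell_cell, rect, Pi.zero_apply, h.short]
      change _ = a (quadOf y)
      rw [ha]
      linear_combination e y * two
    · obtain ⟨y, rfl⟩ := exists_cell Y
      rw [d1_snd, d1bd_boundaryHexagon]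
      have : ν (T.move .medium (T.move .short (T.move .medium y))) =
          ν (T.move .medium (T.move .short y)) := by rw [← short_medium_short, h.short']
      simp only [k, liftCell_cell, Pi.zero_apply, h.short', this, add_zero]
      change _ = (0 : ZMod 2)
      linear_combination
        (ν y + ν (T.move .medium y) + ν (T.move .medium (T.move .short y))) * two
    · rw [d1_snd, d1bd_edgeDisc]
      simp

/-- If the class of a face function vanishes, then it comes from edge data. -/
theorem exists_isEdgeData_of_d1 {b : T.Flag → ZMod 2} (hl : ∀ y, b (T.move .long y) = b y)
    (hm : ∀ y, b (T.move .medium y) = b y) (hg : ∀ y, b (T.move .glue y) = b y)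
    {a : T.Quad → ZMod 2} (ha : ∀ y, a (quadOf y) = b y + b (T.move .short y)) {c : T.C1}
    (hc : T.d1 c = (T.rect a, 0)) :
    ∃ e ν : T.Flag → ZMod 2, T.IsEdgeData e ν ∧ (c.2 = 0 → ∀ y, ν y = 0) ∧
      ∀ y, sideSum e ν y = b y := by
  classical
  have two : (2 : ZMod 2) = 0 := rfl
  have hrec : ∀ y, c.1 (cell _ y) + c.1 (cell _ (T.move .short y))
      + (c.2.2 (cell _ y) + c.2.2 (cell _ (T.move .long y))) = b y + b (T.move .short y) :=
    fun y => by
      rw [← d1_rectangle, hc, ← ha]; rfl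
  have hex : ∀ y, c.1 (cell _ y) + c.1 (cell _ (T.move .medium y))
        + c.1 (cell _ (T.move .medium (T.move .long y)))
      + (c.2.1 (cell _ y) + c.2.1 (cell _ (T.move .long y))
        + c.2.1 (cell _ (T.move .long (T.move .medium y)))) = 0 := fun y => by
    rw [← d1_largeHexagon, hc]; rfl
  have bd : ∀ y, c.2.1 (cell _ y) + c.2.1 (cell _ (T.move .short y))
        + c.2.1 (cell _ (T.move .short (T.move .medium y)))
      + (c.2.2 (cell _ y) + c.2.2 (cell _ (T.move .medium y))
        + c.2.2 (cell _ (T.move .medium (T.move .short y)))) = 0 := fun y => by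
    rw [← d1bd_boundaryHexagon, ← d1_snd, hc]; rfl
  have main : ∀ n : T.Flag → ZMod 2, (∀ y, n (T.move .glue y) = n y) →
      (∀ y, n (T.move .short y) = n y + c.2.2 (cell _ y)) →
      ∃ e ν : T.Flag → ZMod 2, T.IsEdgeData e ν ∧
      ((∀ y, n y = 0) → c.2 = 0 → ∀ y, ν y = 0) ∧ ∀ y, sideSum e ν y = b y := by
    -- Changing the cochain by the coboundary of `n` makes it vanish on the short edges; `l` and `k`
    -- are its new values on long and medium edges.
    intro n ng ns
    let l : T.Flag → ZMod 2 := fun y => c.1 (cell _ y) + n y + n (T.move .long y)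
    let k : T.Flag → ZMod 2 := fun y => c.2.1 (cell _ y) + n y + n (T.move .medium y)
    have kM : ∀ y, k (T.move .medium y) = k y := fun y => by
      simp only [k, move_move, cell_move (S := {.medium, .glue}) (c := .medium) (by decide)]; ring
    have kG : ∀ y, k (T.move .glue y) = k y := fun y => by
      simp only [k, ← glue_medium, ng, cell_move (S := {.medium, .glue}) (c := .glue) (by decide)]
    have lL : ∀ y, l (T.move .long y) = l y := fun y => by
      simp only [l, move_move, cell_move (S := {.long, .glue}) (c := .long) (by decide)]; ring
    have lG : ∀ y, l (T.move .glue y) = l y := fun y => by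
      simp only [l, ← glue_long, ng, cell_move (S := {.long, .glue}) (c := .glue) (by decide)]
    have lrec : ∀ y, l y + l (T.move .short y) = b y + b (T.move .short y) := fun y => by
      simp only [l, ← short_long, ns]
      linear_combination hrec y + (n y + n (T.move .long y)) * two
    have lhex : ∀ y, l y + l (T.move .medium y) + l (T.move .medium (T.move .long y)) +
        (k y + k (T.move .long y) + k (T.move .long (T.move .medium y))) = 0 := fun y => by
      simp only [l, k, long_medium_long]
      linear_combination hex y + (n y + n (T.move .long y) + n (T.move .medium y) +
        n (T.move .long (T.move .medium y)) + n (T.move .medium (T.move .long y)) +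
        n (T.move .medium (T.move .long (T.move .medium y)))) * two
    have kbd : ∀ y, k y + k (T.move .short y) + k (T.move .short (T.move .medium y)) = 0 :=
      fun y => by
      have e₁ := ns y
      have e₂ := ns (T.move .medium y)
      have e₃ := ns (T.move .medium (T.move .short y))
      rw [short_medium_short] at e₃
      simp only [k]
      rw [e₁, e₂, e₃]
      linear_combination bd y + (n y + n (T.move .medium y) +
        n (T.move .medium (T.move .short y))) * two
    have kν : ∀ y, k y = k (T.move .short (T.move .medium y)) + k (T.move .short y) := fun y => by
      linear_combination kbd y - (k (T.move .short (T.move .medium y)) + k (T.move .short y)) * two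
    -- A short edge takes the value of `k` at the medium edge opposite to it in the boundary
    -- hexagon. As the three values of `k` there add up to zero, `k` is the sum of `ν` over the two
    -- ends of a medium edge.
    refine ⟨fun y => l y + b y, fun y => k (T.move .short (T.move .medium y)),
      ⟨fun y => by simp only [lL, hl], fun y => ?_, fun y => by simp only [lG, hg], fun y => ?_,
        fun y => ?_⟩, fun h0 hc y => ?_, fun y => ?_⟩
    · linear_combination lrec y + (b (T.move .short y) - l y) * two
    · rw [short_medium_short, kM]
    · have e₁ := kν y
      have e₂ := kν (T.move .glue y)
      rw [kG] at e₂
      simp only [glue_medium, move_move]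
      linear_combination e₁ - e₂ + (k (T.move .short (T.move .medium y)) -
        k (T.move .short (T.move .medium (T.move .glue y)))) * two
    · simp [k, h0, hc]
    · have e₁ := kν y
      have e₂ := kν (T.move .long y)
      have e₃ := kν (T.move .long (T.move .medium y))
      have e := lhex y
      clear_value k l
      simp only [sideSum, edgeSum, hm, hl, move_move, CharTwo.sub_eq_add, long_medium_long]
      linear_combination e - e₁ - e₂ - e₃ + b y * two
  by_cases h0 : c.2 = 0
  · obtain ⟨e, ν, h₁, h₂, h₃⟩ := main (fun _ => 0) (fun _ => rfl) fun y => by simp [h0]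
    exact ⟨e, ν, h₁, h₂ fun _ => rfl, h₃⟩
  · obtain ⟨n, ng, ns⟩ := exists_discPotential (T := T) c.2.2 fun D => by
      rw [← d1bd_edgeDisc, ← d1_snd, hc]; rfl
    obtain ⟨e, ν, h₁, _, h₃⟩ := main n ng fun y => by rw [ns, sgn_smul_zmod]
    exact ⟨e, ν, h₁, fun h => absurd h h0, h₃⟩

theorem rect_sub (α α' : T.Quad → ZMod 2) : T.rect α - T.rect α' = T.rect (α - α') := by
  ext <;> simp [rect]

theorem mem_B2rel_iff {σ : T.C2rel} : σ ∈ T.B2rel ↔ ∃ c : T.C1, c.2 = 0 ∧ T.d1 c = (σ, 0) := by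
  constructor
  · rintro ⟨l, rfl⟩
    exact ⟨(l, 0), rfl, Prod.ext rfl (by rw [d1_snd, map_zero])⟩
  · rintro ⟨⟨l, _⟩, rfl, h⟩
    exact ⟨l, congrArg Prod.fst h⟩

/-- Two even angle structures define the same class if and only if their difference lifts to an
integer tangent vector. -/
theorem rect_sub_mem_B2_iff {α α' : T.Quad → ZMod 2} (hα : α ∈ T.evenAngles)
    (hα' : α' ∈ T.evenAngles) :
    (T.rect α - T.rect α', 0) ∈ T.B2 ↔
      ∃ f : T.Quad → ℤ, T.IsTangent f ∧ ∀ q, (f q : ZMod 2) = α q - α' q := by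
  obtain ⟨b, hl, hm, hg, h⟩ := exists_face_function_of_evenAngles hα' hα
  have ha : ∀ y, (α - α') (quadOf y) = b y + b (T.move .short y) := fun y => by
    rw [Pi.sub_apply, h, add_sub_cancel_left]
  rw [rect_sub]
  constructor
  · rintro ⟨c, hc⟩
    obtain ⟨e, ν, hd, _, hb⟩ := exists_isEdgeData_of_d1 hl hm hg ha hc
    obtain ⟨f, hf, _, hf'⟩ := exists_isTangent_of_isEdgeData hd hb
    refine ⟨f, hf, fun q => ?_⟩
    obtain ⟨y, rfl⟩ := exists_quadOf_eq q
    rw [hf', ← ha]; rfl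
  · rintro ⟨f, hf, hf'⟩
    obtain ⟨e, ν, hd, _, hb⟩ := exists_isEdgeData_of_isTangent hl hm hg hf
      fun y => by rw [hf', ← ha]; rfl
    obtain ⟨c, _, hc⟩ := exists_d1_eq_rect hl hm hg hd hb ha
    exact ⟨c, hc⟩

theorem rect_sub_mem_B2rel_iff {α α' : T.Quad → ZMod 2} (hα : α ∈ T.evenAngles)
    (hα' : α' ∈ T.evenAngles) :
    T.rect α - T.rect α' ∈ T.B2rel ↔ ∃ f : T.Quad → ℤ, T.IsTangent f ∧ T.IsPeripherallyTrivial f ∧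
      ∀ q, (f q : ZMod 2) = α q - α' q := by
  obtain ⟨b, hl, hm, hg, h⟩ := exists_face_function_of_evenAngles hα' hα
  have ha : ∀ y, (α - α') (quadOf y) = b y + b (T.move .short y) := fun y => by
    rw [Pi.sub_apply, h, add_sub_cancel_left]
  rw [rect_sub, mem_B2rel_iff]
  constructor
  · rintro ⟨c, h0, hc⟩
    obtain ⟨e, ν, hd, hν, hb⟩ := exists_isEdgeData_of_d1 hl hm hg ha hc
    obtain ⟨f, hf, hp, hf'⟩ := exists_isTangent_of_isEdgeData hd hb
    refine ⟨f, hf, hp (hν h0), fun q => ?_⟩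
    obtain ⟨y, rfl⟩ := exists_quadOf_eq q
    rw [hf', ← ha]; rfl
  · rintro ⟨f, hf, hp, hf'⟩
    obtain ⟨e, ν, hd, hν, hb⟩ := exists_isEdgeData_of_isTangent hl hm hg hf
      fun y => by rw [hf', ← ha]; rfl
    obtain ⟨c, hc₀, hc⟩ := exists_d1_eq_rect hl hm hg hd hb ha
    exact ⟨c, hc₀ (hν hp), hc⟩

/-! ### Cohomology classes represented by even angle structures. -/

/-- A consistent choice of one end for every edge, by numbering the discs; it uses that the two ends
are different discs. -/
theorem exists_end_function :
    ∃ χ : T.Flag → Prop, (∀ y, χ (T.move .short y) ↔ χ y) ∧ (∀ y, χ (T.move .glue y) ↔ χ y) ∧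
      ∀ y, χ (T.move .long y) ↔ ¬ χ y := by
  let e := Fintype.equivFin T.EdgeDiscs
  refine ⟨fun y => e (cell _ y) < e (cell _ (T.move .long y)), fun y => ?_, fun y => ?_,
    fun y => ?_⟩
  · simp only [← short_long, cell_move (S := {.short, .glue}) (c := .short) (by decide)]
  · simp only [← glue_long, cell_move (S := {.short, .glue}) (c := .glue) (by decide)]
  · simp only [move_move, not_lt]
    have ne : e (cell _ (T.move .long y)) ≠ e (cell _ y) := fun h =>
      edgeDisc_long_ne y (e.injective h)
    exact ⟨fun h => h.le, fun h => lt_of_le_of_ne h ne⟩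

/-- A function on the rectangles whose sums around all edges vanish is a coboundary up to a function
on the large hexagons. -/
theorem exists_longEdge_function {r : T.Rectangles → ZMod 2}
    [∀ E : T.Edges, DecidablePred fun R : T.Rectangles => R.proj (by decide) = E]
    (hr : ∀ E : T.Edges, ∑ R : T.Rectangles with R.proj (by decide) = E, r R = 0) :
    ∃ l : T.LongEdges → ZMod 2, ∀ y, l (cell _ y) + l (cell _ (T.move .short y)) = r (cell _ y) := by
  classical
  obtain ⟨n, ng, ns⟩ := exists_discPotential (T := T) (fun Y => r (Y.proj (by decide))) fun D => by
    obtain ⟨y, rfl⟩ := exists_cell D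
    rw [← sum_rectangles, hr]
  obtain ⟨χ, χs, χg, χl⟩ := exists_end_function (T := T)
  -- The potential need not agree at the two ends of an edge; evaluating it at the end selected by
  -- `χ` gives a function of the long edge.
  let l : T.Flag → ZMod 2 := fun y => if χ y then n y else n (T.move .long y)
  have ns' : ∀ y, n (T.move .short y) = n y + r (cell _ y) := fun y => by
    rw [ns, sgn_smul_zmod]; rfl
  have hl : ∀ c ∈ ({.long, .glue} : Finset Move), ∀ y, l (T.move c y) = l y := by
    intro c hc y
    obtain rfl | rfl : c = .long ∨ c = .glue := by simpa using hc
    · by_cases h : χ y <;> simp [l, χl, h, move_move]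
    · by_cases h : χ y <;> simp [l, χg, h, ng, ← glue_long]
  refine ⟨liftCell _ l hl, fun y => ?_⟩
  have rl : r (cell _ (T.move .long y)) = r (cell _ y) := by rw [cell_move (by decide)]
  simp only [liftCell_cell, l, χs, ← short_long, ns', rl]
  split_ifs
  · exact (by decide : ∀ a b : ZMod 2, a + (a + b) = b) _ _
  · exact (by decide : ∀ a b : ZMod 2, a + (a + b) = b) _ _

theorem cell_eq_of_face {y y' : T.Flag} (h : y'.1 = y.1) (h₃ : y'.2 3 = y.2 3) :
    cell {.long, .medium} y' = cell {.long, .medium} y := by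
  obtain ⟨β, hβ⟩ := exists_face_function (T := T) (b := cell {.long, .medium})
    (fun y => cell_move (by decide) y) (fun y => cell_move (by decide) y)
  rw [hβ, hβ y, h, h₃]

theorem cell_eq_of_tetrahedron {y y' : T.Flag} (h : y'.1 = y.1) :
    cell {.long, .medium, .short} y' = cell {.long, .medium, .short} y := by
  by_cases h₃ : y'.2 3 = y.2 3
  · exact cell_mono (by decide) (cell_eq_of_face h h₃)
  · obtain ⟨p, hp₂, hp₃⟩ : ∃ p : Equiv.Perm (Fin 4), p 2 = y.2 3 ∧ p 3 = y'.2 3 := by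
      generalize y.2 3 = i at h₃ ⊢
      generalize y'.2 3 = j at h₃ ⊢
      revert i j; decide
    have e₁ : cell {.long, .medium, .short} y' = cell {.long, .medium, .short} ((y.1, p) : T.Flag) :=
      cell_mono (by decide) (cell_eq_of_face h hp₃.symm)
    have e₂ : cell {.long, .medium, .short} y =
        cell {.long, .medium, .short} (T.move .short (y.1, p)) :=
      cell_mono (by decide) (cell_eq_of_face rfl (by simp [move, hp₂]))
    rw [e₁, e₂, cell_move (by decide)]

theorem sum_tetrahedron_faces {A : Type*} [AddCommMonoid A] {β : Fin N → Fin 4 → A}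
    (g : T.Cell {.long, .medium} → A) (hg : ∀ y, g (cell _ y) = β y.1 (y.2 3)) (t : Fin N)
    [DecidablePred fun F : T.Cell {.long, .medium} =>
      F.proj (by decide) = cell {.long, .medium, .short} ((t, 1) : T.Flag)] :
    ∑ F : T.Cell {.long, .medium} with F.proj (by decide) =
      cell {.long, .medium, .short} ((t, 1) : T.Flag), g F = ∑ f, β t f := by
  rw [sum_cells _ (t, 1) (fun f : Fin 4 => (t, Equiv.swap 3 f))]
  · simp [hg]
  · intro i j e
    have := cell_invariant (P := fun y : T.Flag => y.2 3 = j) (fun c hc y hy => by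
      obtain rfl | rfl : c = .long ∨ c = .medium := by simpa using hc
      · simpa [move, Equiv.swap_apply_of_ne_of_ne] using hy
      · simpa [move, Equiv.swap_apply_of_ne_of_ne] using hy) e (by simp)
    simpa using this
  · exact fun i => cell_eq_of_tetrahedron rfl
  · intro y' e
    have : y'.1 = t := cell_invariant (P := fun y : T.Flag => y.1 = t) (fun c hc y hy => by
      obtain rfl | rfl | rfl : c = .long ∨ c = .medium ∨ c = .short := by simpa using hc
      all_goals exact hy) e rfl
    exact ⟨y'.2 3, cell_eq_of_face this (by simp)⟩

/-- Every relative cohomology class is represented by the cocycle of an even angle structure. -/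
theorem exists_rect_of_mem_Z2rel
    (hT : ∀ s t : Fin N, Relation.ReflTransGen (fun a b => ∃ f, T.adj a f = b) s t)
    {σ : T.C2rel} (hσ : σ ∈ T.Z2rel) : ∃ α ∈ T.evenAngles, σ - T.rect α ∈ T.B2rel := by
  classical
  obtain ⟨ρ, hρ⟩ := exists_isEvenCoorientation hT
  have hα := turn_mem_evenAngles hρ
  have h₁ : σ - T.rect (turn ρ) ∈ T.Z2rel := T.Z2rel.sub_mem hσ (rect_mem_Z2 hα)
  set σ₁ := σ - T.rect (turn ρ) with hσ₁
  have h₁' : T.d2 (σ₁, 0) = 0 := h₁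
  -- The cocycle condition on the cylinders lets a cochain on the long edges remove the values on
  -- the rectangles.
  obtain ⟨l, hl⟩ := exists_longEdge_function (r := σ₁.2) fun E => by
    have := congrFun (congrArg Prod.snd h₁') E
    rw [d2_edges] at this
    simpa using this
  let c : T.C1 := (l, 0)
  have hc : T.d1 c = ((T.d1 c).1, 0) := Prod.ext rfl (by rw [d1_snd]; exact map_zero _)
  have hr : (T.d1 c).1.2 = σ₁.2 := by
    ext R
    obtain ⟨y, rfl⟩ := exists_cell R
    rw [d1_rectangle, ← hl]
    simp [c]
  -- What is left lives on the large hexagons, i.e. on the faces. The cocycle condition on the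
  -- tetrahedra says that its sum over the four faces vanishes, which is what a change of even
  -- co-orientation requires.
  let h' : T.LargeHexagons → ZMod 2 := σ₁.1 - (T.d1 c).1.1
  let b : T.Flag → ZMod 2 := fun y => h' (cell _ y)
  have bl : ∀ y, b (T.move .long y) = b y := fun y => by simp only [b, cell_move (S := {.long, .medium, .glue}) (c := .long) (by decide)]
  have bm : ∀ y, b (T.move .medium y) = b y := fun y => by simp only [b, cell_move (S := {.long, .medium, .glue}) (c := .medium) (by decide)]
  have bg : ∀ y, b (T.move .glue y) = b y := fun y => by simp only [b, cell_move (S := {.long, .medium, .glue}) (c := .glue) (by decide)]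
  obtain ⟨β, hβ⟩ := exists_face_function bl bm
  have sum : ∀ t, β t 0 + β t 1 + β t 2 + β t 3 = 0 := by
    intro t
    have e₁ : T.d2 ((h', 0), 0) = 0 := by
      have : (((h', 0), 0) : T.C2) = (σ₁, 0) - T.d1 c := by
        rw [hc]
        refine Prod.ext (Prod.ext rfl ?_) (sub_zero _).symm
        exact (sub_eq_zero.mpr hr.symm).symm
      rw [this, map_sub, h₁', d2_d1, sub_zero]
    have e₂ := congrFun (congrArg Prod.fst e₁) (cell _ (t, 1))
    rw [d2_tetrahedra] at e₂
    simp only [Pi.zero_apply, Finset.sum_const_zero, add_zero, Prod.fst_zero] at e₂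
    rw [sum_tetrahedron_faces (fun F => h' (F.proj (by decide))) hβ] at e₂
    rw [← e₂, Fin.sum_univ_four]
  let a : T.Quad → ZMod 2 := fun q => β q.1 0 + β q.1 q.2.succ
  have ha : ∀ y, a (quadOf y) = b y + b (T.move .short y) := by
    intro y
    have key : ∀ (x : Fin 4 → ZMod 2) (i j : Fin 4), i ≠ j → x 0 + x 1 + x 2 + x 3 = 0 →
      x 0 + x (quadType i j).succ = x j + x i := by decide
    rw [hβ, hβ]
    simp only [a, quadOf, ← quadType_compl y.2, move, Equiv.Perm.mul_apply,
      Equiv.swap_apply_right]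
    exact key _ _ _ (y.2.injective.ne (by decide)) (sum y.1)
  have hα' : turn ρ + a ∈ T.evenAngles := by
    refine mem_evenAngles_of_add hα bl bm bg (fun t => ?_) fun y => by rw [Pi.add_apply, ha]
    have := evenAngles_tet hα t
    have key : ∀ x : Fin 4 → ZMod 2, x 0 + x 1 + x 2 + x 3 = 0 →
      (x 0 + x (0 : Fin 3).succ) + (x 0 + x (1 : Fin 3).succ) + (x 0 + x (2 : Fin 3).succ) = 0 := by
      decide
    simp only [Pi.add_apply, a]
    linear_combination this + key _ (sum t)
  refine ⟨turn ρ + a, hα', mem_B2rel_iff.mpr ?_⟩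
  -- Constant on the three long edges of a face: its coboundary is 3b = b on the hexagon and `b y +
  -- b (short y)` on the rectangles. This trades values on the hexagons for a change of the angle
  -- structure.
  let l' : T.LongEdges → ZMod 2 := liftCell _ b (by
    intro c hc y
    obtain rfl | rfl : c = .long ∨ c = .glue := by simpa using hc
    · exact bl y
    · exact bg y)
  refine ⟨c + (l', 0), by simp [c], ?_⟩
  have e : T.d1 (l', 0) = ((h', fun R => a (T.rectQuad R)), 0) := by
    refine Prod.ext (Prod.ext (funext fun Y => ?_) (funext fun Y => ?_)) (map_zero T.d1bd)
    · obtain ⟨y, rfl⟩ := exists_cell Y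
      rw [d1_largeHexagon]
      simp only [l', liftCell_cell, bm, bl, Prod.fst_zero, Pi.zero_apply, add_zero]
      exact (by decide : ∀ x : ZMod 2, x + x + x = x) _
    · obtain ⟨y, rfl⟩ := exists_cell Y
      rw [d1_rectangle]
      simp only [l', liftCell_cell, Prod.snd_zero, Pi.zero_apply, add_zero]
      exact (ha y).symm
  rw [map_add, hc, e]
  refine Prod.ext (Prod.ext ?_ ?_) (add_zero _)
  · simp [h', hσ₁, rect]
  · change (T.d1 c).1.2 + (fun R => a (T.rectQuad R)) = _
    rw [hr, hσ₁]
    funext R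
    simp only [rect, Pi.add_apply, Prod.snd_sub, Pi.sub_apply]
    exact (by decide : ∀ x y z : ZMod 2, x - y + z = x - (y + z)) _ _ _

/-- Every cohomology class that vanishes on the boundary comes from a relative one. -/
theorem exists_rect_of_restrict_eq_zero
    (hT : ∀ s t : Fin N, Relation.ReflTransGen (fun a b => ∃ f, T.adj a f = b) s t)
    {c : T.H2} (hc : T.restrict c = 0) : ∃ α ∈ T.evenAngles, T.Represents (T.rect α, 0) c := by
  obtain ⟨⟨σ, hσ⟩, rfl⟩ := Submodule.Quotient.mk_surjective _ c
  obtain ⟨d, hd⟩ := (Submodule.Quotient.mk_eq_zero _).mp hc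
  change T.d1bd d = σ.2 at hd
  have h₁ : σ - T.d1 (0, d) = ((σ - T.d1 (0, d)).1, 0) :=
    Prod.ext rfl (by rw [Prod.snd_sub, d1_snd, hd, sub_self])
  have h₂ : σ - T.d1 (0, d) ∈ T.Z2 := T.Z2.sub_mem hσ (d1_mem_Z2 _)
  rw [h₁] at h₂
  obtain ⟨α, hα, h⟩ := exists_rect_of_mem_Z2rel hT (mem_Z2rel_iff.mpr h₂)
  obtain ⟨e, -, he⟩ := mem_B2rel_iff.mp h
  refine ⟨α, hα, rect_mem_Z2 hα, ?_⟩
  rw [Submodule.Quotient.eq, Submodule.submoduleOf, Submodule.mem_comap]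
  change (T.rect α, 0) - σ ∈ T.B2
  refine ⟨-(e + (0, d)), ?_⟩
  rw [map_neg, map_add, he, ← sub_eq_zero]
  have : (((σ - T.d1 (0, d)).1 - T.rect α, 0) : T.C2) = σ - T.d1 (0, d) - (T.rect α, 0) := by
    conv_rhs => rw [h₁]
    exact Prod.ext rfl (sub_zero _).symm
  rw [this]
  abel

theorem represents_iff {σ : T.C2} (hσ : σ ∈ T.Z2) {τ : T.C2} {c : T.H2} (h : T.Represents τ c) :
    T.Represents σ c ↔ σ - τ ∈ T.B2 := by
  obtain ⟨hτ, rfl⟩ := h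
  simp only [Represents, hσ, exists_true_left, Submodule.Quotient.eq, Submodule.submoduleOf,
    Submodule.mem_comap]
  rfl

theorem representsRel_iff {σ : T.C2rel} (hσ : σ ∈ T.Z2rel) {τ : T.C2rel} {c : T.H2rel}
    (h : T.RepresentsRel τ c) : T.RepresentsRel σ c ↔ σ - τ ∈ T.B2rel := by
  obtain ⟨hτ, rfl⟩ := h
  simp only [RepresentsRel, hσ, exists_true_left, Submodule.Quotient.eq, Submodule.submoduleOf,
    Submodule.mem_comap]
  rfl

theorem exists_represents {σ : T.C2} (hσ : σ ∈ T.Z2) : ∃ c, T.Represents σ c := ⟨_, hσ, rfl⟩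

theorem exists_representsRel {σ : T.C2rel} (hσ : σ ∈ T.Z2rel) : ∃ c, T.RepresentsRel σ c :=
  ⟨_, hσ, rfl⟩

theorem Represents.eq {σ : T.C2} {c c' : T.H2} (h : T.Represents σ c) (h' : T.Represents σ c') :
    c = c' := by
  obtain ⟨_, rfl⟩ := h
  obtain ⟨_, rfl⟩ := h'
  rfl

theorem RepresentsRel.eq {σ : T.C2rel} {c c' : T.H2rel} (h : T.RepresentsRel σ c)
    (h' : T.RepresentsRel σ c') : c = c' := by
  obtain ⟨_, rfl⟩ := h
  obtain ⟨_, rfl⟩ := h'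
  rfl

theorem Represents.restrict_eq_zero {σ : T.C2rel} {c : T.H2} (h : T.Represents (σ, 0) c) :
    T.restrict c = 0 := by
  obtain ⟨hσ, rfl⟩ := h
  exact (Submodule.Quotient.mk_eq_zero _).mpr (Submodule.zero_mem _)

/-! ### Topology of the spaces of circle-valued angle structures -/

open Filter Topology in
/-- The relations between circle-valued functions near the constant function `1` hold for their
arguments. -/
theorem eventually_sum_arg_eq_zero {ι : Type*} [Fintype ι] (R : Set (ι → ℤ)) :
    ∀ᶠ κ : ι → Circle in 𝓝 1, (∀ c ∈ R, ∑ q, c q • Additive.ofMul (κ q) = 0) →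
      ∀ c ∈ R, ∑ q, c q • Complex.arg (κ q) = 0 := by
  -- There are infinitely many peripheral relations, but finitely many of them span the rest over
  -- the integers. This yields a single neighbourhood of 1.
  obtain ⟨S, hS, hspan⟩ := (Submodule.fg_span_iff_fg_span_finset_subset R).mp
    (IsNoetherian.noetherian (Submodule.span ℤ R))
  have small : ∀ c ∈ S, ∀ᶠ κ : ι → Circle in 𝓝 1, |∑ q, c q • Complex.arg (κ q)| < 2 * Real.pi := by
    intro c _
    have cont : ContinuousAt (fun κ : ι → Circle => |∑ q, c q • Complex.arg (κ q)|) 1 := by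
      refine ContinuousAt.abs (tendsto_finsetSum _ fun q _ => ?_)
      refine ContinuousAt.const_smul ?_ (c q)
      refine ContinuousAt.comp (g := Complex.arg) (Complex.continuousAt_arg (by simp)) ?_
      exact (by fun_prop : Continuous fun κ : ι → Circle => ((κ q : Circle) : ℂ)).continuousAt
    refine cont.eventually (gt_mem_nhds ?_)
    simp [Real.pi_pos]
  filter_upwards [(Finset.eventually_all S).mpr small] with κ hκ h
  have hS' : ∀ c ∈ S, ∑ q, c q • Complex.arg (κ q) = 0 := by
    intro c hc
    have e : Circle.exp (∑ q, c q • Complex.arg (κ q)) = 1 := by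
      have := h c (hS hc)
      have e : Circle.expHom (∑ q, c q • Complex.arg (κ q)) = 0 := by
        rw [map_sum, ← this]
        refine Finset.sum_congr rfl fun q _ => ?_
        rw [map_zsmul]
        congr 1
        exact congrArg Additive.ofMul (Circle.exp_arg _)
      exact e
    -- The sum of arguments is a multiple of 2π and, close to 1, smaller than 2π in absolute value.
    obtain ⟨n, hn⟩ := Circle.exp_eq_one.mp e
    have := hκ c hc
    rw [hn] at this ⊢
    have pi := Real.pi_pos
    have : |(n : ℝ)| < 1 := by
      rw [abs_mul, abs_of_pos (by positivity : 0 < 2 * Real.pi)] at this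
      by_contra! h
      nlinarith
    have : |n| < 1 := by exact_mod_cast this
    rw [Int.abs_lt_one_iff.mp this]
    simp
  have key : ∀ c ∈ Submodule.span ℤ (S : Set (ι → ℤ)), ∑ q, c q • Complex.arg (κ q) = 0 := by
    intro c hc
    induction hc using Submodule.span_induction with
    | mem c hc => exact hS' c hc
    | zero => simp
    | add c d _ _ h₁ h₂ =>
      simp only [Pi.add_apply, add_smul, Finset.sum_add_distrib, h₁, h₂, add_zero]
    | smul a c _ h =>
      simp only [Pi.smul_apply, smul_assoc, ← Finset.smul_sum, h, smul_zero]
  exact fun c hc => key c (hspan ▸ Submodule.subset_span hc)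

theorem isTangent_iff {A : Type*} [AddCommGroup A] {f : T.Quad → A} :
    T.IsTangent f ↔ ∀ c ∈ Set.range (fun t (q : T.Quad) => if q.1 = t then (1 : ℤ) else 0) ∪
      Set.range (fun E q => (T.G E q : ℤ)), ∑ q, c q • f q = 0 := by
  simp only [Set.mem_union, or_imp, forall_and, Set.forall_mem_range]
  have tet : ∀ t, ∑ q : T.Quad, (if q.1 = t then (1 : ℤ) else 0) • f q =
      f (t, 0) + f (t, 1) + f (t, 2) := by
    intro t
    rw [Fintype.sum_prod_type, Finset.sum_eq_single t]
    · simp [Fin.sum_univ_three]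
    · intro s _ h; simp [h]
    · simp
  simp only [tet, natCast_zsmul]
  exact ⟨fun h => ⟨h.tet, h.edge⟩, fun h => ⟨h.1, h.2⟩⟩

open Filter Topology in
theorem eventually_isTangent_arg : ∀ᶠ κ : T.Quad → Circle in 𝓝 1,
    (T.IsTangent fun q => Additive.ofMul (κ q)) → T.IsTangent fun q => Complex.arg (κ q) := by
  simp only [isTangent_iff]
  exact eventually_sum_arg_eq_zero _

open Filter Topology in
theorem eventually_isPeripherallyTrivial_arg : ∀ᶠ κ : T.Quad → Circle in 𝓝 1,
    (T.IsPeripherallyTrivial fun q => Additive.ofMul (κ q)) →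
      T.IsPeripherallyTrivial fun q => Complex.arg (κ q) := by
  filter_upwards [eventually_sum_arg_eq_zero (Set.range fun γ : T.PeripheralCurve => γ.coeff)]
    with κ h
  simpa only [Set.forall_mem_range, IsPeripherallyTrivial] using h

theorem expMul_arg (κ ω : T.Quad → Circle) : expMul (fun q => Complex.arg (κ q)) ω = κ * ω := by
  funext q
  simp [expMul, Circle.exp_arg]

theorem expMul_expMul (W W' : T.Quad → ℝ) (ω : T.Quad → Circle) :
    expMul W (expMul W' ω) = expMul (W + W') ω := by
  funext q
  simp [expMul, Circle.exp_add, mul_assoc]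

theorem continuous_expMul (W : T.Quad → ℝ) (ω : T.Quad → Circle) :
    Continuous fun s : ℝ => expMul (s • W) ω := by
  refine continuous_pi fun q => ?_
  simp only [expMul, Pi.smul_apply, smul_eq_mul]
  fun_prop

theorem IsTangent.smul {W : T.Quad → ℝ} (h : T.IsTangent W) (s : ℝ) : T.IsTangent (s • W) := by
  simpa [Pi.smul_def] using isTangent_map (AddMonoidHom.mulLeft s) h

theorem IsPeripherallyTrivial.smul {W : T.Quad → ℝ} (h : T.IsPeripherallyTrivial W) (s : ℝ) :
    T.IsPeripherallyTrivial (s • W) := by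
  simpa [Pi.smul_def] using isPeripherallyTrivial_map (AddMonoidHom.mulLeft s) h

theorem connectedComponents_mk_eq {X : Type*} [TopologicalSpace X] {p : ℝ → X} (hp : Continuous p)
    (s t : ℝ) : ConnectedComponents.mk (p s) = ConnectedComponents.mk (p t) :=
  ConnectedComponents.coe_eq_coe'.mpr
    ((isPreconnected_range hp).subset_connectedComponent ⟨t, rfl⟩ ⟨s, rfl⟩)

theorem mk_eq_of_expMul {W : T.Quad → ℝ} (hW : T.IsTangent W) {ω ω' : T.SA}
    (h : (ω' : T.Quad → Circle) = expMul W ω) :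
    ConnectedComponents.mk ω' = ConnectedComponents.mk ω := by
  have := connectedComponents_mk_eq (X := T.SA)
    (p := fun s => ⟨expMul (s • W) ω, expMul_mem_SA (hW.smul s) ω.2⟩)
    ((continuous_expMul W ω).subtype_mk _) 1 0
  convert this using 2
  · exact Subtype.ext (by simp [h])
  · exact Subtype.ext (by funext q; simp [expMul])

theorem mk_eq_of_expMul₀ {W : T.Quad → ℝ} (hW : T.IsTangent W) (hW' : T.IsPeripherallyTrivial W)
    {ω ω' : T.SA₀} (h : (ω' : T.Quad → Circle) = expMul W ω) :
    ConnectedComponents.mk ω' = ConnectedComponents.mk ω := by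
  have := connectedComponents_mk_eq (X := T.SA₀)
    (p := fun s => ⟨expMul (s • W) ω, expMul_mem_SA₀ (hW.smul s) (hW'.smul s) ω.2⟩)
    ((continuous_expMul W ω).subtype_mk _) 1 0
  convert this using 2
  · exact Subtype.ext (by simp [h])
  · exact Subtype.ext (by funext q; simp [expMul])

/-- Near a circle-valued angle structure, all of them arise from it by tangent vectors. -/
theorem eventually_expMul (ω : T.SA) :
    ∀ᶠ ω' : T.SA in nhds ω, ∃ W : T.Quad → ℝ, T.IsTangent W ∧
      (ω' : T.Quad → Circle) = expMul W ω := by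
  have cont : Continuous fun ω' : T.SA => (ω' : T.Quad → Circle) / ω := by fun_prop
  have lim : Filter.Tendsto (fun ω' : T.SA => (ω' : T.Quad → Circle) / ω) (nhds ω) (nhds 1) := by
    simpa using cont.tendsto ω
  filter_upwards [lim.eventually eventually_isTangent_arg] with ω' h
  exact ⟨_, h (isTangent_div ω'.2 ω.2), by rw [expMul_arg, div_mul_cancel]⟩

theorem eventually_expMul₀ (ω : T.SA₀) :
    ∀ᶠ ω' : T.SA₀ in nhds ω, ∃ W : T.Quad → ℝ, T.IsTangent W ∧ T.IsPeripherallyTrivial W ∧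
      (ω' : T.Quad → Circle) = expMul W ω := by
  have cont : Continuous fun ω' : T.SA₀ => (ω' : T.Quad → Circle) / ω := by fun_prop
  have lim : Filter.Tendsto (fun ω' : T.SA₀ => (ω' : T.Quad → Circle) / ω) (nhds ω) (nhds 1) := by
    simpa using cont.tendsto ω
  filter_upwards [lim.eventually eventually_isTangent_arg,
    lim.eventually eventually_isPeripherallyTrivial_arg] with ω' h h'
  exact ⟨_, h (isTangent_div ω'.2.1 ω.2.1), h' (isPeripherallyTrivial_div ω'.2 ω.2),
    by rw [expMul_arg, div_mul_cancel]⟩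

theorem expHom_pi_mul (n : ℤ) : Circle.expHom (Real.pi * n) = signHom n := by
  have : Circle.expHom Real.pi = signHom 1 := by
    rw [signHom_one]
    exact congrArg Additive.ofMul (Circle.ext (by simp))
  rw [show Real.pi * n = n • Real.pi by simp [mul_comm], map_zsmul, this, ← map_zsmul, zsmul_one]

theorem expHom_add_signHom_eq_iff {x y : ℝ} {a b : ZMod 2} :
    Circle.expHom x + signHom a = Circle.expHom y + signHom b ↔
      ∃ n : ℤ, y - x = Real.pi * n ∧ (n : ZMod 2) = a - b := by
  have key : Circle.expHom x + signHom a = Circle.expHom y + signHom b ↔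
      Circle.expHom (y - x) = signHom (a - b) := by
    rw [map_sub, map_sub, sub_eq_sub_iff_add_eq_add, eq_comm, add_comm (signHom a)]
  rw [key]
  constructor
  · intro h
    have e : Circle.exp (y - x - Real.pi * ((a - b).val : ℤ)) = 1 := by
      have : Circle.expHom (y - x - Real.pi * ((a - b).val : ℤ)) = 0 := by
        rw [map_sub, expHom_pi_mul, cast_val_zmod, h, sub_self]
      exact this
    obtain ⟨m, hm⟩ := Circle.exp_eq_one.mp e
    refine ⟨(a - b).val + 2 * m, ?_, ?_⟩
    · push_cast at hm ⊢
      linarith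
    · rw [Int.cast_add, cast_val_zmod, Int.cast_mul, Int.cast_ofNat, show (2 : ZMod 2) = 0 from rfl,
        zero_mul, add_zero]
  · rintro ⟨n, h, h'⟩
    rw [h, expHom_pi_mul, h']

theorem expMul_signs_eq_iff {W W' : T.Quad → ℝ} {α α' : T.Quad → ZMod 2} :
    expMul W (signs α) = expMul W' (signs α') ↔
      ∃ f : T.Quad → ℤ, ∀ q, W' q - W q = Real.pi * f q ∧ (f q : ZMod 2) = α q - α' q := by
  rw [funext_iff]
  exact (forall_congr' fun q => expHom_add_signHom_eq_iff).trans Classical.skolem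

theorem IsTangent.add {A : Type*} [AddCommGroup A] {f g : T.Quad → A} (hf : T.IsTangent f)
    (hg : T.IsTangent g) : T.IsTangent (f + g) := by
  rw [isTangent_iff] at *
  intro c hc
  simp only [Pi.add_apply, smul_add, Finset.sum_add_distrib, hf c hc, hg c hc, add_zero]

theorem IsPeripherallyTrivial.add {A : Type*} [AddCommGroup A] {f g : T.Quad → A}
    (hf : T.IsPeripherallyTrivial f) (hg : T.IsPeripherallyTrivial g) :
    T.IsPeripherallyTrivial (f + g) := by
  intro γ
  simp only [Pi.add_apply, smul_add, Finset.sum_add_distrib, hf γ, hg γ, add_zero]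

theorem sum_pi_mul_eq_zero_iff (c f : T.Quad → ℤ) :
    ∑ q, c q • (Real.pi * f q) = 0 ↔ ∑ q, c q • f q = 0 := by
  have : ∑ q, c q • (Real.pi * f q) = Real.pi * ((∑ q, c q • f q : ℤ) : ℝ) := by
    simp [Finset.mul_sum, mul_left_comm]
  rw [this, mul_eq_zero, or_iff_right Real.pi_ne_zero, Int.cast_eq_zero]

theorem isTangent_pi_mul_iff {f : T.Quad → ℤ} :
    T.IsTangent (fun q => Real.pi * f q) ↔ T.IsTangent f := by
  simp only [isTangent_iff]
  exact forall₂_congr fun c _ => sum_pi_mul_eq_zero_iff c f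

theorem isPeripherallyTrivial_pi_mul_iff {f : T.Quad → ℤ} :
    T.IsPeripherallyTrivial (fun q => Real.pi * f q) ↔ T.IsPeripherallyTrivial f := by
  exact forall_congr' fun γ => sum_pi_mul_eq_zero_iff γ.coeff f

theorem IsTangent.sub {W W' : T.Quad → ℝ} (h : T.IsTangent W) (h' : T.IsTangent W') :
    T.IsTangent (W - W') := by
  have := h.add (h'.smul (-1))
  simpa [sub_eq_add_neg] using this

theorem IsPeripherallyTrivial.sub {W W' : T.Quad → ℝ} (h : T.IsPeripherallyTrivial W)
    (h' : T.IsPeripherallyTrivial W') : T.IsPeripherallyTrivial (W - W') := by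
  have := h.add (h'.smul (-1))
  simpa [sub_eq_add_neg] using this

/-! ### The classes of circle-valued angle structures -/

variable (T) in
/-- `Φ` assigns to a circle-valued angle structure the class of the even angle structures in its
connected component. -/
def IsClassMap (Φ : T.SA → T.H2) : Prop :=
  ∀ (ω : T.SA) (W : T.Quad → ℝ), ∀ α ∈ T.evenAngles, T.IsTangent W →
    (ω : T.Quad → Circle) = expMul W (signs α) → T.Represents (T.rect α, 0) (Φ ω)

variable (T) in
/-- The relative version of `IsClassMap`. -/
def IsRelClassMap (Φ : T.SA₀ → T.H2rel) : Prop :=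
  ∀ (ω : T.SA₀) (W : T.Quad → ℝ), ∀ α ∈ T.evenAngles, T.IsTangent W → T.IsPeripherallyTrivial W →
    (ω : T.Quad → Circle) = expMul W (signs α) → T.RepresentsRel (T.rect α) (Φ ω)

/-- Well-definedness of the class: the exponents of two presentations differ by π times an integer
tangent vector that lifts the difference of the sign vectors. -/
theorem rect_sub_mem_B2_of_expMul {W W' : T.Quad → ℝ} (hW : T.IsTangent W) (hW' : T.IsTangent W')
    {α α' : T.Quad → ZMod 2} (hα : α ∈ T.evenAngles) (hα' : α' ∈ T.evenAngles)
    (h : expMul W (signs α) = expMul W' (signs α')) : (T.rect α - T.rect α', 0) ∈ T.B2 := by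
  obtain ⟨f, hf⟩ := expMul_signs_eq_iff.mp h
  refine (rect_sub_mem_B2_iff hα hα').mpr ⟨f, isTangent_pi_mul_iff.mp ?_, fun q => (hf q).2⟩
  simp only [← fun q => (hf q).1]
  exact hW'.sub hW

theorem rect_sub_mem_B2rel_of_expMul {W W' : T.Quad → ℝ} (hW : T.IsTangent W)
    (hW' : T.IsTangent W') (hp : T.IsPeripherallyTrivial W) (hp' : T.IsPeripherallyTrivial W')
    {α α' : T.Quad → ZMod 2} (hα : α ∈ T.evenAngles) (hα' : α' ∈ T.evenAngles)
    (h : expMul W (signs α) = expMul W' (signs α')) : T.rect α - T.rect α' ∈ T.B2rel := by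
  obtain ⟨f, hf⟩ := expMul_signs_eq_iff.mp h
  refine (rect_sub_mem_B2rel_iff hα hα').mpr ⟨f, isTangent_pi_mul_iff.mp ?_,
    isPeripherallyTrivial_pi_mul_iff.mp ?_, fun q => (hf q).2⟩
  · simp only [← fun q => (hf q).1]
    exact hW'.sub hW
  · simp only [← fun q => (hf q).1]
    exact hp'.sub hp

theorem exists_isClassMap (hT : T.IsIdealTriangulation) : ∃ Φ, T.IsClassMap Φ := by
  choose W α hα hW _ h using fun ω : T.SA => exists_expMul hT.connected ω.2
  choose Φ hΦ using fun ω => exists_represents (mem_Z2rel_iff.mp (rect_mem_Z2 (hα ω)))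
  refine ⟨Φ, fun ω W' α' hα' hW' h' => ?_⟩
  rw [represents_iff (mem_Z2rel_iff.mp (rect_mem_Z2 hα')) (hΦ ω), Prod.mk_sub_mk, sub_zero]
  exact rect_sub_mem_B2_of_expMul hW' (hW ω) hα' (hα ω) (h'.symm.trans (h ω))

theorem exists_isRelClassMap (hT : T.IsIdealTriangulation) : ∃ Φ, T.IsRelClassMap Φ := by
  choose W α hα hW hp h using fun ω : T.SA₀ => exists_expMul hT.connected ω.2.1
  choose Φ hΦ using fun ω => exists_representsRel (rect_mem_Z2 (hα ω))
  refine ⟨Φ, fun ω W' α' hα' hW' hp' h' => ?_⟩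
  rw [representsRel_iff (rect_mem_Z2 hα') (hΦ ω)]
  exact rect_sub_mem_B2rel_of_expMul hW' (hW ω) hp' (hp ω ω.2) hα' (hα ω) (h'.symm.trans (h ω))

/-- Nearby angle structures are obtained by changing only the tangent vector, so the same even
structure computes their class. -/
theorem IsClassMap.isLocallyConstant (hT : T.IsIdealTriangulation) {Φ : T.SA → T.H2} (hΦ : T.IsClassMap Φ) :
    IsLocallyConstant Φ := by
  refine (IsLocallyConstant.iff_eventually_eq Φ).mpr fun ω => ?_
  obtain ⟨W, α, hα, hW, _, h⟩ := exists_expMul hT.connected ω.2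
  filter_upwards [eventually_expMul ω] with ω' ⟨V, hV, h'⟩
  rw [h, expMul_expMul] at h'
  exact (hΦ ω' _ α hα (hV.add hW) h').eq (hΦ ω W α hα hW h)

theorem IsRelClassMap.isLocallyConstant (hT : T.IsIdealTriangulation) {Φ : T.SA₀ → T.H2rel} (hΦ : T.IsRelClassMap Φ) :
    IsLocallyConstant Φ := by
  refine (IsLocallyConstant.iff_eventually_eq Φ).mpr fun ω => ?_
  obtain ⟨W, α, hα, hW, hp, h⟩ := exists_expMul hT.connected ω.2.1
  filter_upwards [eventually_expMul₀ ω] with ω' ⟨V, hV, hV', h'⟩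
  rw [h, expMul_expMul] at h'
  exact (hΦ ω' _ α hα (hV.add hW) (hV'.add (hp ω.2)) h').eq (hΦ ω W α hα hW (hp ω.2) h)

/-- Equality of the classes provides an integer tangent vector that absorbs the difference of signs.
Both structures then differ by the exponential of a real tangent vector, and scaling that vector
gives a path. -/
theorem IsClassMap.mk_eq (hT : T.IsIdealTriangulation) {Φ : T.SA → T.H2} (hΦ : T.IsClassMap Φ) {ω ω' : T.SA}
    (e : Φ ω = Φ ω') : ConnectedComponents.mk ω = ConnectedComponents.mk ω' := by
  obtain ⟨W, α, hα, hW, _, h⟩ := exists_expMul hT.connected ω.2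
  obtain ⟨W', α', hα', hW', _, h'⟩ := exists_expMul hT.connected ω'.2
  have h₁ := hΦ ω W α hα hW h
  have h₂ := hΦ ω' W' α' hα' hW' h'
  rw [e] at h₁
  have := (represents_iff (mem_Z2rel_iff.mp (rect_mem_Z2 hα)) h₂).mp h₁
  rw [Prod.mk_sub_mk, sub_zero, rect_sub_mem_B2_iff hα hα'] at this
  obtain ⟨f, hf, hf'⟩ := this
  have e' : expMul W (signs α) = expMul (W + fun q => Real.pi * f q) (signs α') :=
    expMul_signs_eq_iff.mpr ⟨f, fun q => ⟨by simp, hf' q⟩⟩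
  refine mk_eq_of_expMul (W := W + (fun q => Real.pi * f q) - W')
    ((hW.add (isTangent_pi_mul_iff.mpr hf)).sub hW') ?_
  rw [h, h', expMul_expMul, e', sub_add_cancel]

theorem IsRelClassMap.mk_eq (hT : T.IsIdealTriangulation) {Φ : T.SA₀ → T.H2rel} (hΦ : T.IsRelClassMap Φ) {ω ω' : T.SA₀}
    (e : Φ ω = Φ ω') : ConnectedComponents.mk ω = ConnectedComponents.mk ω' := by
  obtain ⟨W, α, hα, hW, hp, h⟩ := exists_expMul hT.connected ω.2.1
  obtain ⟨W', α', hα', hW', hp', h'⟩ := exists_expMul hT.connected ω'.2.1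
  have h₁ := hΦ ω W α hα hW (hp ω.2) h
  have h₂ := hΦ ω' W' α' hα' hW' (hp' ω'.2) h'
  rw [e] at h₁
  have := (representsRel_iff (rect_mem_Z2 hα) h₂).mp h₁
  rw [rect_sub_mem_B2rel_iff hα hα'] at this
  obtain ⟨f, hf, hfp, hf'⟩ := this
  have e' : expMul W (signs α) = expMul (W + fun q => Real.pi * f q) (signs α') :=
    expMul_signs_eq_iff.mpr ⟨f, fun q => ⟨by simp, hf' q⟩⟩
  refine mk_eq_of_expMul₀ (W := W + (fun q => Real.pi * f q) - W')
    ((hW.add (isTangent_pi_mul_iff.mpr hf)).sub hW')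
    (((hp ω.2).add (isPeripherallyTrivial_pi_mul_iff.mpr hfp)).sub (hp' ω'.2)) ?_
  rw [h, h', expMul_expMul, e', sub_add_cancel]

theorem signs_eq_expMul (α : T.Quad → ZMod 2) : signs α = expMul 0 (signs α) := by
  funext q; simp [expMul]

theorem isTangent_zero : T.IsTangent (0 : T.Quad → ℝ) := ⟨by simp, by simp⟩

theorem isPeripherallyTrivial_zero : T.IsPeripherallyTrivial (0 : T.Quad → ℝ) := fun γ => by simp

theorem IsClassMap.signs {Φ : T.SA → T.H2} (hΦ : T.IsClassMap Φ) {α : T.Quad → ZMod 2}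
    (hα : α ∈ T.evenAngles) (h : signs α ∈ T.SA) : T.Represents (T.rect α, 0) (Φ ⟨_, h⟩) :=
  hΦ _ 0 α hα isTangent_zero (signs_eq_expMul α)

theorem IsRelClassMap.signs {Φ : T.SA₀ → T.H2rel} (hΦ : T.IsRelClassMap Φ) {α : T.Quad → ZMod 2}
    (hα : α ∈ T.evenAngles) (h : signs α ∈ T.SA₀) : T.RepresentsRel (T.rect α) (Φ ⟨_, h⟩) :=
  hΦ _ 0 α hα isTangent_zero isPeripherallyTrivial_zero (signs_eq_expMul α)

theorem IsClassMap.range_eq (hT : T.IsIdealTriangulation) {Φ : T.SA → T.H2} (hΦ : T.IsClassMap Φ) :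
    Set.range Φ = (LinearMap.ker T.restrict : Set T.H2) := by
  ext c
  constructor
  · rintro ⟨ω, rfl⟩
    obtain ⟨W, α, hα, hW, _, h⟩ := exists_expMul hT.connected ω.2
    exact (hΦ ω W α hα hW h).restrict_eq_zero
  · intro hc
    obtain ⟨α, hα, h⟩ := exists_rect_of_restrict_eq_zero hT.connected hc
    exact ⟨⟨_, (signs_mem_SA₀ hα).1⟩, (hΦ.signs hα _).eq h⟩

theorem IsRelClassMap.surjective (hT : T.IsIdealTriangulation) {Φ : T.SA₀ → T.H2rel} (hΦ : T.IsRelClassMap Φ) :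
    Function.Surjective Φ := by
  intro c
  obtain ⟨⟨σ, hσ⟩, rfl⟩ := Submodule.Quotient.mk_surjective _ c
  obtain ⟨α, hα, h⟩ := exists_rect_of_mem_Z2rel hT.connected hσ
  have h₁ : T.RepresentsRel σ (Submodule.Quotient.mk ⟨σ, hσ⟩) := ⟨hσ, rfl⟩
  have h₂ := hΦ.signs hα (signs_mem_SA₀ hα)
  exact ⟨_, ((representsRel_iff hσ h₂).mpr h).eq h₁⟩

/-- A locally constant function that separates components induces an injection on the set of
components. -/
theorem exists_map_connectedComponents {X C : Type*} [TopologicalSpace X] {Φ : X → C}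
    (h : IsLocallyConstant Φ)
    (h' : ∀ x y, Φ x = Φ y → ConnectedComponents.mk x = ConnectedComponents.mk y) :
    ∃ Ψ : ConnectedComponents X → C, (∀ x, Ψ (ConnectedComponents.mk x) = Φ x) ∧
      Function.Injective Ψ ∧ Set.range Ψ = Set.range Φ := by
  have surj := ConnectedComponents.surjective_coe (α := X)
  have key : ∀ x, Φ (Function.surjInv surj (ConnectedComponents.mk x)) = Φ x := fun x =>
    h.apply_eq_of_isPreconnected isPreconnected_connectedComponent
      (ConnectedComponents.coe_eq_coe'.mp (Function.surjInv_eq surj _)) mem_connectedComponent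
  refine ⟨fun c => Φ (Function.surjInv surj c), key, fun c d e => ?_, ?_⟩
  · obtain ⟨x, rfl⟩ := surj c
    obtain ⟨y, rfl⟩ := surj d
    simp only [key] at e
    exact h' x y e
  · ext c
    constructor
    · rintro ⟨d, rfl⟩; exact ⟨_, rfl⟩
    · rintro ⟨x, rfl⟩; exact ⟨_, key x⟩

/-! ### Holonomy of labellings -/

@[simp] theorem act_of (c : Move) (y : T.Flag) : T.act (.of c) y = T.move c y := by
  simp [act]

@[simp] theorem act_of_inv (c : Move) (y : T.Flag) : T.act (FreeGroup.of c)⁻¹ y = T.move c y := by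
  simp only [map_inv, act, FreeGroup.lift_apply_of]
  rfl

@[simp] theorem act_mul (v w : FreeGroup Move) (y : T.Flag) :
    T.act (v * w) y = T.act v (T.act w y) := by
  rw [map_mul, Equiv.Perm.mul_apply]

theorem act_inv_act (w : FreeGroup Move) (y : T.Flag) : T.act w⁻¹ (T.act w y) = y := by
  rw [← act_mul]; simp

theorem act_act_inv (w : FreeGroup Move) (y : T.Flag) : T.act w (T.act w⁻¹ y) = y := by
  rw [← act_mul]; simp

theorem mem_loops {x : T.Flag} {w : FreeGroup Move} : w ∈ T.loops x ↔ T.act w x = x := Iff.rfl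

namespace Labelling

section

variable {A : Type} [Group A] (L : T.Labelling A)

theorem lift_transport (w : FreeGroup Move) (y : T.Flag) (a : A) :
    FreeGroup.lift L.transport w (y, a) = (T.act w y, L.hol w y * a) := by
  induction w using FreeGroup.induction_on generalizing y a with
  | C1 => simp [hol]
  | of c => simp [hol, transport]
  | inv_of c _ =>
    simp only [hol, map_inv, FreeGroup.lift_apply_of]
    refine Prod.ext ?_ ?_
    · exact (act_of_inv c y).symm
    · change L.label c y * a = L.label c y * 1 * a
      rw [mul_one]
  | mul v w hv hw =>
    have e : L.hol (v * w) y = L.hol v (T.act w y) * L.hol w y := by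
      rw [hol, map_mul, Equiv.Perm.mul_apply, hw, hv, mul_one]
    rw [map_mul, Equiv.Perm.mul_apply, hw, hv, e, act_mul, mul_assoc]

theorem hol_mul (v w : FreeGroup Move) (y : T.Flag) :
    L.hol (v * w) y = L.hol v (T.act w y) * L.hol w y := by
  rw [hol, map_mul, Equiv.Perm.mul_apply, L.lift_transport, L.lift_transport, mul_one]

@[simp] theorem hol_one (y : T.Flag) : L.hol 1 y = 1 := by simp [hol]

@[simp] theorem hol_of (c : Move) (y : T.Flag) : L.hol (.of c) y = L.label c y := by
  simp [hol, transport]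

@[simp] theorem hol_of_inv (c : Move) (y : T.Flag) : L.hol (FreeGroup.of c)⁻¹ y = L.label c y := by
  simp only [hol, map_inv, FreeGroup.lift_apply_of]
  exact mul_one _

theorem hol_inv (w : FreeGroup Move) (y : T.Flag) :
    L.hol w⁻¹ (T.act w y) = (L.hol w y)⁻¹ := by
  rw [eq_inv_iff_mul_eq_one, ← hol_mul, inv_mul_cancel, hol_one]

theorem hol_conj {w b : FreeGroup Move} {y : T.Flag} (h : T.act b (T.act w y) = T.act w y) :
    L.hol (w⁻¹ * b * w) y = (L.hol w y)⁻¹ * L.hol b (T.act w y) * L.hol w y := by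
  rw [hol_mul, hol_mul, h, hol_inv]

theorem hol_largeHexagonWord (y : T.Flag) :
    L.hol largeHexagonWord y =
      L.label .medium (T.move .long (T.move .medium (T.move .long (T.move .medium (T.move .long y))))) *
      L.label .long (T.move .medium (T.move .long (T.move .medium (T.move .long y)))) *
      (L.label .medium (T.move .long (T.move .medium (T.move .long y))) *
      L.label .long (T.move .medium (T.move .long y))) *
      (L.label .medium (T.move .long y) * L.label .long y) := by
  simp only [largeHexagonWord, pow_succ, pow_zero, one_mul, hol_mul, act_mul, act_of, hol_of]

theorem hol_rectangleWord (y : T.Flag) :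
    L.hol rectangleWord y =
      L.label .short (T.move .long (T.move .short (T.move .long y))) *
      L.label .long (T.move .short (T.move .long y)) *
      (L.label .short (T.move .long y) * L.label .long y) := by
  simp only [rectangleWord, pow_succ, pow_zero, one_mul, hol_mul, act_mul, act_of, hol_of]

theorem hol_boundaryHexagonWord (y : T.Flag) :
    L.hol boundaryHexagonWord y =
      L.label .short (T.move .medium (T.move .short (T.move .medium (T.move .short (T.move .medium y))))) *
      L.label .medium (T.move .short (T.move .medium (T.move .short (T.move .medium y)))) *
      (L.label .short (T.move .medium (T.move .short (T.move .medium y))) *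
      L.label .medium (T.move .short (T.move .medium y))) *
      (L.label .short (T.move .medium y) * L.label .medium y) := by
  simp only [boundaryHexagonWord, pow_succ, pow_zero, one_mul, hol_mul, act_mul, act_of, hol_of]

/-- The image of a labelling under a homomorphism. -/
def map {B : Type} [Group B] (φ : A →* B) : T.Labelling B where
  label c y := φ (L.label c y)
  reverse c y := by rw [L.reverse, map_inv]
  glue y := by rw [L.glue, map_one]
  long_glue y := by rw [L.long_glue]
  medium_glue y := by rw [L.medium_glue]

@[simp] theorem hol_map {B : Type} [Group B] (φ : A →* B) (w : FreeGroup Move) (y : T.Flag) :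
    (L.map φ).hol w y = φ (L.hol w y) := by
  induction w using FreeGroup.induction_on generalizing y with
  | C1 => simp
  | of c => simp [map]
  | inv_of c _ => simp [map]
  | mul v w hv hw => rw [hol_mul, hv, hw, hol_mul, map_mul]

theorem eq_of_label_eq {L L' : T.Labelling A} (h : L.label = L'.label) : L = L' := by
  cases L; cases L'; cases h; rfl

/-- A labelling with trivial holonomy around all contracted paths determines a representation. -/
theorem exists_monodromy (h : ∀ y r, T.Contracted y r → L.hol r y = 1) (x : T.Flag) :
    ∃ ρ : T.FundGroup x →* A, ∀ w : T.loops x, ρ (QuotientGroup.mk w) = L.hol w x := by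
  let φ : T.loops x →* A :=
    { toFun := fun w => L.hol w x
      map_one' := L.hol_one x
      map_mul' := fun v w => by
        rw [Subgroup.coe_mul, hol_mul, mem_loops.mp w.2] }
  refine ⟨QuotientGroup.lift _ φ ?_, fun w => rfl⟩
  refine Subgroup.normalClosure_le_normal ?_
  rintro l ⟨w, r, hr, hl⟩
  have e := mem_loops.mp l.2
  rw [hl, mul_assoc, act_mul, act_mul] at e
  have e' : T.act r (T.act w x) = T.act w x := by
    conv_rhs => rw [← e]
    rw [act_act_inv]
  change L.hol l x = 1
  rw [hl, hol_conj _ e', h _ _ hr, mul_one, inv_mul_cancel]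

/-- If the holonomy along closed paths with moves in `H` is trivial, then the labelling is the
coboundary of a function on the flags. -/
theorem exists_gauge (H : Subgroup (FreeGroup Move))
    (h : ∀ y, ∀ b ∈ H, T.act b y = y → L.hol b y = 1) :
    ∃ θ : T.Flag → A, ∀ c, .of c ∈ H → ∀ y, L.label c y = θ (T.move c y) * (θ y)⁻¹ := by
  let s : Setoid T.Flag :=
    { r := fun y y' => ∃ b ∈ H, T.act b y = y'
      iseqv := ⟨fun y => ⟨1, H.one_mem, by simp⟩, fun {y y'} ⟨b, hb, e⟩ =>
        ⟨b⁻¹, H.inv_mem hb, by rw [← e, act_inv_act]⟩, fun {y y' y''} ⟨b, hb, e⟩ ⟨b', hb', e'⟩ =>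
        ⟨b' * b, H.mul_mem hb' hb, by rw [act_mul, e, e']⟩⟩ }
  have ex : ∀ y, ∃ b ∈ H, T.act b (Quotient.mk s y).out = y := fun y => Quotient.mk_out (s := s) y
  choose w hw hwy using ex
  -- Holonomy from the chosen flag of the orbit under `H`; its independence of the path is the
  -- triviality of closed paths.
  refine ⟨fun y => L.hol (w y) (Quotient.mk s y).out, fun c hc y => ?_⟩
  have e : Quotient.mk s (T.move c y) = Quotient.mk s y :=
    (Quotient.sound ⟨.of c, hc, act_of c y⟩ : Quotient.mk s y = _).symm
  have hy := hwy (T.move c y)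
  simp only [e] at hy ⊢
  set z := (Quotient.mk s y).out
  have key := h z ((w (T.move c y))⁻¹ * (.of c * w y))
    (H.mul_mem (H.inv_mem (hw _)) (H.mul_mem hc (hw _)))
    (by
      have := act_inv_act (w (T.move c y)) z
      rw [hy] at this
      rw [act_mul, act_mul, hwy, act_of, this])
  rw [hol_mul, hol_mul, act_mul, hwy, act_of, hol_of] at key
  have e' := L.hol_inv (w (T.move c y)) z
  rw [hy] at e'
  rw [e', ← mul_assoc, mul_eq_one_iff_eq_inv, inv_mul_eq_iff_eq_mul] at key
  exact key

end

end Labelling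

/-! ### Connectedness -/

theorem exists_act_eq
    (hT : ∀ s t : Fin N, Relation.ReflTransGen (fun a b => ∃ f, T.adj a f = b) s t)
    (x y : T.Flag) : ∃ w, T.act w x = y := by
  have same : ∀ {y y' : T.Flag}, y'.1 = y.1 → ∃ w, T.act w y = y' := by
    intro y y' h
    refine cell_invariant (P := fun y' => ∃ w, T.act w y = y') (fun c _ z ⟨w, hw⟩ =>
      ⟨.of c * w, by simp [hw]⟩) (cell_eq_of_tetrahedron h) ⟨1, by simp⟩
  have key : ∀ t, ∃ w, (T.act w x).1 = t := by
    intro t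
    induction hT x.1 t with
    | refl => exact ⟨1, by simp⟩
    | tail _ h ih =>
      obtain ⟨w, hw⟩ := ih
      obtain ⟨f, hf⟩ := h
      obtain ⟨v, hv⟩ := same (y := T.act w x) (y' := ((T.act w x).1, Equiv.swap 3 f)) rfl
      refine ⟨.of .glue * (v * w), ?_⟩
      rw [act_mul, act_mul, hv, act_of]
      simp [move, hw, hf]
  obtain ⟨w, hw⟩ := key y.1
  obtain ⟨v, hv⟩ := same hw.symm
  exact ⟨v * w, by rw [act_mul, hv]⟩

/-! ### The kernel of `SL(2, ℂ) → PSL(2, ℂ)` -/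

theorem central_zero : central 0 = 1 := by simp [central]

theorem central_one : central 1 = -1 := by simp [central, ZMod.val_one]

theorem central_eq (a : ZMod 2) : central a = 1 ∨ central a = -1 := by
  have : ∀ a : ZMod 2, a = 0 ∨ a = 1 := by decide
  rcases this a with rfl | rfl
  · exact .inl central_zero
  · exact .inr central_one

theorem central_add (a b : ZMod 2) : central (a + b) = central a * central b := by
  have : ∀ a : ZMod 2, a = 0 ∨ a = 1 := by decide
  rcases this a with rfl | rfl <;> rcases this b with rfl | rfl
  · simp [central_zero]
  · simp [central_zero]
  · simp [central_zero]
  · rw [show (1 : ZMod 2) + 1 = 0 from rfl, central_one, central_zero]; simp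

theorem central_mul_comm (a : ZMod 2) (X : SL(2, ℂ)) : central a * X = X * central a := by
  rcases central_eq a with h | h <;> simp [h]

theorem central_injective : Function.Injective central := by
  have ne : (1 : SL(2, ℂ)) ≠ -1 := by
    intro h
    have := congrArg (fun X : SL(2, ℂ) => X 0 0) h
    norm_num at this
  have : ∀ a : ZMod 2, a = 0 ∨ a = 1 := by decide
  intro a b h
  rcases this a with rfl | rfl <;> rcases this b with rfl | rfl
  · rfl
  · rw [central_one, central_zero] at h; exact absurd h ne
  · rw [central_one, central_zero] at h; exact absurd h.symm ne
  · rfl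

theorem central_inv (a : ZMod 2) : (central a)⁻¹ = central a := by
  rcases central_eq a with h | h <;> simp [h]

theorem mk_central (a : ZMod 2) : (QuotientGroup.mk (central a) : PSL(2, ℂ)) = 1 := by
  rw [QuotientGroup.eq_one_iff, Subgroup.mem_center_iff]
  exact fun X => (central_mul_comm a X).symm

theorem mk_eq_mk_iff {X Y : SL(2, ℂ)} :
    (QuotientGroup.mk X : PSL(2, ℂ)) = QuotientGroup.mk Y ↔ ∃ a, X = central a * Y := by
  constructor
  · intro h
    have h' : X * Y⁻¹ ∈ Subgroup.center SL(2, ℂ) := by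
      rw [← QuotientGroup.eq_one_iff, QuotientGroup.mk_mul, QuotientGroup.mk_inv, h, mul_inv_cancel]
    obtain ⟨r, hr, e⟩ := Matrix.SpecialLinearGroup.mem_center_iff.mp h'
    rw [Fintype.card_fin, sq_eq_one_iff] at hr
    rcases hr with rfl | rfl
    · refine ⟨0, ?_⟩
      rw [central_zero, ← mul_inv_eq_iff_eq_mul]
      exact Subtype.ext (by rw [← e]; simp)
    · refine ⟨1, ?_⟩
      rw [central_one, ← mul_inv_eq_iff_eq_mul]
      exact Subtype.ext (by
        rw [← e]
        ext i j
        fin_cases i <;> fin_cases j <;> simp)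
  · rintro ⟨a, rfl⟩
    rw [QuotientGroup.mk_mul, mk_central, one_mul]

/-! ### Uniqueness of the obstruction class -/

/-- The products of the labels around the 2-cells are given by the cochain `σ`. -/
structure HasCurvature (L : T.Labelling SL(2, ℂ)) (σ : T.C2) : Prop where
  largeHexagon : ∀ y, L.hol largeHexagonWord y = central (σ.1.1 (cell _ y))
  rectangle : ∀ y, L.hol rectangleWord y = central (σ.1.2 (cell _ y))
  boundaryHexagon : ∀ y, L.hol boundaryHexagonWord y = central (σ.2.1 (cell _ y))
  edgeDisc : ∀ y, L.hol (T.edgeDiscWord y) y = central (σ.2.2 (cell _ y))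

theorem IsLift.hasCurvature {x : T.Flag} {ρ : T.FundGroup x →* PSL(2, ℂ)}
    {L : T.Labelling SL(2, ℂ)} {σ : T.C2} (h : T.IsLift ρ L σ) : HasCurvature L σ :=
  ⟨h.largeHexagon, h.rectangle, h.boundaryHexagon, h.edgeDisc⟩

theorem act_rot_pow (n : ℕ) (y : T.Flag) : T.act ((.of .short * .of .glue) ^ n) y = T.rot^[n] y := by
  induction n with
  | zero => simp
  | succ n ih => rw [pow_succ', act_mul, ih, act_mul, act_of, act_of, Function.iterate_succ_apply']; rfl

theorem act_edgeDiscWord (y : T.Flag) : T.act (T.edgeDiscWord y) y = y := by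
  rw [edgeDiscWord, act_rot_pow]
  exact Function.iterate_minimalPeriod (f := T.rot)

theorem act_largeHexagonWord (y : T.Flag) : T.act largeHexagonWord y = y := by
  simp [largeHexagonWord, pow_succ, long_medium_long, move_move]

theorem act_rectangleWord (y : T.Flag) : T.act rectangleWord y = y := by
  simp [rectangleWord, pow_succ, short_long, move_move]

theorem act_boundaryHexagonWord (y : T.Flag) : T.act boundaryHexagonWord y = y := by
  simp [boundaryHexagonWord, pow_succ, short_medium_short, move_move]

section

variable (E : T.Labelling (Multiplicative (ZMod 2)))

/-- The 1-cochain given by a labelling by elements of `𝔽₂`. -/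
def Labelling.cochain : T.C1 :=
  (liftCell _ (fun y => (E.label .long y).toAdd) (by
    intro c hc y
    obtain rfl | rfl : c = .long ∨ c = .glue := by simpa using hc
    · rw [E.reverse]; exact CharTwo.neg_eq _
    · rw [E.long_glue]),
   liftCell _ (fun y => (E.label .medium y).toAdd) (by
    intro c hc y
    obtain rfl | rfl : c = .medium ∨ c = .glue := by simpa using hc
    · rw [E.reverse]; exact CharTwo.neg_eq _
    · rw [E.medium_glue]),
   liftCell _ (fun y => (E.label .short y).toAdd) (by
    intro c hc y
    obtain rfl : c = .short := by simpa using hc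
    rw [E.reverse]; exact CharTwo.neg_eq _))

theorem label_move_zmod (c : Move) (y : T.Flag) :
    (E.label c (T.move c y)).toAdd = (E.label c y).toAdd := by
  rw [E.reverse]; exact CharTwo.neg_eq _

theorem d1_cochain_largeHexagon (y : T.Flag) :
    (T.d1 E.cochain).1.1 (cell _ y) = (E.hol largeHexagonWord y).toAdd := by
  rw [d1_largeHexagon, E.hol_largeHexagonWord]
  simp only [Labelling.cochain, liftCell_cell, toAdd_mul, long_medium_long, move_move,
    label_move_zmod]
  abel

theorem d1_cochain_rectangle (y : T.Flag) :
    (T.d1 E.cochain).1.2 (cell _ y) = (E.hol rectangleWord y).toAdd := by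
  rw [d1_rectangle, E.hol_rectangleWord]
  simp only [Labelling.cochain, liftCell_cell, toAdd_mul, short_long, move_move,
    label_move_zmod]
  abel

theorem d1_cochain_boundaryHexagon (y : T.Flag) :
    (T.d1 E.cochain).2.1 (cell _ y) = (E.hol boundaryHexagonWord y).toAdd := by
  have e : (E.label .short (T.move .medium (T.move .short (T.move .medium y)))).toAdd =
      (E.label .short (T.move .medium (T.move .short y))).toAdd := by
    rw [← short_medium_short, label_move_zmod]
  rw [d1_snd, d1bd_boundaryHexagon, E.hol_boundaryHexagonWord]
  simp only [Labelling.cochain, liftCell_cell, toAdd_mul, short_medium_short, move_move,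
    label_move_zmod, e]
  abel

theorem hol_rot_pow (n : ℕ) (y : T.Flag) :
    (E.hol ((.of .short * .of .glue) ^ n) y).toAdd =
      ∑ i ∈ Finset.range n, (E.label .short (T.move .glue (T.rot^[i] y))).toAdd := by
  induction n with
  | zero => simp
  | succ n ih =>
    rw [pow_succ', E.hol_mul, toAdd_mul, ih, act_rot_pow, E.hol_mul, E.hol_of, E.hol_of, act_of,
      E.glue, mul_one, Finset.sum_range_succ, add_comm]

theorem d1_cochain_edgeDisc (y : T.Flag) :
    (T.d1 E.cochain).2.2 (cell _ y) = (E.hol (T.edgeDiscWord y) y).toAdd := by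
  classical
  rw [d1_snd, d1bd_edgeDisc, edgeDiscWord, hol_rot_pow, ← sum_minimalPeriod]
  rfl

end

/-- Two labellings are related by the gauge transformation `U`, up to the signs given by `E`. -/
structure IsGauge (L L' : T.Labelling SL(2, ℂ)) (E : T.Labelling (Multiplicative (ZMod 2)))
    (U : T.Flag → SL(2, ℂ)) : Prop where
  glue : ∀ y, U (T.move .glue y) = U y
  label : ∀ c y, L.label c y =
    central (E.label c y).toAdd * (U (T.move c y) * L'.label c y * (U y)⁻¹)

section

variable {L L' : T.Labelling SL(2, ℂ)} {E : T.Labelling (Multiplicative (ZMod 2))}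
  {U : T.Flag → SL(2, ℂ)}

theorem IsGauge.hol (h : IsGauge L L' E U) (w : FreeGroup Move) (y : T.Flag) :
    L.hol w y = central (E.hol w y).toAdd * (U (T.act w y) * L'.hol w y * (U y)⁻¹) := by
  induction w using FreeGroup.induction_on generalizing y with
  | C1 => simp [central_zero]
  | of c => simpa using h.label c y
  | inv_of c _ => simpa only [Labelling.hol_of_inv, act_of_inv] using h.label c y
  | mul v w hv hw =>
    rw [L.hol_mul, hv, hw, L'.hol_mul, E.hol_mul, toAdd_mul, central_add, act_mul]
    generalize (E.hol v (T.act w y)).toAdd = a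
    generalize (E.hol w y).toAdd = b
    rcases central_eq a with ha | ha <;> rcases central_eq b with hb | hb <;>
      simp [ha, hb, mul_assoc]

/-- Around a closed path the gauge transformation conjugates a central element and disappears, so
the signs measure the difference of the curvatures. -/
theorem IsGauge.curvature (h : IsGauge L L' E U) {w : FreeGroup Move} {y : T.Flag}
    (hw : T.act w y = y) {a a' : ZMod 2} (ha : L.hol w y = central a)
    (ha' : L'.hol w y = central a') : (E.hol w y).toAdd = a - a' := by
  have := h.hol w y
  rw [ha, ha', hw, ← central_mul_comm, mul_assoc, mul_inv_cancel, mul_one, ← central_add] at this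
  rw [central_injective this, add_sub_cancel_right]

theorem IsGauge.d1_cochain (h : IsGauge L L' E U) {σ σ' : T.C2} (hσ : HasCurvature L σ)
    (hσ' : HasCurvature L' σ') : T.d1 E.cochain = σ - σ' := by
  ext Y
  all_goals obtain ⟨y, rfl⟩ := exists_cell Y
  · rw [d1_cochain_largeHexagon, h.curvature (act_largeHexagonWord y) (hσ.largeHexagon y)
      (hσ'.largeHexagon y)]
    rfl
  · rw [d1_cochain_rectangle, h.curvature (act_rectangleWord y) (hσ.rectangle y)
      (hσ'.rectangle y)]
    rfl
  · rw [d1_cochain_boundaryHexagon, h.curvature (act_boundaryHexagonWord y) (hσ.boundaryHexagon y)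
      (hσ'.boundaryHexagon y)]
    rfl
  · rw [d1_cochain_edgeDisc, h.curvature (act_edgeDiscWord y) (hσ.edgeDisc y)
      (hσ'.edgeDisc y)]
    rfl

/-- A gauge transformation up to signs is determined by a gauge transformation in `PSL(2, ℂ)`. -/
theorem exists_isGauge_of_mk {u : T.Flag → PSL(2, ℂ)} (h : ∀ c y, (QuotientGroup.mk (L.label c y) :
    PSL(2, ℂ)) = u (T.move c y) * QuotientGroup.mk (L'.label c y) * (u y)⁻¹) :
    ∃ E U, IsGauge L L' E U := by
  have surj : Function.Surjective (QuotientGroup.mk : SL(2, ℂ) → PSL(2, ℂ)) :=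
    QuotientGroup.mk_surjective
  -- The lift depends on the flag only through `u y`, so it inherits invariance under `glue`.
  let U : T.Flag → SL(2, ℂ) := fun y => Function.surjInv surj (u y)
  have hU : ∀ y, (QuotientGroup.mk (U y) : PSL(2, ℂ)) = u y := fun y => Function.surjInv_eq surj _
  have hg : ∀ y, U (T.move .glue y) = U y := fun y => by
    have := h .glue y
    rw [L.glue, L'.glue, QuotientGroup.mk_one, mul_one, eq_comm, mul_inv_eq_one] at this
    simp only [U, this]
  have ex : ∀ c y, ∃ a, L.label c y = central a * (U (T.move c y) * L'.label c y * (U y)⁻¹) :=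
    fun c y => mk_eq_mk_iff.mp (by rw [h, QuotientGroup.mk_mul, QuotientGroup.mk_mul,
      QuotientGroup.mk_inv, hU, hU])
  choose ε hε using ex
  have uniq : ∀ {c y c' y'}, L.label c y = L.label c' y' → L'.label c y = L'.label c' y' →
      U y = U y' → U (T.move c y) = U (T.move c' y') → ε c y = ε c' y' := by
    intro c y c' y' h₁ h₂ h₃ h₄
    rw [hε c y, hε c' y', h₂, h₃, h₄] at h₁
    exact central_injective (mul_right_cancel h₁)
  refine ⟨⟨fun c y => .ofAdd (ε c y), fun c y => ?_, fun y => ?_, fun y => ?_, fun y => ?_⟩, U, hg,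
    hε⟩
  · have e := hε c (T.move c y)
    rw [L.reverse, hε c y, L'.reverse, move_move, mul_inv_rev, central_inv, mul_inv_rev, inv_inv,
      mul_inv_rev, ← central_mul_comm, ← mul_assoc (U y)] at e
    rw [← central_injective (mul_right_cancel e), ← ofAdd_neg, CharTwo.neg_eq]
  · have e := hε .glue y
    rw [L.glue, L'.glue, hg, mul_one, mul_inv_cancel, mul_one, ← central_zero] at e
    rw [← central_injective e]; rfl
  · exact congrArg _ (uniq (L.long_glue y) (L'.long_glue y) (hg y) (by rw [← glue_long, hg]))
  · exact congrArg _ (uniq (L.medium_glue y) (L'.medium_glue y) (hg y) (by rw [← glue_medium, hg]))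

/-- Two lifts of the same representation are related by a gauge transformation. -/
theorem exists_isGauge (hT : T.IsIdealTriangulation) {x : T.Flag} {ρ : T.FundGroup x →* PSL(2, ℂ)}
    {σ σ' : T.C2} (h : T.IsLift ρ L σ) (h' : T.IsLift ρ L' σ') : ∃ E U, IsGauge L L' E U := by
  obtain ⟨g, hg⟩ := h.monodromy
  obtain ⟨g', hg'⟩ := h'.monodromy
  choose w hw using exists_act_eq hT.connected x
  let p := fun v => (QuotientGroup.mk (L.hol v x) : PSL(2, ℂ))
  let p' := fun v => (QuotientGroup.mk (L'.hol v x) : PSL(2, ℂ))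
  have conj : ∀ v ∈ T.loops x, p v = (g⁻¹ * g') * p' v * (g⁻¹ * g')⁻¹ := fun v hv => by
    have := (hg ⟨v, hv⟩).symm.trans (hg' ⟨v, hv⟩)
    change g * p v * g⁻¹ = g' * p' v * g'⁻¹ at this
    rw [mul_inv_eq_iff_eq_mul, ← eq_inv_mul_iff_mul_eq] at this
    rw [this]; group
  -- Transport from the base flag in one labelling, the conjugation that matches the two
  -- monodromies, and transport back in the other. Independence of the chosen path `w y` is the
  -- equality `conj` on loops.
  refine exists_isGauge_of_mk (u := fun y => p (w y) * (g⁻¹ * g') * (p' (w y))⁻¹) fun c y => ?_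
  have loop : T.act ((w (T.move c y))⁻¹ * (.of c * w y)) x = x := by
    have := act_inv_act (w (T.move c y)) x
    rw [hw] at this
    rw [act_mul, act_mul, hw, act_of, this]
  have expand : ∀ M : T.Labelling SL(2, ℂ), M.hol ((w (T.move c y))⁻¹ * (.of c * w y)) x =
      (M.hol (w (T.move c y)) x)⁻¹ * (M.label c y * M.hol (w y) x) := fun M => by
    have := M.hol_inv (w (T.move c y)) x
    rw [hw] at this
    rw [M.hol_mul, M.hol_mul, act_mul, hw, act_of, M.hol_of, this]
  have key := conj _ loop
  simp only [p, p', expand, QuotientGroup.mk_mul, QuotientGroup.mk_inv] at key ⊢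
  rw [inv_mul_eq_iff_eq_mul, ← eq_mul_inv_iff_mul_eq] at key
  rw [key]
  group

theorem IsLift.sub_mem_B2 (hT : T.IsIdealTriangulation) {x : T.Flag}
    {ρ : T.FundGroup x →* PSL(2, ℂ)} {σ σ' : T.C2} (h : T.IsLift ρ L σ) (h' : T.IsLift ρ L' σ') :
    σ - σ' ∈ T.B2 := by
  obtain ⟨E, U, hE⟩ := exists_isGauge hT h h'
  exact ⟨_, hE.d1_cochain h.hasCurvature h'.hasCurvature⟩

/-- A sign at each flag may be moved from the sign labelling into the gauge transformation. -/
theorem IsGauge.change (h : IsGauge L L' E U) {θ : T.Flag → Multiplicative (ZMod 2)}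
    (hθ : ∀ y, θ (T.move .glue y) = θ y) :
    ∃ (E' : T.Labelling (Multiplicative (ZMod 2))) (U' : T.Flag → SL(2, ℂ)), IsGauge L L' E' U' ∧
      ∀ c y, E'.label c y = E.label c y * (θ (T.move c y) * (θ y)⁻¹)⁻¹ := by
  refine ⟨⟨fun c y => E.label c y * (θ (T.move c y) * (θ y)⁻¹)⁻¹, fun c y => ?_, fun y => ?_,
    fun y => ?_, fun y => ?_⟩, fun y => central (θ y).toAdd * U y, ⟨fun y => ?_, fun c y => ?_⟩,
    fun _ _ => rfl⟩
  · rw [E.reverse, move_move, ← mul_inv]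
    congr 2
    rw [mul_inv, inv_inv, mul_comm]
  · rw [E.glue, hθ, mul_inv_cancel, inv_one, one_mul]
  · rw [E.long_glue, ← glue_long, hθ, hθ]
  · rw [E.medium_glue, ← glue_medium, hθ, hθ]
  · simp only [hθ, h.glue]
  · rw [h.label]
    rcases central_eq (θ (T.move c y)).toAdd with h₁ | h₁ <;>
      rcases central_eq (θ y).toAdd with h₂ | h₂ <;>
      rcases central_eq (E.label c y).toAdd with h₃ | h₃ <;>
      simp [central_add, h₁, h₂, h₃]

theorem trace_unipotent (b : ℂ) : (unipotent b : Matrix (Fin 2) (Fin 2) ℂ).trace = 2 := by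
  simp [unipotent, Matrix.trace_fin_two]; norm_num

theorem trace_conj (g X : SL(2, ℂ)) :
    ((g * X * g⁻¹ : SL(2, ℂ)) : Matrix (Fin 2) (Fin 2) ℂ).trace =
      (X : Matrix (Fin 2) (Fin 2) ℂ).trace := by
  rw [Matrix.SpecialLinearGroup.coe_mul, Matrix.trace_mul_comm, ← Matrix.SpecialLinearGroup.coe_mul,
    ← mul_assoc, inv_mul_cancel, one_mul]

theorem IsBoundaryUnipotent.trace (h : T.IsBoundaryUnipotent L) {y : T.Flag} {b : FreeGroup Move}
    (hb : b ∈ boundaryWords) (hy : T.act b y = y) :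
    (L.hol b y : Matrix (Fin 2) (Fin 2) ℂ).trace = 2 := by
  obtain ⟨g, hg⟩ := h y
  obtain ⟨c, hc⟩ := hg b hb hy
  rw [← trace_conj g, hc, trace_unipotent]

theorem IsLift.sub_mem_B2rel (hT : T.IsIdealTriangulation) {x : T.Flag}
    {ρ : T.FundGroup x →* PSL(2, ℂ)} {σ σ' : T.C2rel} (h : T.IsLift ρ L (σ, 0))
    (h' : T.IsLift ρ L' (σ', 0)) (hu : T.IsBoundaryUnipotent L) (hu' : T.IsBoundaryUnipotent L') :
    σ - σ' ∈ T.B2rel := by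
  obtain ⟨E, U, hE⟩ := exists_isGauge hT h h'
  -- Unipotent monodromies have trace 2, and a sign -1 would turn this into -2. So the signs have
  -- trivial boundary holonomy and can be gauged away on the boundary, leaving a relative cochain.
  obtain ⟨θ, hθ⟩ := E.exists_gauge boundaryWords fun y b hb hy => by
    have e := hE.hol b y
    have t := hu.trace hb hy
    rw [e, hy] at t
    rcases central_eq (E.hol b y).toAdd with h | h
    · rw [← central_zero] at h
      exact Multiplicative.toAdd.injective (central_injective h)
    · rw [h, neg_one_mul, Matrix.SpecialLinearGroup.coe_neg, Matrix.trace_neg, trace_conj,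
        hu'.trace hb hy] at t
      norm_num at t
  have mem : ∀ c ∈ [Move.medium, .short, .glue], FreeGroup.of c ∈ boundaryWords := fun c hc => by
    refine Subgroup.subset_closure ?_
    simp only [List.mem_cons, List.not_mem_nil, or_false] at hc
    rcases hc with rfl | rfl | rfl <;> simp
  have hg : ∀ y, θ (T.move .glue y) = θ y := fun y => by
    have := hθ .glue (mem _ (by simp)) y
    rw [E.glue, eq_comm, mul_inv_eq_one] at this
    exact this
  obtain ⟨E', U', hE', h₁⟩ := hE.change hg
  have triv : ∀ c, FreeGroup.of c ∈ boundaryWords → ∀ y, E'.label c y = 1 := fun c hc y => by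
    rw [h₁, ← hθ c hc, mul_inv_cancel]
  refine mem_B2rel_iff.mpr ⟨E'.cochain, ?_, ?_⟩
  · ext Y
    all_goals
      obtain ⟨y, rfl⟩ := exists_cell Y
      simp [Labelling.cochain, triv _ (mem .medium (by simp)), triv _ (mem .short (by simp))]
  · rw [hE'.d1_cochain h.hasCurvature h'.hasCurvature, Prod.mk_sub_mk, sub_zero]

end

/-! ### Matrices -/

/-- The matrix with rows `(u⁻¹, b)` and `(0, u)`. -/
noncomputable def upper (u : ℂˣ) (b : ℂ) : SL(2, ℂ) :=
  ⟨!![((u⁻¹ : ℂˣ) : ℂ), b; 0, u], by simp [Matrix.det_fin_two]⟩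

/-- The matrix with rows `(0, u)` and `(-u⁻¹, 0)`. -/
noncomputable def antidiag (u : ℂˣ) : SL(2, ℂ) :=
  ⟨!![0, (u : ℂ); -((u⁻¹ : ℂˣ) : ℂ), 0], by simp [Matrix.det_fin_two]⟩

theorem coe_upper (u : ℂˣ) (b : ℂ) :
    (upper u b : Matrix (Fin 2) (Fin 2) ℂ) = !![((u⁻¹ : ℂˣ) : ℂ), b; 0, u] := rfl

theorem coe_antidiag (u : ℂˣ) :
    (antidiag u : Matrix (Fin 2) (Fin 2) ℂ) = !![0, (u : ℂ); -((u⁻¹ : ℂˣ) : ℂ), 0] := rfl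

theorem upper_mul_upper (u v : ℂˣ) (b c : ℂ) :
    upper u b * upper v c = upper (u * v) (((u⁻¹ : ℂˣ) : ℂ) * c + b * v) := by
  apply Subtype.ext
  rw [Matrix.SpecialLinearGroup.coe_mul, coe_upper, coe_upper, coe_upper]
  simp [mul_comm]

theorem upper_one_zero : upper 1 0 = 1 := by
  apply Subtype.ext
  ext i j
  fin_cases i <;> fin_cases j <;> simp [upper]

theorem upper_one (b : ℂ) : upper 1 b = unipotent b := by
  apply Subtype.ext
  ext i j
  fin_cases i <;> fin_cases j <;> simp [upper, unipotent]

theorem upper_inv (u : ℂˣ) (b : ℂ) : (upper u b)⁻¹ = upper u⁻¹ (-b) := by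
  rw [inv_eq_iff_mul_eq_one, upper_mul_upper, mul_inv_cancel, ← upper_one_zero]
  congr 1
  ring

theorem upper_neg_one : upper (-1) 0 = -1 := by
  apply Subtype.ext
  ext i j
  fin_cases i <;> fin_cases j <;> simp [upper]

theorem antidiag_inv (u : ℂˣ) : (antidiag u)⁻¹ = antidiag (-u) := by
  rw [inv_eq_iff_mul_eq_one]
  apply Subtype.ext
  rw [Matrix.SpecialLinearGroup.coe_mul, coe_antidiag, coe_antidiag, Matrix.SpecialLinearGroup.coe_one,
    Matrix.one_fin_two]
  simp

theorem antidiag_mul_upper_mul_antidiag (u v w : ℂˣ) :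
    antidiag u * (upper w 0 * antidiag v) = upper (-(u⁻¹ * v * w⁻¹)) 0 := by
  apply Subtype.ext
  rw [Matrix.SpecialLinearGroup.coe_mul, Matrix.SpecialLinearGroup.coe_mul, coe_antidiag,
    coe_antidiag, coe_upper, coe_upper]
  simp [mul_comm, mul_assoc, mul_left_comm]

theorem eq_or_eq_neg_of_sq {u v : ℂˣ} (h : u ^ 2 = v ^ 2) : u = v ∨ u = -v := by
  have : (u : ℂ) ^ 2 = (v : ℂ) ^ 2 := by exact_mod_cast h
  rcases sq_eq_sq_iff_eq_or_eq_neg.mp this with h | h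
  · exact .inl (Units.ext h)
  · exact .inr (Units.ext h)

theorem mk_upper_neg (u : ℂˣ) (b : ℂ) :
    (QuotientGroup.mk (upper (-u) (-b)) : PSL(2, ℂ)) = QuotientGroup.mk (upper u b) := by
  rw [mk_eq_mk_iff]
  refine ⟨1, ?_⟩
  rw [central_one, ← upper_neg_one, upper_mul_upper]
  simp

theorem mk_antidiag_neg (u : ℂˣ) :
    (QuotientGroup.mk (antidiag (-u)) : PSL(2, ℂ)) = QuotientGroup.mk (antidiag u) := by
  rw [mk_eq_mk_iff]
  refine ⟨1, ?_⟩
  rw [central_one, neg_one_mul]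
  apply Subtype.ext
  rw [Matrix.SpecialLinearGroup.coe_neg, coe_antidiag, coe_antidiag]
  simp

/-- The imaginary unit. -/
noncomputable def unitI : ℂˣ := Units.mk0 Complex.I Complex.I_ne_zero

theorem unitI_sq : unitI ^ 2 = -1 := by
  apply Units.ext; simp [unitI]

theorem mk_antidiag {u : ℂˣ} (h : u ^ 2 = -1) : (QuotientGroup.mk (antidiag u) : PSL(2, ℂ)) = mobInv := by
  have e : (QuotientGroup.mk (antidiag unitI) : PSL(2, ℂ)) = mobInv := by
    rw [mobInv]; congr 1; apply Subtype.ext; simp [antidiag, unitI]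
  rcases eq_or_eq_neg_of_sq (h.trans unitI_sq.symm) with rfl | rfl
  · exact e
  · rw [mk_antidiag_neg, e]

theorem mk_upper_self {u : ℂˣ} (h : u ^ 2 = -1) :
    (QuotientGroup.mk (upper u u) : PSL(2, ℂ)) = mobOneSub := by
  have e : (QuotientGroup.mk (upper unitI unitI) : PSL(2, ℂ)) = mobOneSub := by
    rw [mobOneSub]; congr 1; apply Subtype.ext; simp [upper, unitI]
  rcases eq_or_eq_neg_of_sq (h.trans unitI_sq.symm) with rfl | rfl
  · exact e
  · rw [Units.val_neg, mk_upper_neg, e]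

theorem mk_upper_zero {u : ℂˣ} {w : ℂ} (h : ((u ^ 2 : ℂˣ) : ℂ) = w⁻¹) :
    (QuotientGroup.mk (upper u 0) : PSL(2, ℂ)) = mobScale w := by
  have hw : w ≠ 0 := fun e => (u ^ 2).ne_zero (by rw [h, e, inv_zero])
  let v : ℂˣ := Units.mk0 (Complex.exp (-(Complex.log w / 2))) (Complex.exp_ne_zero _)
  have e : (QuotientGroup.mk (upper v 0) : PSL(2, ℂ)) = mobScale w := by
    rw [mobScale]; congr 1; apply Subtype.ext; simp [upper, v, Complex.exp_neg]
  have hv : u ^ 2 = v ^ 2 := by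
    apply Units.ext
    rw [h, Units.val_pow_eq_pow_val, Units.val_mk0, ← Complex.exp_nat_mul]
    push_cast
    rw [mul_neg, mul_div_cancel₀ _ two_ne_zero, Complex.exp_neg, Complex.exp_log hw]
  rcases eq_or_eq_neg_of_sq hv with rfl | rfl
  · exact e
  · rw [← e, ← mk_upper_neg v 0, neg_zero]

/-! ### Spin structures -/

variable (T) in
/-- Square roots of the spinor frames of the flags. -/
structure IsSpinStructure (α : T.Quad → ZMod 2) (e : T.Flag → ℂˣ) : Prop where
  pow_four : ∀ y, e y ^ 4 = -1
  long : ∀ y, e (T.move .long y) = (e y)⁻¹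
  medium : ∀ y, e (T.move .medium y) = (e y)⁻¹
  glue : ∀ y, e (T.move .glue y) = e y
  short : ∀ y, e (T.move .short y) ^ 2 = (-1) ^ (α (quadOf y)).val * e y ^ 2

theorem exists_pow_four : ∃ u : ℂˣ, u ^ 4 = -1 := by
  refine ⟨Units.mk0 (Complex.exp (Real.pi * Complex.I / 4)) (Complex.exp_ne_zero _), ?_⟩
  apply Units.ext
  rw [Units.val_pow_eq_pow_val, Units.val_mk0, ← Complex.exp_nat_mul]
  push_cast
  rw [show 4 * ((Real.pi : ℂ) * Complex.I / 4) = Real.pi * Complex.I by ring, Complex.exp_pi_mul_I]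

/-- Take an eighth root of unity or its inverse according to the parity of the flag plus the
co-orientation of its face. Both terms change under `glue`; only the parity changes under `long` and
`medium`; under `short` the total changes by `α`. -/
theorem exists_isSpinStructure {α : T.Quad → ZMod 2} (hα : α ∈ T.evenAngles) :
    ∃ e, T.IsSpinStructure α e := by
  obtain ⟨ρ, hρ, rfl⟩ := evenAngles_eq_turn hα
  obtain ⟨u, hu⟩ := exists_pow_four
  have hu' : u⁻¹ ^ 2 = -u ^ 2 := by
    rw [inv_pow, inv_eq_iff_mul_eq_one, mul_neg, ← pow_add, hu, neg_neg]
  let R : ZMod 2 → ℂˣ := fun a => if a = 0 then u else u⁻¹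
  have cases : ∀ a : ZMod 2, a = 0 ∨ a = 1 := by decide
  have R0 : R 0 = u := rfl
  have R1 : R 1 = u⁻¹ := rfl
  have one : (1 : ZMod 2) + 1 = 0 := rfl
  have hR : ∀ a, R (a + 1) = (R a)⁻¹ := fun a => by
    rcases cases a with rfl | rfl
    · rw [zero_add, R0, R1]
    · rw [one, R0, R1, inv_inv]
  let o : T.Flag → ZMod 2 := fun y => flagParity y + ρ y.1 (y.2 3)
  have ho : ∀ c, c = .long ∨ c = .medium → ∀ y, o (T.move c y) = o y + 1 := by
    rintro c hc y
    have : ρ (T.move c y).1 ((T.move c y).2 3) = ρ y.1 (y.2 3) := by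
      rcases hc with rfl | rfl <;> simp [move, Equiv.swap_apply_of_ne_of_ne]
    simp only [o, flagParity_move, this]
    abel
  refine ⟨fun y => R (o y), fun y => ?_, fun y => ?_, fun y => ?_, fun y => ?_, fun y => ?_⟩
  · rcases cases (o y) with h | h
    · rw [h, R0, hu]
    · rw [h, R1, inv_pow, hu, inv_neg, inv_one]
  · rw [ho _ (.inl rfl), hR]
  · rw [ho _ (.inr rfl), hR]
  · have : o (T.move .glue y) = o y := by
      simp only [o, flagParity_move]
      change _ + 1 + ρ (T.adj y.1 (y.2 3)) (T.gluing y.1 (y.2 3) (y.2 3)) = _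
      rw [hρ.glue]
      linear_combination one
    rw [this]
  · have : o (T.move .short y) = o y + turn ρ (quadOf y) := by
      simp only [o, flagParity_move, turn_quadOf hρ]
      have : ρ (T.move .short y).1 ((T.move .short y).2 3) = ρ y.1 (y.2 2) := by
        simp [move]
      rw [this]
      linear_combination -(ρ y.1 (y.2 3)) * one
    rw [this]
    rcases cases (turn ρ (quadOf y)) with h | h
    · rw [h, add_zero]; simp
    · rw [h, hR, ZMod.val_one, pow_one]
      rcases cases (o y) with h | h
      · rw [h, R0, hu', neg_one_mul]
      · rw [h, R1, inv_inv, hu', neg_one_mul, neg_neg]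

/-! ### Lifts of the shape labelling -/

variable (T) in
/-- Square roots of the moduli of the developed triangles at the ends. -/
structure IsShapeRoot (α : T.Quad → ZMod 2) (z : T.Quad → ℂ) (X : T.Flag → ℂˣ) : Prop where
  glue : ∀ y, X (T.move .glue y) = X y
  long : ∀ y, X (T.move .short (T.move .long y)) * X (T.move .short y) = X (T.move .long y) * X y
  triangle : ∀ y, X (T.move .short y) * X (T.move .short (T.move .medium (T.move .short y))) *
    X (T.move .medium y) = X y * X (T.move .medium (T.move .short y)) *
    X (T.move .short (T.move .medium y))
  sq : ∀ y, (((X (T.move .short y) / X y) ^ 2 : ℂˣ) : ℂ) =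
    (-1) ^ (α (quadOf y)).val * if T.sgn y = 1 then z (quadOf y) else (z (quadOf y))⁻¹

/-- The eigenvalue of a boundary edge. -/
noncomputable def eigenvalue (e X : T.Flag → ℂˣ) : Move → T.Flag → ℂˣ
  | .medium, y => -e y ^ 2
  | .short, y => (X (T.move .short y) * e (T.move .short y)) / (X y * e y)
  | _, _ => 1

section

variable {α : T.Quad → ZMod 2} {z : T.Quad → ℂ} {e X : T.Flag → ℂˣ}

theorem IsSpinStructure.sq_inv (he : T.IsSpinStructure α e) (y : T.Flag) :
    (e y ^ 2)⁻¹ = -e y ^ 2 := by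
  rw [inv_eq_iff_mul_eq_one, mul_neg, ← pow_add, he.pow_four, neg_neg]

/-- The labelling of the boundary edges by the eigenvalues. -/
noncomputable def eigenvalueLabelling (he : T.IsSpinStructure α e) (X : T.Flag → ℂˣ) :
    T.Labelling ℂˣ where
  label := eigenvalue e X
  reverse c y := by
    cases c
    · simp [eigenvalue]
    · simp only [eigenvalue, he.medium, inv_neg, inv_pow, he.sq_inv]
    · simp [eigenvalue, move_move]
    · simp [eigenvalue]
  glue _ := rfl
  long_glue _ := rfl
  medium_glue y := by simp only [eigenvalue, he.glue]

/-- A lift of the shape labelling to `SL(2, ℂ)`. -/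
noncomputable def shapeLift (he : T.IsSpinStructure α e) (X : T.Flag → ℂˣ) : T.Labelling SL(2, ℂ) where
  label
    | .long, y => antidiag (e y ^ 2)
    | .medium, y => upper (-e y ^ 2) (-e y ^ 2 : ℂˣ)
    | .short, y => upper (eigenvalue e X .short y) 0
    | .glue, _ => 1
  reverse c y := by
    cases c
    · simp only [he.long, antidiag_inv, inv_pow, he.sq_inv]
    · simp only [he.medium, upper_inv, inv_pow, he.sq_inv, inv_neg, Units.val_neg]
    · simp [upper_inv, eigenvalue, move_move]
    · simp
  glue _ := rfl
  long_glue y := by simp only [he.glue]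
  medium_glue y := by simp only [he.glue]

theorem quadOf_medium_short (y : T.Flag) : quadOf (T.move .medium (T.move .short y)) =
    if T.sgn y = 1 then (y.1, (quadOf y).2 + 2) else (y.1, (quadOf y).2 + 1) := by
  obtain ⟨t, p⟩ := y
  have : ∀ p : Equiv.Perm (Fin 4),
      quadType ((p * Equiv.swap 2 3 * Equiv.swap 1 2 : Equiv.Perm (Fin 4)) 0)
        ((p * Equiv.swap 2 3 * Equiv.swap 1 2 : Equiv.Perm (Fin 4)) 1) =
        if Equiv.Perm.sign p = 1 then quadType (p 0) (p 1) + 2 else quadType (p 0) (p 1) + 1 := by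
    decide
  simp only [quadOf, move, this, sgn]
  split <;> rename_i h <;> simp [h]

/-- The sign `(-1)^α` in the squares of the spin roots cancels the one in the squares of `X`. -/
theorem IsSpinStructure.eigenvalue_sq (he : T.IsSpinStructure α e) (hX : T.IsShapeRoot α z X)
    (y : T.Flag) : ((eigenvalue e X .short y ^ 2 : ℂˣ) : ℂ) =
      if T.sgn y = 1 then z (quadOf y) else (z (quadOf y))⁻¹ := by
  have h : eigenvalue e X .short y ^ 2 =
      (-1) ^ (α (quadOf y)).val * (X (T.move .short y) / X y) ^ 2 := by
    rw [eigenvalue, mul_div_mul_comm, mul_pow, div_pow (e _), he.short, mul_div_cancel_right, mul_comm]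
  have sq : ((-1 : ℂ) ^ (α (quadOf y)).val) * (-1) ^ (α (quadOf y)).val = 1 := by
    rw [← mul_pow]; simp
  rw [h, Units.val_mul, hX.sq, ← mul_assoc]
  push_cast
  rw [sq, one_mul]

theorem IsSpinStructure.mk_label (he : T.IsSpinStructure α e) (hX : T.IsShapeRoot α z X)
    (c : Move) (y : T.Flag) :
    (QuotientGroup.mk ((shapeLift he X).label c y) : PSL(2, ℂ)) = T.shapeLabel z c y := by
  have sq : (e y ^ 2) ^ 2 = -1 := by rw [← pow_mul, he.pow_four]
  cases c
  · exact mk_antidiag sq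
  · exact mk_upper_self (by rw [neg_sq, sq])
  · have := he.eigenvalue_sq hX y
    rw [shapeLabel]
    change (QuotientGroup.mk (upper _ 0) : PSL(2, ℂ)) = _
    rw [sgn] at this
    split_ifs at this ⊢ with h
    · exact mk_upper_zero (by rw [this, inv_inv])
    · exact mk_upper_zero this
  · rfl

/-- The product is independent of `u` and has trace -1, so its order is 3 already in SL(2, ℂ); it
permutes the vertices of a face cyclically. -/
theorem upper_mul_antidiag_pow_three (u : ℂˣ) : (upper u u * antidiag u) ^ 3 = 1 := by
  have h : ((upper u u * antidiag u : SL(2, ℂ)) : Matrix (Fin 2) (Fin 2) ℂ) = !![-1, 1; -1, 0] := by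
    rw [Matrix.SpecialLinearGroup.coe_mul, coe_upper, coe_antidiag]
    simp
  apply Subtype.ext
  rw [Matrix.SpecialLinearGroup.coe_pow, h, Matrix.SpecialLinearGroup.coe_one, Matrix.one_fin_two]
  simp [pow_succ]

theorem central_eq_upper (a : ZMod 2) : central a = upper ((-1) ^ a.val) 0 := by
  have : ∀ a : ZMod 2, a = 0 ∨ a = 1 := by decide
  rcases this a with rfl | rfl
  · rw [central_zero, ZMod.val_zero, pow_zero, upper_one_zero]
  · rw [central_one, ZMod.val_one, pow_one, upper_neg_one]

/-- The spin root is inverted at every step, which makes the three pairs of labels equal to one and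
the same product of order 3. -/
theorem shapeLift_largeHexagon (he : T.IsSpinStructure α e) (X : T.Flag → ℂˣ) (y : T.Flag) :
    (shapeLift he X).hol largeHexagonWord y = 1 := by
  rw [Labelling.hol_largeHexagonWord]
  simp only [shapeLift, he.long, he.medium, inv_inv, inv_pow, he.sq_inv, neg_neg]
  rw [← upper_mul_antidiag_pow_three (e y ^ 2)]
  simp only [pow_succ, pow_zero, one_mul]

/-- The diagonal labels of the two short sides cancel, and the two long sides contribute the ratio
of the squared spin roots on the two faces. This is the only 2-cell where the sign `(-1)^α`
survives. -/
theorem shapeLift_rectangle (he : T.IsSpinStructure α e) (hX : T.IsShapeRoot α z X) (y : T.Flag) :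
    (shapeLift he X).hol rectangleWord y = central (α (quadOf y)) := by
  have h₁ : eigenvalue e X .short (T.move .short y) = (eigenvalue e X .short y)⁻¹ := by
    simp [eigenvalue, move_move]
  have h₂ : eigenvalue e X .short y = (eigenvalue e X .short (T.move .long y))⁻¹ := by
    simp only [eigenvalue, short_long, he.long]
    have := hX.long y
    rw [short_long] at this
    rw [inv_div, div_eq_div_iff_mul_eq_mul]
    apply Units.ext
    have := congrArg Units.val this
    push_cast at this ⊢
    field_simp
    linear_combination this
  have h₃ : e (T.move .short (T.move .long y)) ^ 2 = -((-1) ^ (α (quadOf y)).val * e y ^ 2) := by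
    rw [he.short, quadOf_long, he.long, inv_pow, he.sq_inv, mul_neg]
  have h₄ : e y ^ 2 * e y ^ 2 = -1 := by rw [← pow_add, he.pow_four]
  rw [Labelling.hol_rectangleWord]
  simp only [shapeLift]
  rw [mul_assoc, antidiag_mul_upper_mul_antidiag, upper_mul_upper, short_long, move_move, h₁, h₂,
    ← short_long, h₃, central_eq_upper]
  congr 1
  · apply Units.ext
    have := congrArg Units.val h₄
    push_cast at this ⊢
    field_simp
    rw [← pow_mul, mul_comm, pow_mul]
    simp
  · simp

/-- The relation between the shape parameters of a tetrahedron, on squares of eigenvalues. -/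
theorem IsSpinStructure.eigenvalue_triangle (he : T.IsSpinStructure α e) (hX : T.IsShapeRoot α z X)
    (hz : T.IsAlgebraicSolution z) (y : T.Flag) :
    1 - ((eigenvalue e X .short y ^ 2 : ℂˣ) : ℂ) + ((eigenvalue e X .short y ^ 2 : ℂˣ) : ℂ) *
      ((eigenvalue e X .short (T.move .medium (T.move .short y)) ^ 2 : ℂˣ) : ℂ) = 0 := by
  rw [he.eigenvalue_sq hX, he.eigenvalue_sq hX, quadOf_medium_short]
  simp only [sgn_move, neg_neg]
  obtain ⟨t, k, ht, hk⟩ : ∃ t k, y.1 = t ∧ quadOf y = (t, k) := ⟨_, _, rfl, rfl⟩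
  rw [hk]
  have h₀ := hz.ne_zero (t, k)
  have h₁ : 1 - z (t, k) ≠ 0 := sub_ne_zero.mpr (hz.ne_one (t, k)).symm
  split_ifs
  · have e : ∀ k : Fin 3, k + 2 = k + 1 + 1 := by decide
    have e' : 1 - 1 / (1 - z (t, k)) = -z (t, k) / (1 - z (t, k)) := by
      field_simp
      ring
    simp only [ht, e]
    rw [hz.next, hz.next, e']
    field_simp
    ring
  · simp only [ht]
    rw [hz.next]
    field_simp
    ring

theorem shapeLift_boundaryHexagon (he : T.IsSpinStructure α e) (hX : T.IsShapeRoot α z X)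
    (hz : T.IsAlgebraicSolution z) (y : T.Flag) :
    (shapeLift he X).hol boundaryHexagonWord y = 1 := by
  -- Each pair of a short and a medium label is upper triangular with its off-diagonal entry tied to
  -- the diagonal. Three of them multiply to 1 under one condition on the diagonal and one on the
  -- squares.
  have main : ∀ d₁ d₂ d₃ : ℂˣ, d₃ * d₂ * d₁ = 1 → (1 : ℂ) + (d₁ : ℂ) ^ 2 + d₁ ^ 2 * d₂ ^ 2 = 0 →
      upper d₃ (-(d₃⁻¹ : ℂˣ)) * upper d₂ (-(d₂⁻¹ : ℂˣ)) * upper d₁ (-(d₁⁻¹ : ℂˣ)) = 1 := by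
    intro d₁ d₂ d₃ h h'
    rw [upper_mul_upper, upper_mul_upper, h, ← upper_one_zero]
    congr 1
    push_cast
    field_simp
    linear_combination -h'
  have step : ∀ q u : ℂˣ, u ^ 2 = -1 → upper q 0 * upper u u = upper (q * u) (-((q * u)⁻¹ : ℂˣ)) := by
    intro q u h
    rw [upper_mul_upper]
    congr 1
    have := congrArg Units.val h
    push_cast at this ⊢
    field_simp
    linear_combination this
  have sq : ∀ y, (-e y ^ 2) ^ 2 = -1 := fun y => by rw [neg_sq, ← pow_mul, he.pow_four]
  rw [Labelling.hol_boundaryHexagonWord]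
  simp only [shapeLift]
  rw [step _ _ (sq _), step _ _ (sq _), step _ _ (sq _)]
  refine main _ _ _ ?_ ?_
  -- Diagonal: the factors `X` cancel by the triangle relation, and three fourth powers equal to -1
  -- cancel the three signs of the medium labels.
  · have tri := congrArg Units.val (hX.triangle (T.move .medium y))
    have h₀ := congrArg Units.val (he.pow_four y)
    have h₁ := congrArg Units.val (he.pow_four (T.move .short (T.move .medium y)))
    have h₂ := congrArg Units.val (he.pow_four (T.move .short y))
    simp only [short_medium_short, move_move, eigenvalue, he.medium] at tri ⊢
    apply Units.ext
    push_cast at *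
    field_simp
    rw [h₀, h₁, h₂]
    linear_combination -tri
  -- Off the diagonal the condition is the relation between the consecutive shape parameters of the
  -- tetrahedron.
  · have tri := he.eigenvalue_triangle hX hz (T.move .medium y)
    have h₀ := congrArg Units.val (sq y)
    have h₁ := congrArg Units.val (sq (T.move .short (T.move .medium y)))
    push_cast at *
    rw [mul_pow, mul_pow, h₀]
    rw [h₁]
    linear_combination tri

/-- The labels around a disc are quotients of `X * e` and telescope. -/
theorem shapeLift_rot_pow (he : T.IsSpinStructure α e) (hX : T.IsShapeRoot α z X) (n : ℕ)
    (y : T.Flag) : (shapeLift he X).hol ((.of .short * .of .glue) ^ n) y =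
      upper ((X (T.rot^[n] y) * e (T.rot^[n] y)) / (X y * e y)) 0 := by
  induction n with
  | zero => simp [upper_one_zero]
  | succ n ih =>
    rw [pow_succ', Labelling.hol_mul, ih, act_rot_pow, Labelling.hol_mul, Labelling.hol_of,
      Labelling.hol_of, act_of, Labelling.glue, mul_one, Function.iterate_succ_apply']
    change upper (eigenvalue e X .short _) 0 * _ = _
    rw [upper_mul_upper, eigenvalue, hX.glue, he.glue, ← rot_apply, div_mul_div_cancel]
    simp

theorem shapeLift_edgeDisc (he : T.IsSpinStructure α e) (hX : T.IsShapeRoot α z X)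
    (y : T.Flag) : (shapeLift he X).hol (T.edgeDiscWord y) y = 1 := by
  rw [edgeDiscWord, shapeLift_rot_pow he hX]
  have : T.rot^[Function.minimalPeriod T.rot y] y = y := Function.iterate_minimalPeriod
  change upper ((X (T.rot^[Function.minimalPeriod T.rot y] y) *
    e (T.rot^[Function.minimalPeriod T.rot y] y)) / _) 0 = 1
  rw [this, div_self', upper_one_zero]

theorem shapeLift_hasCurvature (he : T.IsSpinStructure α e) (hX : T.IsShapeRoot α z X)
    (hz : T.IsAlgebraicSolution z) : HasCurvature (shapeLift he X) (T.rect α, 0) where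
  largeHexagon y := (shapeLift_largeHexagon he X y).trans central_zero.symm
  rectangle y := shapeLift_rectangle he hX y
  boundaryHexagon y := (shapeLift_boundaryHexagon he hX hz y).trans central_zero.symm
  edgeDisc y := (shapeLift_edgeDisc he hX y).trans central_zero.symm

theorem exists_hol_eq_upper (he : T.IsSpinStructure α e) (X : T.Flag → ℂˣ) {b : FreeGroup Move}
    (hb : b ∈ boundaryWords) (y : T.Flag) :
    ∃ c, (shapeLift he X).hol b y = upper ((eigenvalueLabelling he X).hol b y) c := by
  have gen : ∀ c ∈ ({.of .medium, .of .short, .of .glue} : Set (FreeGroup Move)), ∀ y,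
      (∃ a, (shapeLift he X).hol c y = upper ((eigenvalueLabelling he X).hol c y) a) ∧
      ∃ a, (shapeLift he X).hol c⁻¹ y = upper ((eigenvalueLabelling he X).hol c⁻¹ y) a := by
    rintro c (rfl | rfl | rfl) y <;>
      simp only [Labelling.hol_of, Labelling.hol_of_inv, and_self]
    · exact ⟨_, rfl⟩
    · exact ⟨_, rfl⟩
    · exact ⟨0, upper_one_zero.symm⟩
  induction hb using Subgroup.closure_induction'' generalizing y with
  | mem c hc => exact (gen c hc y).1
  | inv_mem c hc => exact (gen c hc y).2
  | one => exact ⟨0, by simp [upper_one_zero]⟩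
  | mul v w _ _ hv hw =>
    obtain ⟨a, ha⟩ := hv (T.act w y)
    obtain ⟨b, hb⟩ := hw y
    exact ⟨_, by rw [Labelling.hol_mul, Labelling.hol_mul, ha, hb, upper_mul_upper]⟩

/-- If the developed triangles fit together along the boundary components, then the lift has
unipotent boundary monodromy. -/
theorem shapeLift_isBoundaryUnipotent (he : T.IsSpinStructure α e) (hX : T.IsShapeRoot α z X)
    (hm : ∀ y, X (T.move .medium y) = X y) : T.IsBoundaryUnipotent (shapeLift he X) := by
  -- If `X` is constant along medium edges, the medium label `-e² = e⁻²` is also a quotient of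
  -- values of `X * e`. All boundary eigenvalues then form a coboundary, and closed paths have
  -- eigenvalue 1.
  have lab : ∀ c, c ≠ .long → ∀ y, (eigenvalueLabelling he X).label c y =
      (X (T.move c y) * e (T.move c y)) / (X y * e y) := by
    intro c hc y
    cases c
    · exact absurd rfl hc
    · change -e y ^ 2 = _
      rw [hm, he.medium, mul_div_mul_left_eq_div, ← he.sq_inv, sq, mul_inv, div_eq_mul_inv]
    · rfl
    · change 1 = _
      rw [hX.glue, he.glue, div_self']
  have hol : ∀ b ∈ boundaryWords, ∀ y, (eigenvalueLabelling he X).hol b y =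
      (X (T.act b y) * e (T.act b y)) / (X y * e y) := by
    intro b hb
    have gen : ∀ c ∈ ({.of .medium, .of .short, .of .glue} : Set (FreeGroup Move)), ∀ y,
        ((eigenvalueLabelling he X).hol c y = (X (T.act c y) * e (T.act c y)) / (X y * e y)) ∧
        (eigenvalueLabelling he X).hol c⁻¹ y = (X (T.act c⁻¹ y) * e (T.act c⁻¹ y)) / (X y * e y) := by
      rintro c (rfl | rfl | rfl) y <;>
        simp only [Labelling.hol_of, Labelling.hol_of_inv, act_of, act_of_inv, and_self] <;>
        exact lab _ (by decide) y
    induction hb using Subgroup.closure_induction'' with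
    | mem c hc => exact fun y => (gen c hc y).1
    | inv_mem c hc => exact fun y => (gen c hc y).2
    | one => simp
    | mul v w _ _ hv hw =>
      intro y
      rw [Labelling.hol_mul, hv, hw, act_mul, div_mul_div_cancel]
  refine fun y => ⟨1, fun b hb hy => ?_⟩
  obtain ⟨c, hc⟩ := exists_hol_eq_upper he X hb y
  refine ⟨c, ?_⟩
  rw [one_mul, inv_one, mul_one, hc, hol b hb, mem_loops.mp hy, div_self', upper_one]

end

/-! ### Flattenings -/

section

variable {z : T.Quad → ℂ}

theorem exp_I_mul_pi_mul_int (n : ℤ) :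
    Complex.exp (Complex.I * Real.pi * n) = (-1) ^ (n : ZMod 2).val := by
  have h : Complex.exp (Complex.I * Real.pi * n) = (-1) ^ n := by
    rw [mul_comm, Complex.exp_int_mul, mul_comm, Complex.exp_pi_mul_I]
  rw [h]
  rcases Int.even_or_odd n with e | e
  · rw [e.neg_one_zpow, (ZMod.intCast_zmod_eq_zero_iff_dvd n 2).mpr e.two_dvd]; simp
  · obtain ⟨k, rfl⟩ := e
    have : ((2 * k + 1 : ℤ) : ZMod 2) = 1 := by
      push_cast; rw [show (2 : ZMod 2) = 0 from rfl, zero_mul, zero_add]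
    rw [this, ZMod.val_one, pow_one, (odd_two_mul_add_one k).neg_one_zpow]

theorem neg_one_pow_val_mul_self (a : ZMod 2) : (-1 : ℂ) ^ a.val * (-1) ^ a.val = 1 := by
  rw [← mul_pow]; simp

theorem IsAlgebraicSolution.tet (hz : T.IsAlgebraicSolution z) (t : Fin N) (k : Fin 3) :
    z (t, k) * z (t, k + 1) * z (t, k + 2) = -1 := by
  have h₀ := hz.ne_zero (t, k)
  have h₁ : 1 - z (t, k) ≠ 0 := sub_ne_zero.mpr (hz.ne_one (t, k)).symm
  have e : ∀ k : Fin 3, k + 2 = k + 1 + 1 := by decide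
  have e' : 1 - 1 / (1 - z (t, k)) = -z (t, k) / (1 - z (t, k)) := by
    field_simp
    ring
  rw [e, hz.next t (k + 1), hz.next t k, e']
  field_simp

variable {W : T.Quad → ℂ} {f : T.Quad → ℤ}

theorem IsEdgeFlattening.isTangent (h : T.IsEdgeFlattening z W f) : T.IsTangent W :=
  ⟨fun t => h.tet t 0, fun E => by simpa only [nsmul_eq_mul] using h.edge E⟩

theorem IsStrongFlattening.isPeripherallyTrivial (h : T.IsStrongFlattening z W f) :
    T.IsPeripherallyTrivial W := fun γ => by simpa only [zsmul_eq_mul] using h.peripheral γ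

theorem IsEdgeFlattening.eq_exp (h : T.IsEdgeFlattening z W f) (q : T.Quad) :
    z q = Complex.exp (W q) * (-1) ^ (f q : ZMod 2).val := by
  rw [← h.exp_eq, Complex.exp_add, exp_I_mul_pi_mul_int]

/-- The product of the three shapes is -1 while the three values of `W` add up to 0, so the sum of
the three values of `f` is odd. -/
theorem IsEdgeFlattening.mem_evenAngles (hz : T.IsAlgebraicSolution z)
    (h : T.IsEdgeFlattening z W f) : (fun q => (f q : ZMod 2)) ∈ T.evenAngles := by
  refine ⟨fun t k => ?_, h.parity⟩
  have e := hz.tet t k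
  rw [← h.exp_eq, ← h.exp_eq, ← h.exp_eq, ← Complex.exp_add, ← Complex.exp_add] at e
  have : W (t, k) + Complex.I * Real.pi * f (t, k) +
      (W (t, k + 1) + Complex.I * Real.pi * f (t, k + 1)) +
      (W (t, k + 2) + Complex.I * Real.pi * f (t, k + 2)) =
      Complex.I * Real.pi * (f (t, k) + f (t, k + 1) + f (t, k + 2) : ℤ) := by
    push_cast
    linear_combination h.tet t k
  rw [this, exp_I_mul_pi_mul_int] at e
  push_cast at e
  have cases : ∀ a : ZMod 2, a = 0 ∨ a = 1 := by decide
  refine (cases _).resolve_left fun h₀ => ?_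
  rw [h₀] at e
  norm_num at e

/-- The roots given by a potential of a flattening. -/
theorem IsEdgeFlattening.isShapeRoot (h : T.IsEdgeFlattening z W f) {n : T.Flag → ℂ}
    (hg : ∀ y, n (T.move .glue y) = n y)
    (hs : ∀ y, n (T.move .short y) = n y + (T.sgn y : ℤ) • W (quadOf y)) :
    T.IsShapeRoot (fun q => (f q : ZMod 2)) z
      (fun y => Units.mk0 (Complex.exp (n y / 2)) (Complex.exp_ne_zero _)) where
  glue y := by simp only [hg]
  long y := by
    apply Units.ext
    simp only [Units.val_mul, Units.val_mk0, ← Complex.exp_add, hs, quadOf_long, sgn_move]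
    congr 1
    push_cast
    rw [neg_smul]
    ring
  triangle y := by
    apply Units.ext
    simp only [Units.val_mul, Units.val_mk0, ← Complex.exp_add, hs, sgn_move, neg_neg]
    congr 1
    have := sum_quadOf W y
    rw [h.isTangent.tet] at this
    push_cast
    rw [neg_smul]
    have := congrArg ((T.sgn y : ℤ) • ·) this
    simp only [smul_add, smul_zero] at this
    linear_combination this / 2
  sq y := by
    have key : (((Units.mk0 (Complex.exp (n (T.move .short y) / 2)) (Complex.exp_ne_zero _) /
        Units.mk0 (Complex.exp (n y / 2)) (Complex.exp_ne_zero _)) ^ 2 : ℂˣ) : ℂ) =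
        Complex.exp ((T.sgn y : ℤ) • W (quadOf y)) := by
      rw [Units.val_pow_eq_pow_val, Units.val_div_eq_div_val, Units.val_mk0, Units.val_mk0,
        ← Complex.exp_sub, ← Complex.exp_nat_mul, hs]
      congr 1
      push_cast
      ring
    have sq := neg_one_pow_val_mul_self (f (quadOf y))
    rw [key, h.eq_exp (quadOf y)]
    rcases T.sgn_eq y with e | e
    · rw [e, if_pos rfl, Units.val_one, one_smul]
      linear_combination -Complex.exp (W (quadOf y)) * sq
    · rw [e, if_neg (by decide), Units.val_neg, Units.val_one, neg_one_smul, Complex.exp_neg, mul_inv,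
        ← inv_pow, inv_neg, inv_one]
      linear_combination -(Complex.exp (W (quadOf y)))⁻¹ * sq

/-! ### The angles of an algebraic solution -/

/-- The arguments of complex numbers as elements of the circle. -/
noncomputable def unitPart (z : T.Quad → ℂ) : T.Quad → Circle := fun q => Circle.exp (Complex.arg (z q))

theorem coe_unitPart {q : T.Quad} (h : z q ≠ 0) : (unitPart z q : ℂ) = z q / ‖z q‖ := by
  rw [unitPart, Circle.coe_exp, eq_div_iff (by simpa using h), mul_comm, Complex.norm_mul_exp_arg_mul_I]

theorem IsAlgebraicSolution.norm_tet (hz : T.IsAlgebraicSolution z) (t : Fin N) (k : Fin 3) :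
    ‖z (t, k)‖ * ‖z (t, k + 1)‖ * ‖z (t, k + 2)‖ = 1 := by
  rw [← norm_mul, ← norm_mul, hz.tet, norm_neg, norm_one]

theorem IsAlgebraicSolution.unitPart_mem_SA (hz : T.IsAlgebraicSolution z) : unitPart z ∈ T.SA := by
  refine ⟨fun t k => Circle.ext ?_, fun E => Circle.ext ?_⟩
  · rw [Circle.coe_mul, Circle.coe_mul, coe_unitPart (hz.ne_zero _), coe_unitPart (hz.ne_zero _),
      coe_unitPart (hz.ne_zero _), div_mul_div_comm, div_mul_div_comm, hz.tet, ← Complex.ofReal_mul,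
      ← Complex.ofReal_mul, hz.norm_tet]
    simp
  · have : Circle.coeHom (∏ q, unitPart z q ^ T.G E q) = ∏ q, (z q / ‖z q‖) ^ T.G E q := by
      rw [map_prod]
      refine Finset.prod_congr rfl fun q _ => ?_
      rw [map_pow, ← coe_unitPart (hz.ne_zero q)]; rfl
    change Circle.coeHom _ = 1
    rw [this]
    simp only [div_pow, Finset.prod_div_distrib, hz.edge]
    rw [show ∏ q, (‖z q‖ : ℂ) ^ T.G E q = ((‖∏ q, z q ^ T.G E q‖ : ℝ) : ℂ) by simp, hz.edge]
    simp

theorem IsAlgebraicSolution.unitPart_mem_SA₀ (hz : T.IsAlgebraicSolution z) (hc : T.IsComplete z) :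
    unitPart z ∈ T.SA₀ := by
  refine ⟨hz.unitPart_mem_SA, fun γ => Circle.ext ?_⟩
  have : Circle.coeHom (∏ q, unitPart z q ^ γ.coeff q) = ∏ q, (z q / ‖z q‖) ^ γ.coeff q := by
    rw [map_prod]
    refine Finset.prod_congr rfl fun q _ => ?_
    rw [← coe_unitPart (hz.ne_zero q), ← Circle.coe_zpow]; rfl
  change Circle.coeHom _ = 1
  rw [this]
  simp only [div_zpow, Finset.prod_div_distrib, hc γ]
  rw [show ∏ q, (‖z q‖ : ℂ) ^ γ.coeff q = ((‖∏ q, z q ^ γ.coeff q‖ : ℝ) : ℂ) by simp, hc γ]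
  simp

theorem IsAlgebraicSolution.isTangent_log (hz : T.IsAlgebraicSolution z) :
    T.IsTangent fun q => Real.log ‖z q‖ := by
  have ne : ∀ q, ‖z q‖ ≠ 0 := fun q => norm_ne_zero_iff.mpr (hz.ne_zero q)
  refine ⟨fun t => ?_, fun E => ?_⟩
  · rw [← Real.log_mul (ne _) (ne _), ← Real.log_mul (mul_ne_zero (ne _) (ne _)) (ne _)]
    exact (congrArg Real.log (hz.norm_tet t 0)).trans Real.log_one
  · simp only [nsmul_eq_mul, ← Real.log_pow]
    rw [← Real.log_prod fun q _ => pow_ne_zero _ (ne q)]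
    simp only [← norm_pow]
    rw [← norm_prod, hz.edge, norm_one, Real.log_one]

theorem IsAlgebraicSolution.isPeripherallyTrivial_log (hz : T.IsAlgebraicSolution z)
    (hc : T.IsComplete z) : T.IsPeripherallyTrivial fun q => Real.log ‖z q‖ := by
  have ne : ∀ q, ‖z q‖ ≠ 0 := fun q => norm_ne_zero_iff.mpr (hz.ne_zero q)
  intro γ
  simp only [zsmul_eq_mul, ← Real.log_zpow]
  rw [← Real.log_prod fun q _ => zpow_ne_zero _ (ne q)]
  simp only [← norm_zpow]
  rw [← norm_prod, hc γ, norm_one, Real.log_one]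

/-- The real part comes from the moduli, whose logarithms satisfy the homogeneous equations; the
imaginary part and the integers come from the normal form of the arguments. -/
theorem isEdgeFlattening_of_expMul (hz : T.IsAlgebraicSolution z) {V : T.Quad → ℝ}
    (hV : T.IsTangent V) {α : T.Quad → ZMod 2} (hα : α ∈ T.evenAngles)
    (h : unitPart z = expMul V (signs α)) :
    T.IsEdgeFlattening z (fun q => Real.log ‖z q‖ + V q * Complex.I) (fun q => (α q).val) := by
  have cast : ∀ q, (((α q).val : ℤ) : ZMod 2) = α q := fun q => by simp
  refine ⟨fun q => ?_, fun t k => ?_, fun E => ?_, fun θ => ?_⟩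
  · have e := congrArg (fun u : Circle => (u : ℂ)) (congrFun h q)
    have ne : ‖z q‖ ≠ 0 := norm_ne_zero_iff.mpr (hz.ne_zero q)
    simp only [coe_unitPart (hz.ne_zero q), expMul, signs, Circle.coe_mul, Circle.coe_exp,
      Circle.coe_pow, Circle.coe_neg, Circle.coe_one] at e
    rw [div_eq_iff (Complex.ofReal_ne_zero.mpr ne)] at e
    rw [Complex.exp_add, exp_I_mul_pi_mul_int, cast, Complex.exp_add, ← Complex.ofReal_exp,
      Real.exp_log (norm_pos_iff.mpr (hz.ne_zero q))]
    linear_combination -e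
  · have h₁ : Real.log ‖z (t, k)‖ + Real.log ‖z (t, k + 1)‖ + Real.log ‖z (t, k + 2)‖ = 0 :=
      (sum_add_one (fun k => Real.log ‖z (t, k)‖) k).trans (hz.isTangent_log.tet t)
    have h₂ : V (t, k) + V (t, k + 1) + V (t, k + 2) = 0 :=
      (sum_add_one (fun k => V (t, k)) k).trans (hV.tet t)
    have h₁ := congrArg (fun x : ℝ => (x : ℂ)) h₁
    have h₂ := congrArg (fun x : ℝ => (x : ℂ)) h₂
    push_cast at h₁ h₂
    linear_combination h₁ + h₂ * Complex.I
  · have h₁ := congrArg (fun x : ℝ => (x : ℂ)) (hz.isTangent_log.edge E)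
    have h₂ := congrArg (fun x : ℝ => (x : ℂ)) (hV.edge E)
    simp only [nsmul_eq_mul] at h₁ h₂
    push_cast at h₁ h₂
    simp only [mul_add, Finset.sum_add_distrib, ← mul_assoc, ← Finset.sum_mul, h₁, h₂, zero_mul,
      add_zero]
  · simp only [cast]
    exact hα.2 θ

theorem exists_isEdgeFlattening (hT : T.IsIdealTriangulation) (hz : T.IsAlgebraicSolution z) :
    ∃ W f, T.IsEdgeFlattening z W f := by
  obtain ⟨V, α, hα, hV, _, h⟩ := exists_expMul hT.connected hz.unitPart_mem_SA
  exact ⟨_, _, isEdgeFlattening_of_expMul hz hV hα h⟩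

theorem exists_isStrongFlattening (hT : T.IsIdealTriangulation) (hz : T.IsAlgebraicSolution z)
    (hc : T.IsComplete z) : ∃ W f, T.IsStrongFlattening z W f := by
  obtain ⟨V, α, hα, hV, hp, h⟩ := exists_expMul hT.connected hz.unitPart_mem_SA
  refine ⟨_, _, isEdgeFlattening_of_expMul hz hV hα h, fun γ => ?_⟩
  have h₁ := congrArg (fun x : ℝ => (x : ℂ)) (hz.isPeripherallyTrivial_log hc γ)
  have h₂ := congrArg (fun x : ℝ => (x : ℂ)) (hp (hz.unitPart_mem_SA₀ hc) γ)
  simp only [zsmul_eq_mul] at h₁ h₂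
  push_cast at h₁ h₂
  simp only [mul_add, Finset.sum_add_distrib, ← mul_assoc, ← Finset.sum_mul, h₁, h₂, zero_mul,
    add_zero]

/-- Conversely a flattening displays the arguments in normal form, so `f mod 2` computes the class
of the angle structure. -/
theorem IsEdgeFlattening.unitPart_eq (hz : T.IsAlgebraicSolution z) (h : T.IsEdgeFlattening z W f) :
    unitPart z = expMul (fun q => (W q).im) (signs fun q => (f q : ZMod 2)) := by
  funext q
  apply Circle.ext
  have norm : ‖z q‖ = Real.exp (W q).re := by
    rw [h.eq_exp, norm_mul, norm_pow, norm_neg, norm_one, one_pow, mul_one, Complex.norm_exp]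
  rw [coe_unitPart (hz.ne_zero q), norm]
  simp only [expMul, signs, Circle.coe_mul, Circle.coe_exp, Circle.coe_pow, Circle.coe_neg,
    Circle.coe_one]
  rw [h.eq_exp, Complex.ofReal_exp, mul_div_right_comm, ← Complex.exp_sub]
  congr 2
  linear_combination -Complex.re_add_im (W q)

theorem IsEdgeFlattening.isTangent_im (h : T.IsEdgeFlattening z W f) :
    T.IsTangent fun q => (W q).im := isTangent_map Complex.imAddGroupHom h.isTangent

theorem IsStrongFlattening.isPeripherallyTrivial_im (h : T.IsStrongFlattening z W f) :
    T.IsPeripherallyTrivial fun q => (W q).im :=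
  isPeripherallyTrivial_map Complex.imAddGroupHom h.isPeripherallyTrivial

end

/-! ### The representation determined by the shape parameters -/

section

variable {z : T.Quad → ℂ} {α : T.Quad → ZMod 2} {e X : T.Flag → ℂˣ} {x : T.Flag}
  {ρ : T.FundGroup x →* PSL(2, ℂ)}

theorem shapeLift_map_label (he : T.IsSpinStructure α e) (hX : T.IsShapeRoot α z X) :
    ((shapeLift he X).map (QuotientGroup.mk' (Subgroup.center SL(2, ℂ)))).label =
      T.shapeLabel z := by
  funext c y
  exact he.mk_label hX c y

/-- The curvature of the lift is central and dies in PSL(2, ℂ), so the shape labelling is a cocycle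
there. -/
theorem exists_isDeterminedBy (hz : T.IsAlgebraicSolution z) (he : T.IsSpinStructure α e)
    (hX : T.IsShapeRoot α z X) (x : T.Flag) : ∃ ρ : T.FundGroup x →* PSL(2, ℂ), T.IsDeterminedBy z ρ := by
  let L := (shapeLift he X).map (QuotientGroup.mk' (Subgroup.center SL(2, ℂ)))
  have curv := shapeLift_hasCurvature he hX hz
  have dies : ∀ {w y a}, (shapeLift he X).hol w y = central a → L.hol w y = 1 := by
    intro w y a h
    rw [Labelling.hol_map, h]
    exact mk_central a
  have twice : ∀ c y, L.label c (T.move c y) * L.label c y = 1 := fun c y => by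
    rw [L.reverse, inv_mul_cancel]
  obtain ⟨ρ, hρ⟩ := L.exists_monodromy (fun y r hr => by
    cases hr with
    | back c => rw [L.hol_mul, L.hol_of, L.hol_of, act_of, twice]
    | long_glue =>
      simp only [pow_two, L.hol_mul, act_mul, act_of, L.hol_of, L.glue, mul_one, L.long_glue]
      rw [← glue_long, L.long_glue, twice]
    | medium_glue =>
      simp only [pow_two, L.hol_mul, act_mul, act_of, L.hol_of, L.glue, mul_one, L.medium_glue]
      rw [← glue_medium, L.medium_glue, twice]
    | largeHexagon => exact dies (curv.largeHexagon y)
    | rectangle => exact dies (curv.rectangle y)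
    | boundaryHexagon => exact dies (curv.boundaryHexagon y)
    | edgeDisc => exact dies (curv.edgeDisc y)) x
  exact ⟨ρ, L, shapeLift_map_label he hX, 1, fun w => by rw [hρ, one_mul, inv_one, mul_one]⟩

theorem IsDeterminedBy.isLift (hρ : T.IsDeterminedBy z ρ) (hz : T.IsAlgebraicSolution z)
    (he : T.IsSpinStructure α e) (hX : T.IsShapeRoot α z X) :
    T.IsLift ρ (shapeLift he X) (T.rect α, 0) := by
  obtain ⟨L, hL, g, hg⟩ := hρ
  obtain rfl := Labelling.eq_of_label_eq (hL.trans (shapeLift_map_label he hX).symm)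
  have curv := shapeLift_hasCurvature he hX hz
  refine ⟨⟨g, fun w => ?_⟩, curv.largeHexagon, curv.rectangle, curv.boundaryHexagon, curv.edgeDisc⟩
  rw [hg, Labelling.hol_map]
  rfl

theorem IsLift.isObstruction (hT : T.IsIdealTriangulation) {L : T.Labelling SL(2, ℂ)} {σ : T.C2}
    (h : T.IsLift ρ L σ) {c : T.H2} (hc : T.Represents σ c) : T.IsObstruction ρ c := by
  refine ⟨⟨L, σ, h⟩, fun L' σ' h' => ?_⟩
  have mem := IsLift.sub_mem_B2 hT h' h
  refine (represents_iff ?_ hc).mpr mem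
  obtain ⟨b, hb⟩ := mem
  have := T.Z2.add_mem (d1_mem_Z2 b) hc.1
  rwa [hb, sub_add_cancel] at this

theorem IsLift.isRelObstruction (hT : T.IsIdealTriangulation) {L : T.Labelling SL(2, ℂ)}
    {σ : T.C2rel} (h : T.IsLift ρ L (σ, 0)) (hu : T.IsBoundaryUnipotent L) {c : T.H2rel}
    (hc : T.RepresentsRel σ c) : T.IsRelObstruction ρ c := by
  refine ⟨⟨L, σ, h, hu⟩, fun L' σ' h' hu' => ?_⟩
  refine (representsRel_iff ?_ hc).mpr (IsLift.sub_mem_B2rel hT h' h hu' hu)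
  obtain ⟨b, hb⟩ := IsLift.sub_mem_B2 hT h' h
  have := T.Z2.add_mem (d1_mem_Z2 b) (mem_Z2rel_iff.mp hc.1)
  rw [hb, sub_add_cancel] at this
  exact mem_Z2rel_iff.mpr this

theorem IsLift.isBoundaryParabolic {L : T.Labelling SL(2, ℂ)} {σ : T.C2} (h : T.IsLift ρ L σ)
    (hu : T.IsBoundaryUnipotent L) : T.IsBoundaryParabolic ρ := by
  intro w
  obtain ⟨g, hg⟩ := h.monodromy
  obtain ⟨g', hg'⟩ := hu (T.act w x)
  refine ⟨QuotientGroup.mk (g' * L.hol w x) * g⁻¹, fun b hb hw => ?_⟩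
  have hy : T.act b (T.act w x) = T.act w x := by
    have := mem_loops.mp hw
    rw [mul_assoc, act_mul, act_mul] at this
    conv_rhs => rw [← this]
    rw [act_act_inv]
  obtain ⟨c, hc⟩ := hg' b hb hy
  refine ⟨c, ?_⟩
  rw [hg, ← hc]
  change _ * (g * QuotientGroup.mk (L.hol (w⁻¹ * b * w) x) * _) * _ = _
  rw [L.hol_conj hy]
  simp only [QuotientGroup.mk_mul, QuotientGroup.mk_inv]
  group

/-- A boundary-parabolic representation lifts to matrices with trace `2` or `-2` on the boundary. -/
theorem IsLift.trace_of_isBoundaryParabolic (hT : T.IsIdealTriangulation)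
    {L : T.Labelling SL(2, ℂ)} {σ : T.C2} (h : T.IsLift ρ L σ) (hp : T.IsBoundaryParabolic ρ)
    {b : FreeGroup Move} (hb : b ∈ boundaryWords) {y : T.Flag} (hy : T.act b y = y) :
    (L.hol b y : Matrix (Fin 2) (Fin 2) ℂ).trace ^ 2 = 4 := by
  obtain ⟨w, rfl⟩ := exists_act_eq hT.connected x y
  obtain ⟨g, hg⟩ := h.monodromy
  obtain ⟨g', hg'⟩ := hp w
  have hw : w⁻¹ * b * w ∈ T.loops x := by
    rw [mem_loops, mul_assoc, act_mul, act_mul, hy, act_inv_act]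
  obtain ⟨c, hc⟩ := hg' b hb hw
  rw [hg] at hc
  change _ * (g * QuotientGroup.mk (L.hol (w⁻¹ * b * w) x) * _) * _ = _ at hc
  obtain ⟨u, hu⟩ := QuotientGroup.mk_surjective (g' * g)
  have key : (QuotientGroup.mk (u * L.hol (w⁻¹ * b * w) x * u⁻¹) : PSL(2, ℂ)) =
      QuotientGroup.mk (unipotent c) := by
    rw [← hc, QuotientGroup.mk_mul, QuotientGroup.mk_mul, QuotientGroup.mk_inv, hu]
    group
  obtain ⟨a, ha⟩ := mk_eq_mk_iff.mp key
  have tr := trace_conj u (L.hol (w⁻¹ * b * w) x)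
  have tr' := trace_conj (L.hol w x)⁻¹ (L.hol b (T.act w x))
  rw [inv_inv, ← L.hol_conj hy, ← tr, ha] at tr'
  rw [← tr']
  rcases central_eq a with h | h
  · rw [h, one_mul, trace_unipotent]; norm_num
  · rw [h, neg_one_mul, Matrix.SpecialLinearGroup.coe_neg, Matrix.trace_neg, trace_unipotent]; norm_num

/-- The completeness equations hold if the boundary monodromy is parabolic. -/
theorem IsLift.isComplete (hT : T.IsIdealTriangulation) (hz : T.IsAlgebraicSolution z)
    (hα : α ∈ T.evenAngles) (he : T.IsSpinStructure α e) (hX : T.IsShapeRoot α z X) {σ : T.C2}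
    (h : T.IsLift ρ (shapeLift he X) σ) (hp : T.IsBoundaryParabolic ρ) : T.IsComplete z := by
  have mem : ∀ c ∈ [Move.medium, .short, .glue], FreeGroup.of c ∈ boundaryWords := fun c hc => by
    refine Subgroup.subset_closure ?_
    simp only [List.mem_cons, List.not_mem_nil, or_false] at hc
    rcases hc with rfl | rfl | rfl <;> simp
  -- Trace ±2 only says that an eigenvalue `u` satisfies `(u² - 1)² = 0`, so it is the squares of
  -- the eigenvalues that have trivial holonomy along the boundary.
  obtain ⟨D, hD⟩ := ((eigenvalueLabelling he X).map (powMonoidHom 2)).exists_gauge boundaryWords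
    fun y b hb hy => by
      obtain ⟨c, hc⟩ := exists_hol_eq_upper he X hb y
      have tr := h.trace_of_isBoundaryParabolic hT hp hb hy
      rw [hc, coe_upper, Matrix.trace_fin_two] at tr
      rw [Labelling.hol_map, powMonoidHom_apply]
      generalize (eigenvalueLabelling he X).hol b y = u at tr ⊢
      have : ((u : ℂ) ^ 2 - 1) ^ 2 = 0 := by
        simp at tr
        field_simp at tr
        linear_combination tr
      apply Units.ext
      push_cast
      exact sub_eq_zero.mp (pow_eq_zero_iff two_ne_zero |>.mp this)
  have pow_four : ∀ y, (-e y ^ 2) ^ 2 = -1 := fun y => by rw [neg_sq, ← pow_mul, he.pow_four]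
  have hm : ∀ y, D (T.move .medium y) = -D y := fun y => by
    have : (-e y ^ 2) ^ 2 = D (T.move .medium y) * (D y)⁻¹ := hD .medium (mem _ (by simp)) y
    rw [pow_four, ← mul_inv_eq_iff_eq_mul.symm.trans eq_comm] at this
    rw [this, neg_one_mul]
  have hs : ∀ y, D (T.move .short y) = eigenvalue e X .short y ^ 2 * D y := fun y =>
    (mul_inv_eq_iff_eq_mul.mp (hD .short (mem _ (by simp)) y).symm)
  have hg : ∀ y, D (T.move .glue y) = D y := fun y => by
    have := mul_inv_eq_iff_eq_mul.mp (hD .glue (mem _ (by simp)) y).symm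
    rwa [(Labelling.glue _ y : _ = (1 : ℂˣ)), one_mul] at this
  let s : T.Quad → ℂˣ := fun q => (-1) ^ (α q).val
  let u : T.Quad → ℂˣ := fun q => Units.mk0 (z q) (hz.ne_zero q)
  -- `D` changes sign along medium edges and so does `e²`; their product is a side function for
  -- `(-1)^α z`, unchanged under `glue`. The factor `(-1)^α` is itself peripherally trivial, which
  -- leaves `z`.
  have side : T.IsSideFunction (fun q => Additive.ofMul (s q * u q))
      (fun y => Additive.ofMul (D y * e y ^ 2)) := by
    refine ⟨fun y => ?_, fun y => ?_⟩
    · simp only [hm, he.medium, inv_pow, he.sq_inv, neg_mul_neg]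
    · have ev : eigenvalue e X .short y ^ 2 = u (quadOf y) ^ (T.sgn y : ℤ) := by
        apply Units.ext
        rw [he.eigenvalue_sq hX]
        rcases T.sgn_eq y with e | e <;> simp [e, u]
      have sg : s (quadOf y) ^ (T.sgn y : ℤ) = s (quadOf y) := by
        rcases T.sgn_eq y with e | e <;> simp [e, s, ← inv_pow]
      rw [← ofMul_zpow, ← ofMul_mul, mul_zpow, sg, ← ev, hs, he.short]
      congr 1
      change _ * _ * (s (quadOf y) * _) = _
      rw [mul_comm, mul_mul_mul_comm, mul_comm (e y ^ 2), mul_comm, mul_mul_mul_comm]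
  have triv := side.isPeripherallyTrivial fun y => by simp only [hg, he.glue]
  have triv' : T.IsPeripherallyTrivial fun q => Additive.ofMul (s q) := by
    have := isPeripherallyTrivial_map
      ((MonoidHom.toAdditive Circle.toUnits).comp signHom) (evenAngles_peripheral hα)
    convert this using 2 with q
    simp only [AddMonoidHom.comp_apply]
    exact congrArg Additive.ofMul (show s q = Circle.toUnits ((-1) ^ (α q).val) from
      Units.ext (by simp [s]))
  have prod : ∀ {v : T.Quad → ℂˣ}, T.IsPeripherallyTrivial (fun q => Additive.ofMul (v q)) →
      ∀ γ : T.PeripheralCurve, ∏ q, v q ^ γ.coeff q = 1 := fun hv γ => by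
    apply Additive.ofMul.injective
    rw [ofMul_prod]
    exact hv γ
  intro γ
  have h₁ := prod triv γ
  simp only [mul_zpow, Finset.prod_mul_distrib, prod triv' γ, one_mul] at h₁
  simpa [u] using congrArg Units.val h₁

end

end FacePairing

theorem mainTheorem1 {N : ℕ} (T : FacePairing N) (hT : T.IsIdealTriangulation) :
    ∃ (Φ : T.SA → T.H2) (Φ₀ : T.SA₀ → T.H2rel),
      IsLocallyConstant Φ ∧ IsLocallyConstant Φ₀ ∧
      -- the induced maps on the sets of connected components
      (∃ π₀Φ₀ : ConnectedComponents T.SA₀ → T.H2rel,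
        (∀ ω : T.SA₀, π₀Φ₀ (ConnectedComponents.mk ω) = Φ₀ ω) ∧ Function.Bijective π₀Φ₀) ∧
      (∃ π₀Φ : ConnectedComponents T.SA → T.H2,
        (∀ ω : T.SA, π₀Φ (ConnectedComponents.mk ω) = Φ ω) ∧ Function.Injective π₀Φ ∧
          Set.range π₀Φ = (LinearMap.ker T.restrict : Set T.H2)) ∧
      -- the values at the angle structures with values 1 and -1 and with even parity
      (∀ α ∈ T.evenAngles, ∃ (h : FacePairing.signs α ∈ T.SA) (h₀ : FacePairing.signs α ∈ T.SA₀),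
        T.Represents (T.rect α, 0) (Φ ⟨FacePairing.signs α, h⟩) ∧
          T.RepresentsRel (T.rect α) (Φ₀ ⟨FacePairing.signs α, h₀⟩)) ∧
      -- the values at the angle structures that come from algebraic solutions
      ∀ z : T.Quad → ℂ, T.IsAlgebraicSolution z →
        ∃ ω : T.SA, (∀ q, ((ω : T.Quad → Circle) q : ℂ) = z q / ‖z q‖) ∧
          (∃ W f, T.IsEdgeFlattening z W f) ∧
          (∀ W f, T.IsEdgeFlattening z W f →
            (fun q => (f q : ZMod 2)) ∈ T.evenAngles ∧
            (∃ h : FacePairing.signs (fun q => (f q : ZMod 2)) ∈ T.SA,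
              ConnectedComponents.mk (⟨_, h⟩ : T.SA) = ConnectedComponents.mk ω) ∧
            T.Represents (T.rect fun q => (f q : ZMod 2), 0) (Φ ω)) ∧
          ∀ x : T.Flag,
            (∃ ρ : T.FundGroup x →* PSL(2, ℂ), T.IsDeterminedBy z ρ) ∧
            ∀ ρ : T.FundGroup x →* PSL(2, ℂ), T.IsDeterminedBy z ρ →
              T.IsObstruction ρ (Φ ω) ∧
              (T.IsComplete z → T.IsBoundaryParabolic ρ) ∧
              (T.IsBoundaryParabolic ρ →
                ∃ h₀ : (ω : T.Quad → Circle) ∈ T.SA₀,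
                  T.IsRelObstruction ρ (Φ₀ ⟨ω, h₀⟩) ∧
                  (∃ W f, T.IsStrongFlattening z W f) ∧
                  ∀ W f, T.IsStrongFlattening z W f →
                    (∃ h : FacePairing.signs (fun q => (f q : ZMod 2)) ∈ T.SA₀,
                      ConnectedComponents.mk (⟨_, h⟩ : T.SA₀) =
                        ConnectedComponents.mk (⟨ω, h₀⟩ : T.SA₀)) ∧
                    T.RepresentsRel (T.rect fun q => (f q : ZMod 2)) (Φ₀ ⟨ω, h₀⟩)) := by
  obtain ⟨Φ, hΦ⟩ := FacePairing.exists_isClassMap hT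
  obtain ⟨Φ₀, hΦ₀⟩ := FacePairing.exists_isRelClassMap hT
  have loc := FacePairing.IsClassMap.isLocallyConstant hT hΦ
  have loc₀ := FacePairing.IsRelClassMap.isLocallyConstant hT hΦ₀
  refine ⟨Φ, Φ₀, loc, loc₀, ?_, ?_, fun α hα => ?_, fun z hz => ?_⟩
  · obtain ⟨Ψ, h, inj, hr⟩ := FacePairing.exists_map_connectedComponents loc₀ fun _ _ =>
      FacePairing.IsRelClassMap.mk_eq hT hΦ₀
    refine ⟨Ψ, h, inj, Set.range_eq_univ.mp ?_⟩
    rw [hr, (FacePairing.IsRelClassMap.surjective hT hΦ₀).range_eq]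
  · obtain ⟨Ψ, h, inj, hr⟩ := FacePairing.exists_map_connectedComponents loc fun _ _ =>
      FacePairing.IsClassMap.mk_eq hT hΦ
    exact ⟨Ψ, h, inj, hr.trans (FacePairing.IsClassMap.range_eq hT hΦ)⟩
  · have h₀ := FacePairing.signs_mem_SA₀ hα
    exact ⟨h₀.1, h₀, hΦ.signs hα h₀.1, hΦ₀.signs hα h₀⟩
  have class_eq : ∀ W f, T.IsEdgeFlattening z W f →
      T.Represents (T.rect fun q => (f q : ZMod 2), 0) (Φ ⟨_, hz.unitPart_mem_SA⟩) :=
    fun W f h => hΦ _ _ _ (h.mem_evenAngles hz) h.isTangent_im (h.unitPart_eq hz)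
  refine ⟨⟨_, hz.unitPart_mem_SA⟩, fun q => FacePairing.coe_unitPart (hz.ne_zero q),
    FacePairing.exists_isEdgeFlattening hT hz, fun W f h => ⟨h.mem_evenAngles hz,
      ⟨(FacePairing.signs_mem_SA₀ (h.mem_evenAngles hz)).1, ?_⟩, class_eq W f h⟩, fun x => ?_⟩
  · exact (FacePairing.mk_eq_of_expMul h.isTangent_im (h.unitPart_eq hz)).symm
  obtain ⟨W, f, h⟩ := FacePairing.exists_isEdgeFlattening hT hz
  have hα := h.mem_evenAngles hz
  obtain ⟨e, he⟩ := FacePairing.exists_isSpinStructure hα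
  obtain ⟨n, hg, hs⟩ := h.isTangent.exists_discPotential
  have hX := h.isShapeRoot hg hs
  refine ⟨FacePairing.exists_isDeterminedBy hz he hX x, fun ρ hρ => ?_⟩
  have lift := hρ.isLift hz he hX
  -- For a strong flattening the side function can be taken unchanged under `glue`. It then also
  -- serves as the potential around the edges, and it is constant along medium edges as unipotence
  -- requires.
  have unip : ∀ W f, T.IsStrongFlattening z W f → ∃ L : T.Labelling SL(2, ℂ),
      T.IsLift ρ L (T.rect fun q => (f q : ZMod 2), 0) ∧ T.IsBoundaryUnipotent L := fun W f h => by
    obtain ⟨e, he⟩ := FacePairing.exists_isSpinStructure (h.mem_evenAngles hz)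
    obtain ⟨l, hl, hg⟩ := FacePairing.exists_glue_sideFunction h.isTangent.tet
      h.isPeripherallyTrivial
    have hX := h.isShapeRoot hg hl.short
    exact ⟨_, hρ.isLift hz he hX, FacePairing.shapeLift_isBoundaryUnipotent he hX fun y => by
      simp only [hl.medium]⟩
  refine ⟨lift.isObstruction hT (class_eq W f h), fun hc => ?_, fun hp => ?_⟩
  · obtain ⟨W, f, h⟩ := FacePairing.exists_isStrongFlattening hT hz hc
    obtain ⟨L, hL, hu⟩ := unip W f h
    exact hL.isBoundaryParabolic hu
  -- Completeness is deduced from the lift of an arbitrary edge flattening; only then are strong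
  -- flattenings available for the relative statement.
  · have hc := lift.isComplete hT hz hα he hX hp
    have h₀ := hz.unitPart_mem_SA₀ hc
    have rel : ∀ W f, T.IsStrongFlattening z W f →
        T.RepresentsRel (T.rect fun q => (f q : ZMod 2)) (Φ₀ ⟨_, h₀⟩) :=
      fun W f h => hΦ₀ _ _ _ (h.mem_evenAngles hz) h.isTangent_im h.isPeripherallyTrivial_im
        (h.unitPart_eq hz)
    obtain ⟨W, f, h⟩ := FacePairing.exists_isStrongFlattening hT hz hc
    obtain ⟨L, hL, hu⟩ := unip W f h
    refine ⟨h₀, hL.isRelObstruction hT hu (rel W f h), ⟨W, f, h⟩, fun W f h =>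
      ⟨⟨FacePairing.signs_mem_SA₀ (h.mem_evenAngles hz), ?_⟩, rel W f h⟩⟩
    exact (FacePairing.mk_eq_of_expMul₀ h.isTangent_im h.isPeripherallyTrivial_im
      (h.unitPart_eq hz)).symm
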